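/- **Setup.** Let $\mathfrak g$ be a finite-dimensional simple complex Lie algebra with Cartan subalgebra $\mathfrak h$ and Chevalley generators $e_i,f_i,h_i$ $(i=1,\dots,r)$, simple roots $\alpha_i$, highest root $\theta=\sum_i a_i\alpha_i$, and put $A=\sum_i a_i$. Let $(\cdot,\cdot)$ be the invariant bilinear form on $\mathfrak h^*$ with $(\theta,\theta)=2$, and let $\kappa$ be a nonzero complex number. Fix weights $\Lambda_1,\dots,\Lambda_n\in\mathfrak h^*$, distinct $z_1,\dots,z_n\in\mathbb C$, integers $M\ge 0$, $m\ge 1$, a map $\pi_1:[M]\to[r]$, and a map $\pi_2:[A]\to[r]$ with $|\pi_2^{-1}(i)|=a_i$ for all $i$. For a sequence $I=(i_1,\dots,i_N)$ put $[f_I]=\mathrm{ad}(f_{i_N})\cdots\mathrm{ad}(f_{i_2})(f_{i_1})$. Fix a nonzero root vector $f_\theta=c_\theta[f_{I(\theta)}]\in\mathfrak g_{-\theta}$ with $c_\theta\in\mathbb C^\times$, $I(\theta)\in[r]^A$, and $J(\theta)=(j_1,\dots,j_A)$ with pairwise distinct $j_p\in[A]$ and $\pi_2(j_p)=I(\theta)_p$.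 Fix disjoint sequences $I_1,\dots,I_n$ without repetitions whose union is $[M]$ (the set of elements of $I_s$ is also denoted $I_s$). Take variables $u_i$ $(i\in[M])$ and $v_j(p)$ $(j\in[A],\,p\in[m])$; give $u_i$ the simple root $\alpha(u_i)=\alpha_{\pi_1(i)}$ and $v_j(p)$ the simple root $\alpha(v_j(p))=\alpha_{\pi_2(j)}$. The exponents are $a(x,y)=(\alpha(x),\alpha(y))/\kappa$ and $a(x,z_s)=-(\alpha(x),\Lambda_s)/\kappa$. Put $e_{ij}=a(v_i(p),v_j(p))$ and $$a=\sum_{j,s}a(v_j(p),z_s),\quad b=\sum_{i>j}e_{ij},\quad c=\sum_{i,j}e_{ij},\quad d=\sum_{i,j}a(v_i(p),u_j),\qquad C(j)=j+ja+jb+\tfrac{j(j-1)}2c+jd.$$ For a sequence of variables $(x_1,\dots,x_N)$ put $$A_{(x_1,\dots,x_N)}=\prod_{p=2}^N\sum_{q<p}\frac{a(x_p,x_q)}{x_p-x_q},\qquad B_{(x_1,\dots,x_N);z_s}=\prod_{p=1}^N\Bigl(\frac{a(x_p,z_s)}{x_p-z_s}+\sum_{q<p}\frac{a(x_p,x_q)}{x_p-x_q}\Bigr).$$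 Let $A_{J(\theta)}(v(p))$ be the function $A$ of the sequence $(v_{j_1}(p),\dots,v_{j_A}(p))$, and let $B_{I_1,\dots,I_n}(u;z)$ be the product over $s$ of the functions $B_{\,\cdot\,;z_s}$ of the sequences $(u_i)_{i\in I_s}$. Consider the formal symbols $$l_{\Lambda''}(u)=\prod_{i,s}(u_i-z_s)^{a(u_i,z_s)}\prod_{i>j}(u_i-u_j)^{a(u_i,u_j)},\qquad l_\theta(v(p))=\prod_{i,s}(v_i(p)-z_s)^{a(v_i(p),z_s)}\prod_{i>j}(v_i(p)-v_j(p))^{e_{ij}},$$ $$\textstyle\prod(v(p),u)=\prod_{i,j}(v_i(p)-u_j)^{a(v_i(p),u_j)},\qquad \prod(v(p),v(q))=\prod_{i,j}(v_i(p)-v_j(q))^{e_{ij}},$$ $$l(u,v)=l_{\Lambda''}(u)\prod_p l_\theta(v(p))\prod_p\textstyle\prod(v(p),u)\displaystyle\prod_{p>q}\textstyle\prod(v(p),v(q)).$$ Expressions (symbol)$\cdot$(rational form) are multiplied in the obvious way and differentiated formally, $d(l\omega)=l\,(d\omega+d\log l\wedge\omega)$. Let $du=du_1\wedge\dots\wedge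 du_M$, $dv(p)=dv_1(p)\wedge\dots\wedge dv_A(p)$, $dv=dv(1)\wedge\dots\wedge dv(m)$ and $\nu(v(p))=\sum_{q}(-1)^{q-1}v_q(p)\,dv_1(p)\wedge\dots\widehat{dv_q(p)}\dots\wedge dv_A(p)$. Set $$\tilde\Omega(p)=c_\theta\,d\bigl\{l_\theta(v(p))\,\textstyle\prod(v(p),v(p-1))\cdots\prod(v(p),v(1))\,\prod(v(p),u)\;A_{J(\theta)}(v(p))\,\nu(v(p))\bigr\}.$$ Let $\Sigma$ be the group of permutations of all the variables that preserve the assigned simple roots. It acts on rational functions by permuting the variables, and on expressions $f\,l(u,v)\,dx_1\wedge\dots\wedge dx_k$ by permuting the variables in $f$ and in the $dx_i$ and fixing the symbol $l(u,v)$. Put $\mathrm{Sym}=\sum_{\sigma\in\Sigma}\sigma$, $\mathcal A=\sum_{\sigma\in\Sigma}(-1)^{|\sigma|}\sigma$. Finally, for $0\le i\le m$ let $W_i(u,v)$ be the sum, over all $i$-tuples $(p_1,\dots,p_i)$ of distinct elements of $[m]$, all $s_1,\dots,s_i\in[n]$, all $q_1,\dots,q_i\in[A]$ and all choices of $$t_k\in\{z_{s_k}\}\cup\{u_j:j\in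 I_{s_k}\}\cup\bigcup_{k'<k,\ s_{k'}=s_k}\{v_j(p_{k'}):j\in[A]\}\qquad(1\le k\le i),$$ of the products $\prod_{k=1}^i z_{s_k}\,\dfrac{a(v_{q_k}(p_k),t_k)}{v_{q_k}(p_k)-t_k}$; thus $W_0=1$. **Theorem (Resonance identity).** The form $$\Omega_m=\mathcal A\bigl(B_{I_1,\dots,I_n}(u;z)\;l_{\Lambda''}(u)\;du\wedge\tilde\Omega(1)\wedge\dots\wedge\tilde\Omega(m)\bigr)$$ satisfies $$\Omega_m=\frac{c_\theta^m}{m!}\;l(u,v)\,du\,dv\cdot\mathrm{Sym}\Bigl\{B_{I_1,\dots,I_n}(u;z)\,A_{J(\theta)}(v(1))\cdots A_{J(\theta)}(v(m))\sum_{i=0}^m\Bigl(\prod_{j=i+1}^mC(j)\Bigr)W_i(u,v)\Bigr\}.$$ -/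

import Mathlib

open scoped TensorProduct

noncomputable section

/-! ### Rational functions and rational differential forms in variables indexed by `T` -/

/-- The field `ℂ(t_x : x ∈ T)` of rational functions. -/
def RatField (T : Type) : Type := FractionRing (MvPolynomial T ℂ)

instance (T : Type) : Field (RatField T) :=
  inferInstanceAs (Field (FractionRing (MvPolynomial T ℂ)))

instance (T : Type) : Algebra (MvPolynomial T ℂ) (RatField T) :=
  inferInstanceAs (Algebra (MvPolynomial T ℂ) (FractionRing (MvPolynomial T ℂ)))

instance (T : Type) : IsFractionRing (MvPolynomial T ℂ) (RatField T) :=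
  inferInstanceAs (IsFractionRing (MvPolynomial T ℂ) (FractionRing (MvPolynomial T ℂ)))

instance (T : Type) : Algebra ℂ (RatField T) :=
  inferInstanceAs (Algebra ℂ (FractionRing (MvPolynomial T ℂ)))

instance (T : Type) : IsScalarTower ℂ (MvPolynomial T ℂ) (RatField T) :=
  inferInstanceAs (IsScalarTower ℂ (MvPolynomial T ℂ) (FractionRing (MvPolynomial T ℂ)))

/-- The variable `t_x`. -/
def tvar {T : Type} (x : T) : RatField T :=
  algebraMap (MvPolynomial T ℂ) (RatField T) (MvPolynomial.X x)

/-- The constant rational function `c`. -/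
def cst {T : Type} (c : ℂ) : RatField T := algebraMap ℂ (RatField T) c

open Classical in
/-- Evaluation `f ↦ f(t + ε e_x)` of polynomials in the dual numbers over the field of rational
functions; its `ε`-coefficient is the partial derivative with respect to `t_x`. -/
def dualEval {T : Type} (x : T) :
    MvPolynomial T ℂ →ₐ[ℂ] TrivSqZeroExt (RatField T) (RatField T) :=
  MvPolynomial.aeval fun y =>
    TrivSqZeroExt.inl (tvar y) + if y = x then TrivSqZeroExt.inr 1 else 0

theorem fst_dualEval {T : Type} (x : T) (p : MvPolynomial T ℂ) :
    (dualEval x p).fst = algebraMap (MvPolynomial T ℂ) (RatField T) p := by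
  have h : (TrivSqZeroExt.fstHom ℂ (RatField T) (RatField T)).comp (dualEval x) =
      IsScalarTower.toAlgHom ℂ (MvPolynomial T ℂ) (RatField T) := by
    ext y
    by_cases hy : y = x <;> simp [dualEval, tvar, hy]
  exact DFunLike.congr_fun h p

theorem isUnit_dualEval {T : Type} (x : T) (p : nonZeroDivisors (MvPolynomial T ℂ)) :
    IsUnit (dualEval x (p : MvPolynomial T ℂ)) := by
  rw [TrivSqZeroExt.isUnit_iff_isUnit_fst, fst_dualEval]
  exact IsLocalization.map_units (RatField T) p

/-- The partial derivative `∂/∂t_x` of rational functions. -/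
def pderivRat {T : Type} (x : T) : RatField T →ₗ[ℂ] RatField T where
  toFun f := (IsLocalization.liftAlgHom (M := nonZeroDivisors (MvPolynomial T ℂ))
    (S := RatField T) (f := dualEval x) (isUnit_dualEval x) f).snd
  map_add' f g := by rw [map_add, TrivSqZeroExt.snd_add]
  map_smul' c f := by rw [map_smul, TrivSqZeroExt.snd_smul, RingHom.id_apply]

theorem injective_permPoly {T : Type} (σ : Equiv.Perm T) :
    Function.Injective ((IsScalarTower.toAlgHom ℂ (MvPolynomial T ℂ) (RatField T)).comp
      (MvPolynomial.rename σ)) := by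
  intro p q h
  exact MvPolynomial.rename_injective σ σ.injective
    (IsFractionRing.injective (MvPolynomial T ℂ) (RatField T) h)

/-- The action of a permutation of the variables on rational functions: the field automorphism
with `t_x ↦ t_{σ x}`. -/
def permRat {T : Type} (σ : Equiv.Perm T) : RatField T →ₐ[ℂ] RatField T :=
  IsFractionRing.liftAlgHom (K := RatField T) (injective_permPoly σ)

/-- The algebra of rational differential forms: rational functions tensored with the exterior
algebra on the symbols `dt_x`. The product is the wedge product. -/
abbrev RatForm (T : Type) : Type := RatField T ⊗[ℂ] ExteriorAlgebra ℂ (T →₀ ℂ)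

/-- A rational function as a form of degree zero. -/
def fnForm {T : Type} (f : RatField T) : RatForm T := f ⊗ₜ[ℂ] 1

/-- The `1`-form `dt_x`. -/
def dvar {T : Type} (x : T) : RatForm T :=
  1 ⊗ₜ[ℂ] ExteriorAlgebra.ι ℂ (Finsupp.single x (1 : ℂ))

/-- The de Rham differential `f ω ↦ ∑_x (∂f/∂t_x) dt_x ∧ ω` (`ω` with constant coefficients). -/
def deRham {T : Type} [Fintype T] : RatForm T →ₗ[ℂ] RatForm T :=
  ∑ x : T, LinearMap.mulLeft ℂ (dvar x) ∘ₗ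
    LinearMap.rTensor (ExteriorAlgebra ℂ (T →₀ ℂ)) (pderivRat x)

/-- The action `f(t) dt_{x₁} ∧ ⋯ ∧ dt_{xₖ} ↦ f(σ t) dt_{σ x₁} ∧ ⋯ ∧ dt_{σ xₖ}`. -/
def permForm {T : Type} (σ : Equiv.Perm T) : RatForm T →ₐ[ℂ] RatForm T :=
  Algebra.TensorProduct.map (permRat σ)
    (ExteriorAlgebra.map (Finsupp.lmapDomain ℂ ℂ σ))

/-- For a tuple of variables `t₁, …, t_N`, the form
`∑_q (-1)^{q-1} t_q dt₁ ∧ ⋯ ∧ \hat{dt_q} ∧ ⋯ ∧ dt_N`. -/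
def nuForm {T : Type} {N : ℕ} (x : Fin N → T) : RatForm T :=
  ∑ q : Fin N, (-1 : ℂ) ^ (q : ℕ) •
    (fnForm (tvar (x q)) * (((List.finRange N).erase q).map fun j => dvar (x j)).prod)

/-! ### Formal symbols and twisted forms -/

/-- Formal products `∏_f f^{c_f}` of complex powers of rational functions. The group of symbols is
written additively: `f^c` is `Finsupp.single f c` and `+` is the product of symbols. -/
abbrev PowSymbol (T : Type) : Type := RatField T →₀ ℂ

/-- The symbol `f^c`. -/
def fpow {T : Type} (f : RatField T) (c : ℂ) : PowSymbol T := Finsupp.single f c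

/-- `dlog (∏ f^{c_f}) = ∑ c_f df / f`. -/
def dlogForm {T : Type} [Fintype T] (l : PowSymbol T) : RatForm T :=
  l.sum fun f c => c • (fnForm f⁻¹ * deRham (fnForm f))

/-- Finite sums of expressions `l · ω`, with `l` a symbol and `ω` a rational form, multiplied by
`(l · ω)(l' · ω') = l l' · (ω ∧ ω')`. -/
abbrev TwForm (T : Type) : Type := AddMonoidAlgebra (RatForm T) (PowSymbol T)

/-- The expression `l · ω`. -/
def tw {T : Type} (l : PowSymbol T) (ω : RatForm T) : TwForm T := AddMonoidAlgebra.single l ω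

/-- Formal differentiation `d (l · ω) = l · (dω + dlog l ∧ ω)`. -/
def twD {T : Type} [Fintype T] (w : TwForm T) : TwForm T :=
  w.coeff.sum fun l ω => tw l (deRham ω + dlogForm l * ω)

/-- The action of a permutation of the variables on twisted forms; it permutes the variables and
their differentials in the coefficient and leaves the symbol alone. -/
def permTw {T : Type} (σ : Equiv.Perm T) (w : TwForm T) : TwForm T :=
  w.coeff.sum fun l ω => tw l (permForm σ ω)

open Classical in
/-- The permutations of the variables that preserve a colouring. -/
def colourPerms {T : Type} {ι : Type*} [Fintype T] (col : T → ι) : Finset (Equiv.Perm T) :=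
  Finset.univ.filter fun σ => ∀ x, col (σ x) = col x

/-- Symmetrisation of rational functions over the colour preserving permutations. -/
def symRat {T : Type} {ι : Type*} [Fintype T] (col : T → ι) (f : RatField T) : RatField T :=
  ∑ σ ∈ colourPerms col, permRat σ f

open Classical in
/-- Skew symmetrisation of twisted forms over the colour preserving permutations. -/
def skewTw {T : Type} {ι : Type*} [Fintype T] (col : T → ι) (w : TwForm T) : TwForm T :=
  ∑ σ ∈ colourPerms col, ((Equiv.Perm.sign σ : ℤˣ) : ℤ) • permTw σ w

/-! ### The rational functions `A` and `B` of a sequence of variables -/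

/-- `∏_{p ≥ 2} ∑_{q < p} e(x_p, x_q) / (x_p - x_q)`. -/
def funA {T : Type} (e : T → T → ℂ) {N : ℕ} (x : Fin N → T) : RatField T :=
  ∏ p : Fin N with 0 < p.val,
    ∑ q : Fin N with q < p, cst (e (x p) (x q)) / (tvar (x p) - tvar (x q))

/-- `∏_p (e(x_p, z) / (x_p - z) + ∑_{q < p} e(x_p, x_q) / (x_p - x_q))`, for a point `z ∈ ℂ` with
exponents `ez x = e(x, z)`. -/
def funB {T : Type} (e : T → T → ℂ) (z : ℂ) (ez : T → ℂ) {N : ℕ} (x : Fin N → T) :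
    RatField T :=
  ∏ p : Fin N, (cst (ez (x p)) / (tvar (x p) - cst z) +
    ∑ q : Fin N with q < p, cst (e (x p) (x q)) / (tvar (x p) - tvar (x q)))

/-! ### The data and the objects of the resonance identity -/

/-- The variables `u_i`, `i ∈ [M]`, and `v_j(p)`, `p ∈ [m]`, `j ∈ [A]`. -/
abbrev ResVar (M m A : ℕ) : Type := Fin M ⊕ (Fin m × Fin A)

/-- Combinatorial data: points `z_s`, colourings of the `u_i` and of the `v_j(p)` by the index set
of simple roots, the exponent between two variables and between a variable and `z_s` as functions
of colours, sequences of indices of `u`'s, and a sequence of indices of `v(p)`'s. -/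
structure ResData (ι : Type*) (n M A : ℕ) where
  z : Fin n → ℂ
  colU : Fin M → ι
  colV : Fin A → ι
  ex : ι → ι → ℂ
  exz : ι → Fin n → ℂ
  seqI : Fin n → List (Fin M)
  seqJ : Fin A → Fin A

namespace ResData

variable {ι : Type*} {n M A : ℕ} (D : ResData ι n M A) (m : ℕ)

/-- The variable `u_i`. -/
def u (m A : ℕ) {M : ℕ} (i : Fin M) : ResVar M m A := Sum.inl i

/-- The variable `v_j(p)`. -/
def v (M : ℕ) {m A : ℕ} (p : Fin m) (j : Fin A) : ResVar M m A := Sum.inr (p, j)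

/-- The colour of a variable. -/
def col : ResVar M m A → ι := Sum.elim D.colU fun pj => D.colV pj.2

/-- The exponent `a(x, y)` of two variables. -/
def exv (x y : ResVar M m A) : ℂ := D.ex (D.col m x) (D.col m y)

/-- The exponent `a(x, z_s)`. -/
def exvz (x : ResVar M m A) (s : Fin n) : ℂ := D.exz (D.col m x) s

/-- `a = ∑_{j,s} a(v_j(p), z_s)`. -/
def numA : ℂ := ∑ j : Fin A, ∑ s : Fin n, D.exz (D.colV j) s

/-- `b = ∑_{i>j} e_{ij}`, where `e_{ij} = a(v_i(p), v_j(p))`. -/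
def numB : ℂ := ∑ i : Fin A, ∑ j : Fin A with j < i, D.ex (D.colV i) (D.colV j)

/-- `c = ∑_{i,j} e_{ij}`. -/
def numC : ℂ := ∑ i : Fin A, ∑ j : Fin A, D.ex (D.colV i) (D.colV j)

/-- `d = ∑_{i,j} a(v_i(p), u_j)`. -/
def numD : ℂ := ∑ i : Fin A, ∑ j : Fin M, D.ex (D.colV i) (D.colU j)

/-- `C(j) = j + j a + j b + (j (j - 1) / 2) c + j d`. -/
def constC (j : ℕ) : ℂ :=
  j + j * D.numA + j * D.numB + (j : ℂ) * ((j : ℂ) - 1) / 2 * D.numC + j * D.numD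

/-- `l_{Λ''}(u) = ∏_{i,s} (u_i - z_s)^{a(u_i,z_s)} ∏_{i>j} (u_i - u_j)^{a(u_i,u_j)}`. -/
def symU : PowSymbol (ResVar M m A) :=
  (∑ i : Fin M, ∑ s : Fin n,
    fpow (tvar (u m A i) - cst (D.z s)) (D.exvz m (u m A i) s)) +
  ∑ i : Fin M, ∑ j : Fin M with j < i,
    fpow (tvar (u m A i) - tvar (u m A j)) (D.exv m (u m A i) (u m A j))

/-- `l_θ(v(p)) = ∏_{i,s} (v_i(p) - z_s)^{a(v_i(p),z_s)} ∏_{i>j} (v_i(p) - v_j(p))^{e_{ij}}`. -/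
def symTheta (p : Fin m) : PowSymbol (ResVar M m A) :=
  (∑ i : Fin A, ∑ s : Fin n,
    fpow (tvar (v M p i) - cst (D.z s)) (D.exvz m (v M p i) s)) +
  ∑ i : Fin A, ∑ j : Fin A with j < i,
    fpow (tvar (v M p i) - tvar (v M p j)) (D.exv m (v M p i) (v M p j))

/-- `∏(v(p), v(q)) = ∏_{i,j} (v_i(p) - v_j(q))^{a(v_i(p),v_j(q))}`. -/
def symVV (p q : Fin m) : PowSymbol (ResVar M m A) :=
  ∑ i : Fin A, ∑ j : Fin A,
    fpow (tvar (v M p i) - tvar (v M q j)) (D.exv m (v M p i) (v M q j))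

/-- `∏(v(p), u) = ∏_{i,j} (v_i(p) - u_j)^{a(v_i(p),u_j)}`. -/
def symVU (p : Fin m) : PowSymbol (ResVar M m A) :=
  ∑ i : Fin A, ∑ j : Fin M,
    fpow (tvar (v M p i) - tvar (u m A j)) (D.exv m (v M p i) (u m A j))

/-- `l(u,v) = l_{Λ''}(u) · ∏_p l_θ(v(p)) · ∏_p ∏(v(p),u) · ∏_{p>q} ∏(v(p),v(q))`. -/
def symL : PowSymbol (ResVar M m A) :=
  D.symU m + ((∑ p : Fin m, D.symTheta m p) + (∑ p : Fin m, D.symVU m p) +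
    ∑ p : Fin m, ∑ q : Fin m with q < p, D.symVV m p q)

/-- `B_{I_1,…,I_n}(u; z) = ∏_s B_{I_s}(u_{I_s}; z_s)`. -/
def prodB : RatField (ResVar M m A) :=
  ∏ s : Fin n, funB (D.exv m) (D.z s) (fun x => D.exvz m x s)
    fun k => u m A ((D.seqI s).get k)

/-- `A_J(v(p))`. -/
def funAJ (p : Fin m) : RatField (ResVar M m A) :=
  funA (D.exv m) fun k => v M p (D.seqJ k)

/-- `du = du_1 ∧ ⋯ ∧ du_M`. -/
def du (M m A : ℕ) : RatForm (ResVar M m A) := (List.ofFn fun i : Fin M => dvar (u m A i)).prod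

/-- `dv = dv(1) ∧ ⋯ ∧ dv(m)`, where `dv(p) = dv_1(p) ∧ ⋯ ∧ dv_A(p)`. -/
def dv (M m A : ℕ) : RatForm (ResVar M m A) :=
  (List.ofFn fun p : Fin m => (List.ofFn fun j : Fin A => dvar (v M p j)).prod).prod

/-- `c · d { l_θ(v(p)) ∏(v(p),v(p-1)) ⋯ ∏(v(p),v(1)) ∏(v(p),u) · A_J(v(p)) · ν(v(p)) }`. -/
def omegaFactor (c : ℂ) (p : Fin m) : TwForm (ResVar M m A) :=
  c • twD (tw (D.symTheta m p + (∑ q : Fin m with q < p, D.symVV m p q) + D.symVU m p)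
    (fnForm (D.funAJ m p) * nuForm fun j => v M p j))

/-- `B_{I_1,…,I_n}(u; z) l_{Λ''}(u) du ∧ Ω̃(1) ∧ ⋯ ∧ Ω̃(m)`. -/
def omegaTilde (c : ℂ) : TwForm (ResVar M m A) :=
  tw (D.symU m) (fnForm (D.prodB m) * du M m A) *
    (List.ofFn fun p : Fin m => D.omegaFactor m c p).prod

/-- The skew symmetrisation `Ω_m` of `omegaTilde`. -/
def omega (c : ℂ) : TwForm (ResVar M m A) := skewTw (D.col m) (D.omegaTilde m c)

/-- The points that the `j`-th factor of an admissible term with indices `s` and `p` may be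
attached to: `z_{s_j}`, the `u_i` with `i` in the sequence `I_{s_j}`, and the variables of those
`v(p_k)` with `k < j` and `s_k = s_j`. -/
def Admissible {i : ℕ} (s : Fin i → Fin n) (p : Fin i → Fin m) (j : Fin i) :
    ResVar M m A ⊕ Fin n → Prop
  | Sum.inl (Sum.inl k) => k ∈ D.seqI (s j)
  | Sum.inl (Sum.inr (r, _)) => ∃ k : Fin i, k < j ∧ s k = s j ∧ p k = r
  | Sum.inr s' => s' = s j

/-- The rational function given by a variable or by a point `z_s`. -/
def pt : ResVar M m A ⊕ Fin n → RatField (ResVar M m A) :=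
  Sum.elim tvar fun s => cst (D.z s)

/-- The exponent of a variable with a variable or with a point `z_s`. -/
def exPt (x : ResVar M m A) : ResVar M m A ⊕ Fin n → ℂ := Sum.elim (D.exv m x) (D.exvz m x)

open Classical in
/-- The sum `W^{(p_1,…,p_i)}` of all admissible terms
`∏_j z_{s_j} a(v_{q_j}(p_j), t_j) / (v_{q_j}(p_j) - t_j)` for given `p_1, …, p_i`. -/
def funWp {i : ℕ} (p : Fin i → Fin m) : RatField (ResVar M m A) :=
  ∑ s : Fin i → Fin n, ∑ q : Fin i → Fin A,
    ∑ t : Fin i → ResVar M m A ⊕ Fin n with ∀ j, D.Admissible m s p j (t j),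
      ∏ j : Fin i, cst (D.z (s j)) *
        (cst (D.exPt m (v M (p j) (q j)) (t j)) / (tvar (v M (p j) (q j)) - D.pt m (t j)))

/-- `W_i`, the sum of `W^{(p_1,…,p_i)}` over all `i`-tuples of distinct elements of `[m]`. -/
def funW (i : ℕ) : RatField (ResVar M m A) := ∑ p : Fin i ↪ Fin m, D.funWp m p

end ResData

/-! ### Lie theory -/

section LieTheory

open LieAlgebra Module

variable {𝔤 : Type*} [LieRing 𝔤] [LieAlgebra ℂ 𝔤]

/-- The commutator `ad(x_N) ∘ ⋯ ∘ ad(x_2) (x_1)` of a sequence `(x_1, …, x_N)`. -/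
def iterBracket : List 𝔤 → 𝔤
  | [] => 0
  | x :: l => l.foldl (fun y x' => ⁅x', y⁆) x

variable [FiniteDimensional ℂ 𝔤] [LieAlgebra.IsSimple ℂ 𝔤]
  {H : LieSubalgebra ℂ 𝔤} [H.IsCartanSubalgebra]

/-- `θ = ∑ a_i α_i` is the highest root with respect to the simple roots `α_i` of the Chevalley
generators `b`: every root is `θ` minus a sum of simple roots. -/
structure IsHighestRootWith {ι : Type*} [Fintype ι] (b : LieAlgebra.Basis ι H) (θ : H.root)
    (a : ι → ℕ) : Prop where
  eq_sum : θ.1.toLinear = ∑ i, a i • b.baseSupp i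
  le_highest : ∀ β : H.root, ∃ k : ι → ℕ,
    θ.1.toLinear = β.1.toLinear + ∑ i, k i • b.baseSupp i

/-- The bilinear form on `H*` that comes from the Killing form, rescaled so that
`(θ, θ) = 2`. -/
def normForm (θ : H.root) (χ μ : Dual ℂ H) : ℂ :=
  2 * χ ((IsKilling.cartanEquivDual H).symm μ) /
    θ.1 ((IsKilling.cartanEquivDual H).symm θ.1.toLinear)

/-- The data of the resonance identity for Chevalley generators `b`, highest root `θ`, weights
`Λ_s` and points `z_s`: the exponents are `(α_i, α_j) / κ` and `-(α_i, Λ_s) / κ`. -/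
def lieResData {ι : Type*} [Fintype ι] (b : LieAlgebra.Basis ι H) (θ : H.root) (κ : ℂ)
    {n M A : ℕ} (Λ : Fin n → Dual ℂ H) (z : Fin n → ℂ) (π₁ : Fin M → ι) (π₂ : Fin A → ι)
    (I : Fin n → List (Fin M)) (J : Fin A → Fin A) : ResData ι n M A where
  z := z
  colU := π₁
  colV := π₂
  ex i j := normForm θ (b.baseSupp i) (b.baseSupp j) / κ
  exz i s := -normForm θ (b.baseSupp i) (Λ s) / κ
  seqI := I
  seqJ := J

end LieTheory

end

/-!
Two things happen: the differential in `Ω̃(p)` is computed by Euler's identity, and the resulting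
function is symmetrised.

**Forms.** The function `A_J(v(p))` is homogeneous of degree `1 - A`, so that `d (A_J(v(p))
ν(v(p))) = A_J(v(p)) dv(p)`, while `dlog` of the symbol contributes `∑ v_j(p) a(v_j(p), t) /
(v_j(p) - t)`, the sum over all `t` among the `z_s`, the `u_i` and the variables of the blocks
`v(q)`, `q ≤ p`. The differentials `du_i` and `dv_j(q)`, `q < p`, are killed by the preceding
factors of `Ω_m`. Hence `Ω_m` is `c_θ^m l(u, v) du dv` times the symmetrisation of `B A_J(v(1)) ⋯
A_J(v(m)) ∏_p E_p`, with `E_p` the function `ResData.eulerFactor` (`mul_twisted_nuForm`,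
`ResData.omega_eq`).

**Functions.** Let some of the blocks already be attached to points `z_s`, directly or through
other variables that stand there. For a further block, `v / (v - t) = 1 + z_s / (v - t) + (t - z_s)
/ (v - t)` for every variable `t` that stands at `z_s`. The first summands are constants; the
second ones attach the block to `z_s` and turn a term of `W_i` into one of `W_{i+1}`; the third
ones disappear when symmetrised. For two blocks that are not attached, symmetrisation over the
blocks makes a constant out of `x / (x - y) + y / (y - x)`. The constants add up to differences of
the `C(j)` (`ResData.partW_mul_eulerFactor`), and the identity follows by induction on the number
of blocks, a telescoping sum (`ResData.TreesVanish.symRat_prod_eulerFactor`). The factor `1 / m!`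
appears because all the orders of the blocks are equivalent.

**Vanishing of the third summands.** Here the Lie algebra enters. The functions `A` and `B` are the
counterparts of commutators and of products of the `f_i`: the function `A` of a sequence,
multiplied by the sum of the weights of its edges to a base point, expands into functions `B` just
as a commutator expands into words (`treeFun_mul_sum`). Multiplication by the differences `t - z_s`
cuts off a branch of the forest that stands at `z_s` (`forestFun_mul_sum`), and leaves the function
of the commutator of this branch with `f_θ`. As `f_θ` commutes with all the `f_i`, this has to be
zero after symmetrisation, and it is enough to see this for a single `f_i`
(`ResData.TreesVanish.symRat_eq_zero`).

For that, a relation `[f_X] = 0` between commutators has to imply that the symmetrisation of the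
function `A` of the sequence `X` is zero. It is enough to have `[f_X] v = 0` for one highest weight
vector `v` (`sum_perm_treeFun_eq_zero`): the function is multiplied by `∑_x a(x, s) / (x - s)`,
which is symmetric and not zero for a suitable point `s`, and expanded into functions `B`, then by
partial fractions into chains `1 / ((y₁ - s) (y₂ - y₁) ⋯)`. After symmetrisation, the coefficients
of the chains are, up to nonzero factors, the coefficients of `v` in `e_{y₁} ⋯ e_{y_N} [f_X] v`.
The adjoint representation with its highest weight `θ` serves the purpose, as `(θ, θ) ≠ 0`.
-/

set_option linter.unusedSectionVars false

noncomputable section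

/-! ### Tree and forest functions of a sequence -/

section Words

variable {L K : Type*} [CommRing K]

/-- The forest function of a sequence, listed from its last entry to its first: every entry `y` is
attached to the base point, with weight `β y`, or to an earlier entry `q`, with weight `k y q`. -/
def forestFun (k : L → L → K) (β : L → K) : List L → K
  | [] => 1
  | y :: w => forestFun k β w * (β y + (w.map (k y)).sum)

/-- The tree function of a sequence, listed from its last entry to its first: every entry `y` but
the first is attached to an earlier entry `q`, with weight `k y q`. -/
def treeFun (k : L → L → K) : List L → K
  | [] => 1
  | [_] => 1
  | y :: x :: w => treeFun k (x :: w) * ((x :: w).map (k y)).sum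

theorem treeFun_cons (k : L → L → K) (y : L) {w : List L} (hw : w ≠ []) :
    treeFun k (y :: w) = treeFun k w * (w.map (k y)).sum := by
  cases w with
  | nil => exact absurd rfl hw
  | cons x w => rfl

theorem forestFun_append (k : L → L → K) (β : L → K) (w w₀ : List L) :
    forestFun k β (w ++ w₀) =
      forestFun k (fun x => β x + (w₀.map (k x)).sum) w * forestFun k β w₀ := by
  induction w with
  | nil => simp [forestFun]
  | cons y w ih =>
    simp only [List.cons_append, forestFun, ih, List.map_append, List.sum_append]
    ring

/-- Appending entries to a tree: the new entries form a forest whose base is the tree. -/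
theorem treeFun_append (k : L → L → K) (w : List L) {w₀ : List L} (hw₀ : w₀ ≠ []) :
    treeFun k (w ++ w₀) = treeFun k w₀ * forestFun k (fun x => (w₀.map (k x)).sum) w := by
  induction w with
  | nil => simp [forestFun]
  | cons y w ih =>
    rw [List.cons_append, treeFun_cons _ _ (by simp [hw₀]), ih, forestFun, List.map_append,
      List.sum_append]
    ring

theorem forestFun_map {L' : Type*} (k : L → L → K) (β : L → K) (g : L' → L) (w : List L') :
    forestFun k β (w.map g) = forestFun (fun x y => k (g x) (g y)) (fun x => β (g x)) w := by
  induction w with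
  | nil => rfl
  | cons y w ih => simp [forestFun, ih, Function.comp_def]

theorem treeFun_map {L' : Type*} (k : L → L → K) (g : L' → L) (w : List L') :
    treeFun k (w.map g) = treeFun (fun x y => k (g x) (g y)) w := by
  induction w with
  | nil => rfl
  | cons y w ih =>
    cases w with
    | nil => rfl
    | cons x w =>
      rw [List.map_cons, treeFun_cons _ _ (by simp), ih,
        treeFun_cons _ _ (List.cons_ne_nil x w), List.map_map]
      rfl

theorem map_treeFun {K' F : Type*} [CommRing K'] [FunLike F K K'] [RingHomClass F K K'] (φ : F)
    (k : L → L → K) (w : List L) :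
    φ (treeFun k w) = treeFun (fun x y => φ (k x y)) w := by
  induction w with
  | nil => simp [treeFun]
  | cons y w ih =>
    cases w with
    | nil => simp [treeFun]
    | cons x w =>
      rw [treeFun_cons _ _ (List.cons_ne_nil x w), map_mul, ih,
        treeFun_cons _ _ (List.cons_ne_nil x w), map_list_sum, List.map_map]
      rfl

/-- The expansion of the iterated commutator `[x_N, […, [x₂, x₁]]]` as a signed sum of words. Like
the argument of `treeFun`, the list is `(x_N, …, x₁)`. -/
def bracketWords : List L → List (ℤ × List L)
  | [] => []
  | [x] => [(1, [x])]
  | y :: x :: l =>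
    (bracketWords (x :: l)).map (fun w => (w.1, y :: w.2)) ++
      (bracketWords (x :: l)).map (fun w => (-w.1, w.2 ++ [y]))

theorem perm_of_mem_bracketWords {X : List L} {w : ℤ × List L} (hw : w ∈ bracketWords X) :
    w.2.Perm X := by
  induction X generalizing w with
  | nil => simp [bracketWords] at hw
  | cons y X ih =>
    cases X with
    | nil => simp [bracketWords] at hw; simp [hw]
    | cons x X =>
      simp only [bracketWords, List.mem_append, List.mem_map] at hw
      obtain ⟨w', hw', rfl⟩ | ⟨w', hw', rfl⟩ := hw
      · exact (ih hw').cons y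
      · exact (List.perm_append_singleton y w'.2).trans ((ih hw').cons y)

/-- A tree whose base may be any of its vertices is a signed sum of forests: the counterpart, for
functions, of writing the action of a commutator on a vector as a sum of words. -/
theorem treeFun_mul_sum {k : L → L → K} (hk : ∀ x y, k y x = -k x y) (β : L → K) (X : List L) :
    treeFun k X * (X.map β).sum =
      ((bracketWords X).map fun w => (w.1 : K) * forestFun k β w.2).sum := by
  induction X generalizing β with
  | nil => simp [bracketWords]
  | cons y X ih =>
    cases X with
    | nil => simp [bracketWords, treeFun, forestFun]
    | cons x X =>
      rw [treeFun_cons _ _ (by simp), bracketWords, List.map_append, List.sum_append]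
      -- an entry `y` at the head may be attached to the base or anywhere; an entry `y` at the end
      -- is attached to the base, and becomes a second base for all the others
      have h₁ : (List.map (fun w : ℤ × List L => (w.1 : K) * forestFun k β w.2)
          ((bracketWords (x :: X)).map (fun w => (w.1, y :: w.2)))).sum =
          (treeFun k (x :: X) * ((x :: X).map β).sum) * (β y + ((x :: X).map (k y)).sum) := by
        rw [ih, ← List.sum_map_mul_right, List.map_map]
        refine congrArg List.sum (List.map_congr_left fun w hw => ?_)
        simp only [Function.comp, forestFun]
        rw [((perm_of_mem_bracketWords hw).map (k y)).sum_eq]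
        ring
      have h₂ : (List.map (fun w : ℤ × List L => (w.1 : K) * forestFun k β w.2)
          ((bracketWords (x :: X)).map (fun w => (-w.1, w.2 ++ [y])))).sum =
          -(treeFun k (x :: X) * ((x :: X).map fun q => β q + k q y).sum) * β y := by
        rw [ih, ← neg_one_mul, ← List.sum_map_mul_left, ← List.sum_map_mul_right, List.map_map]
        refine congrArg List.sum (List.map_congr_left fun w hw => ?_)
        simp only [Function.comp, forestFun_append]
        simp [forestFun, mul_assoc]
      have h₃ : ((x :: X).map fun q => β q + k q y).sum =
          ((x :: X).map β).sum - ((x :: X).map (k y)).sum := by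
        rw [List.sum_map_add, sub_eq_add_neg]
        congr 1
        rw [← neg_one_mul, ← List.sum_map_mul_left]
        exact congrArg List.sum (List.map_congr_left fun q _ => by rw [hk]; ring)
      rw [h₁, h₂, h₃, List.map_cons (f := β) (a := y), List.sum_cons]
      ring

/-- Applying the word `f_{y₁} f_{y₂} ⋯` to a vector. -/
def wordAct {V : Type*} (f : L → V → V) (w : List L) (v : V) : V := w.foldr f v

theorem iterBracket_reverse_cons {𝔤 : Type*} [LieRing 𝔤] (f : L → 𝔤) (y : L) {X : List L}
    (hX : X ≠ []) :
    iterBracket ((y :: X).map f).reverse = ⁅f y, iterBracket (X.map f).reverse⁆ := by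
  rw [List.map_cons, List.reverse_cons]
  have hne : (X.map f).reverse ≠ [] := by simpa using hX
  cases h : (X.map f).reverse with
  | nil => exact absurd h hne
  | cons a l => simp [iterBracket, List.foldl_append]

/-- The action of an iterated commutator as a signed sum of words; `treeFun_mul_sum` is the same
identity for functions. -/
theorem lie_iterBracket_reverse {𝔤 V : Type*} [LieRing 𝔤] [AddCommGroup V] [LieRingModule 𝔤 V]
    (f : L → 𝔤) (X : List L) (v : V) :
    ⁅iterBracket (X.map f).reverse, v⁆ =
      ((bracketWords X).map fun w => w.1 • wordAct (fun x v => ⁅f x, v⁆) w.2 v).sum := by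
  induction X generalizing v with
  | nil => simp [bracketWords, iterBracket]
  | cons y X ih =>
    cases X with
    | nil => simp [bracketWords, iterBracket, wordAct]
    | cons x X =>
      rw [iterBracket_reverse_cons f y (List.cons_ne_nil x X), lie_lie, ih, ih, bracketWords,
        List.map_append, List.sum_append, List.map_map, List.map_map, sub_eq_add_neg]
      congr 1
      · generalize bracketWords (x :: X) = l
        induction l with
        | nil => simp
        | cons a l ihl =>
          rw [List.map_cons, List.sum_cons, lie_add, ihl]
          simp [wordAct]
      · generalize bracketWords (x :: X) = l
        induction l with
        | nil => simp
        | cons a l ihl =>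
          simp only [List.map_cons, List.sum_cons, neg_add_rev, ihl]
          simp [wordAct, add_comm]

end Words

/-! ### Partial fractions: expansion of forest functions into chains -/

section Chains

variable {L K : Type*} [DecidableEq L] [Field K]

/-- The chain `∏ 1 / (t_{y_i} - t_{y_{i-1}})` of a sequence `y₁, y₂, …` that starts at the point
`s = t_{y₀}`. -/
def chainFun (t : L → K) : K → List L → K
  | _, [] => 1
  | s, y :: τ => (t y - s)⁻¹ * chainFun t (t y) τ

/-- The sum of `e` over the entries of `τ` that stand before `y`. -/
def beforeSum {R : Type*} [AddCommMonoid R] (e : L → R) (y : L) (τ : List L) : R :=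
  ((τ.takeWhile (· ≠ y)).map e).sum

/-- The coefficient of the chain of `τ` in the forest function of `w`: the product over the entries
`y` of the sum of the exponents of `y` with the base point and with all entries that are earlier
than `y` both in the forest and in the chain. -/
def chainCoeff {R : Type*} [CommRing R] (e : L → L → R) (b : L → R) : List L → List L → R
  | [], _ => 1
  | y :: w, τ => (b y + beforeSum (e y) y τ) * chainCoeff e b w (τ.erase y)

theorem beforeSum_cons_self {R : Type*} [AddCommMonoid R] (e : L → R) (y : L) (τ : List L) :
    beforeSum e y (y :: τ) = 0 := by
  simp [beforeSum]

theorem beforeSum_cons_of_ne {R : Type*} [AddCommMonoid R] (e : L → R) {y q : L} (h : q ≠ y)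
    (τ : List L) : beforeSum e y (q :: τ) = e q + beforeSum e y τ := by
  simp [beforeSum, h]

/-- The members of `List.permutations'Aux y τ` arise by inserting `y` into `τ`. -/
theorem erase_of_mem_permutations'Aux {y : L} {τ τ' : List L} (hy : y ∉ τ)
    (h : τ' ∈ List.permutations'Aux y τ) : τ'.erase y = τ := by
  induction τ generalizing τ' with
  | nil => simp only [List.permutations'Aux, List.mem_singleton] at h; simp [h]
  | cons q τ ih =>
    simp only [List.permutations'Aux, List.mem_cons, List.mem_map] at h
    obtain rfl | ⟨τ'', h, rfl⟩ := h
    · simp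
    · rw [List.erase_cons_tail (by simpa using fun h : q = y => hy (by simp [h])),
        ih (fun h => hy (by simp [h])) h]

/-- Partial fractions for a single new point: inserting `y` into a chain in all possible places. -/
theorem sum_chainFun_insert {t : L → K} (ht : Function.Injective t) (e : L → K) (y : L)
    (τ : List L) (hnd : (y :: τ).Nodup) (s g : K) (hs : ∀ x ∈ y :: τ, t x ≠ s) :
    ((List.permutations'Aux y τ).map fun τ' => chainFun t s τ' * (g + beforeSum e y τ')).sum =
      chainFun t s τ * (g / (t y - s) + (τ.map fun q => e q / (t y - t q)).sum) := by
  induction τ generalizing s g with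
  | nil => simp [chainFun, beforeSum]; ring
  | cons q τ ih =>
    have hyq : y ≠ q := fun h => by simp [h] at hnd
    have hnd' : (y :: τ).Nodup := by
      simp only [List.nodup_cons, List.mem_cons, not_or] at hnd ⊢; exact ⟨hnd.1.2, hnd.2.2⟩
    have hq : q ∉ τ := by simp only [List.nodup_cons] at hnd; exact hnd.2.1
    have ih' := ih hnd' (t q) (g + e q) (by
      intro x hx h
      rcases List.mem_cons.1 hx with rfl | hx
      · exact hyq (ht h)
      · exact hq (ht h ▸ hx))
    have h₁ : t y - s ≠ 0 := sub_ne_zero.2 (hs y (by simp))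
    have h₂ : t q - s ≠ 0 := sub_ne_zero.2 (hs q (by simp))
    have h₃ : t y - t q ≠ 0 := sub_ne_zero.2 fun h => hyq (ht h)
    have h₄ : t q - t y ≠ 0 := sub_ne_zero.2 fun h => hyq (ht h).symm
    have hrest : ((List.permutations'Aux y τ).map ((fun τ' => chainFun t s τ' *
        (g + beforeSum e y τ')) ∘ List.cons q)).sum =
        (t q - s)⁻¹ * (chainFun t (t q) τ *
          ((g + e q) / (t y - t q) + (τ.map fun q => e q / (t y - t q)).sum)) := by
      rw [← ih', ← List.sum_map_mul_left]
      refine congrArg List.sum (List.map_congr_left fun τ' _ => ?_)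
      simp only [Function.comp, chainFun, beforeSum_cons_of_ne e hyq.symm]
      ring
    rw [List.permutations'Aux, List.map_cons, List.sum_cons, List.map_map, hrest,
      beforeSum_cons_self]
    simp only [chainFun, List.map_cons, List.sum_cons]
    generalize (τ.map fun q => e q / (t y - t q)).sum = S
    generalize chainFun t (t q) τ = Q
    -- `1 / ((y - s)(q - y)) + 1 / ((q - s)(y - q)) = 1 / ((q - s)(y - s))`
    have key : (t y - s)⁻¹ * (t q - t y)⁻¹ + (t q - s)⁻¹ * (t y - t q)⁻¹ =
        (t q - s)⁻¹ * (t y - s)⁻¹ := by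
      field_simp
      ring
    linear_combination Q * g * key

/-- Partial fractions: a forest function is a combination of the chains of all arrangements of its
entries. -/
theorem forestFun_eq_sum_chainFun {t : L → K} (ht : Function.Injective t) (e : L → L → K)
    (b : L → K) (s : K) (hs : ∀ x, t x ≠ s) (w : List L) (hw : w.Nodup) :
    forestFun (fun x y => e x y / (t x - t y)) (fun x => b x / (t x - s)) w =
      (w.permutations'.map fun τ => chainFun t s τ * chainCoeff e b w τ).sum := by
  induction w with
  | nil => simp [forestFun, chainFun, chainCoeff]
  | cons y w ih =>
    rw [List.nodup_cons] at hw
    rw [forestFun, ih hw.2, List.permutations', List.map_flatMap, List.flatMap_def,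
      List.sum_flatten, List.map_map, ← List.sum_map_mul_right]
    refine congrArg List.sum (List.map_congr_left fun τ hτ => ?_)
    rw [List.mem_permutations'] at hτ
    have hyτ : y ∉ τ := fun h => hw.1 (hτ.mem_iff.1 h)
    have := sum_chainFun_insert ht (e y) y τ
      (List.nodup_cons.2 ⟨hyτ, hτ.nodup_iff.2 hw.2⟩) s (b y) (fun x _ => hs x)
    rw [← (hτ.map _).sum_eq, mul_right_comm, ← this, ← List.sum_map_mul_right, Function.comp]
    refine congrArg List.sum (List.map_congr_left fun τ' hτ' => ?_)
    rw [chainCoeff, erase_of_mem_permutations'Aux hyτ hτ']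
    ring

/-- Exponents may be rescaled by a factor that depends on their first argument only: this compares
the matrix `⟨α_j, h_i⟩` with the symmetric form `(α_i, α_j)`. -/
theorem chainCoeff_scale {R : Type*} [CommRing R] (e e' : L → L → R) (b b' r : L → R)
    (he : ∀ x y, e' x y = r x * e x y) (hb : ∀ x, b' x = r x * b x) (w τ : List L) :
    chainCoeff e' b' w τ = (w.map r).prod * chainCoeff e b w τ := by
  induction w generalizing τ with
  | nil => simp [chainCoeff]
  | cons y w ih =>
    have : beforeSum (e' y) y τ = r y * beforeSum (e y) y τ := by
      rw [beforeSum, beforeSum, show e' y = fun x => r y * e y x from funext (he y),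
        List.sum_map_mul_left]
    simp only [chainCoeff, ih, this, hb, List.map_cons, List.prod_cons]
    ring

theorem map_chainCoeff {R R' : Type*} [CommRing R] [CommRing R'] (φ : R →+* R') (e : L → L → R)
    (b : L → R) (w τ : List L) :
    φ (chainCoeff e b w τ) = chainCoeff (fun x y => φ (e x y)) (fun x => φ (b x)) w τ := by
  induction w generalizing τ with
  | nil => simp [chainCoeff]
  | cons y w ih => simp [chainCoeff, ih, beforeSum, map_list_sum, Function.comp_def]

/-- The arrangements of the entries of `τ` with the prescribed sequence of colours. -/
def arrangements {ι : Type*} [DecidableEq ι] (col : L → ι) : List ι → List L → List (List L)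
  | [], _ => [[]]
  | i :: c, τ => (τ.filter (col · = i)).flatMap fun y =>
      (arrangements col c (τ.erase y)).map (y :: ·)

theorem mem_arrangements {ι : Type*} [DecidableEq ι] {col : L → ι} {c : List ι} {τ w : List L}
    (h : c.length = τ.length) : w ∈ arrangements col c τ ↔ w.Perm τ ∧ w.map col = c := by
  induction c generalizing τ w with
  | nil =>
    have : τ = [] := List.length_eq_zero_iff.1 h.symm
    subst this
    simp [arrangements]
  | cons i c ih =>
    simp only [arrangements, List.mem_flatMap, List.mem_map, List.mem_filter, decide_eq_true_eq]
    constructor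
    · rintro ⟨y, ⟨hy, rfl⟩, w, hw, rfl⟩
      rw [ih (by rw [List.length_erase_of_mem hy]; simp at h; omega)] at hw
      exact ⟨(hw.1.cons y).trans (List.perm_cons_erase hy).symm, by simp [hw.2]⟩
    · rintro ⟨hp, hc⟩
      cases w with
      | nil => simp at hc
      | cons y w =>
        simp only [List.map_cons, List.cons.injEq] at hc
        have hy : y ∈ τ := hp.mem_iff.1 (by simp)
        refine ⟨y, ⟨hy, hc.1⟩, w, ?_, rfl⟩
        rw [ih (by rw [List.length_erase_of_mem hy]; simp at h; omega)]
        exact ⟨(List.cons_perm_iff_perm_erase.1 hp).2, hc.2⟩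

theorem nodup_arrangements {ι : Type*} [DecidableEq ι] (col : L → ι) (c : List ι) {τ : List L}
    (hτ : τ.Nodup) : (arrangements col c τ).Nodup := by
  induction c generalizing τ with
  | nil => simp [arrangements]
  | cons i c ih =>
    rw [arrangements, List.nodup_flatMap]
    refine ⟨fun y _ => (ih (hτ.erase y)).map (List.cons_injective), ?_⟩
    refine (hτ.filter _).pairwise_of_forall_ne ?_
    intro a _ b _ hab
    simp only [Function.onFun, List.disjoint_left, List.mem_map, not_exists, not_and]
    rintro _ ⟨w, _, rfl⟩ w' _ h
    exact hab (List.cons.inj h).1.symm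

end Chains

/-! ### Highest weight vectors -/

section HighestWeight

variable {L ι V : Type*} [DecidableEq L] [DecidableEq ι] [AddCommGroup V] [Module ℂ V]

/-- Endomorphisms `e_i`, `f_i`, `h_i` subject to the commutation relations of Chevalley generators,
and a vector of weight `wt` that is annihilated by all `e_i`. -/
structure IsHighestWeightVector (e f h : ι → V →ₗ[ℂ] V) (C : ι → ι → ℂ) (wt : ι → ℂ) (v : V) :
    Prop where
  ef : ∀ i j x, e i (f j x) = f j (e i x) + if i = j then h j x else 0
  hf : ∀ i j x, h i (f j x) = f j (h i x) - C i j • f j x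
  he : ∀ i j x, h i (e j x) = e j (h i x) + C i j • e j x
  e_vec : ∀ i, e i v = 0
  h_vec : ∀ i, h i v = wt i • v

namespace IsHighestWeightVector

variable {e f h : ι → V →ₗ[ℂ] V} {C : ι → ι → ℂ} {wt : ι → ℂ} {v : V}

theorem h_wordAct_f (hv : IsHighestWeightVector e f h C wt v) (i : ι) (c : List ι) :
    h i (wordAct (fun j => f j) c v) =
      (wt i - (c.map (C i)).sum) • wordAct (fun j => f j) c v := by
  induction c with
  | nil => simp [wordAct, hv.h_vec]
  | cons j c ih =>
    change h i (f j (wordAct _ c v)) = _ • f j (wordAct _ c v)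
    rw [hv.hf, ih, map_smul, ← sub_smul, List.map_cons, List.sum_cons]
    congr 1
    ring

theorem h_wordAct_e (hv : IsHighestWeightVector e f h C wt v) (i : ι) (c : List ι) {x : V} {μ : ℂ}
    (hx : h i x = μ • x) :
    h i (wordAct (fun j => e j) c x) = (μ + (c.map (C i)).sum) • wordAct (fun j => e j) c x := by
  induction c with
  | nil => simp [wordAct, hx]
  | cons j c ih =>
    change h i (e j (wordAct _ c x)) = _ • e j (wordAct _ c x)
    rw [hv.he, ih, map_smul, ← add_smul, List.map_cons, List.sum_cons]
    congr 1
    ring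

/-- Moving `f_i` to the left through a product of `e`'s. -/
theorem wordAct_e_f (hv : IsHighestWeightVector e f h C wt v) (col : L → ι) (i : ι) {x : V} {μ : ℂ}
    (hx : h i x = μ • x) (τ : List L) (hτ : τ.Nodup) :
    wordAct (fun j => e j) (τ.map col) (f i x) = f i (wordAct (fun j => e j) (τ.map col) x) +
      ((τ.filter (col · = i)).map fun y =>
        (μ + ((τ.erase y).map fun q => C i (col q)).sum - beforeSum (fun q => C i (col q)) y τ) •
          wordAct (fun j => e j) ((τ.erase y).map col) x).sum := by
  induction τ with
  | nil => simp [wordAct]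
  | cons q τ ih =>
    rw [List.nodup_cons] at hτ
    change e (col q) (wordAct _ (τ.map col) (f i x)) =
      f i (e (col q) (wordAct _ (τ.map col) x)) + _
    have hterm : e (col q) (((τ.filter (col · = i)).map fun y =>
        (μ + ((τ.erase y).map fun q => C i (col q)).sum - beforeSum (fun q => C i (col q)) y τ) •
          wordAct (fun j => e j) ((τ.erase y).map col) x).sum) =
        ((τ.filter (col · = i)).map fun y =>
        (μ + (((q :: τ).erase y).map fun q => C i (col q)).sum -
          beforeSum (fun q => C i (col q)) y (q :: τ)) •
          wordAct (fun j => e j) (((q :: τ).erase y).map col) x).sum := by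
      rw [map_list_sum, List.map_map]
      refine congrArg List.sum (List.map_congr_left fun y hy => ?_)
      have hqy : q ≠ y := fun hqy => hτ.1 (hqy ▸ (List.mem_filter.1 hy).1)
      rw [List.erase_cons_tail (by simpa using hqy), beforeSum_cons_of_ne _ hqy]
      simp only [Function.comp, map_smul, List.map_cons, List.sum_cons]
      change _ • e (col q) _ = _ • e (col q) _
      congr 1
      ring
    rw [ih hτ.2, map_add, hv.ef, hterm]
    by_cases hq : col q = i
    · rw [if_pos hq, List.filter_cons_of_pos (by simpa using hq), List.map_cons, List.sum_cons,
        hv.h_wordAct_e i _ hx, beforeSum_cons_self, List.erase_cons_head, List.map_map]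
      simp [add_assoc, Function.comp_def]
    · rw [if_neg hq, List.filter_cons_of_neg (by simpa using hq), add_zero]

/-- A product with more `e`'s than `f`'s annihilates a highest weight vector. -/
theorem wordAct_eq_zero (hv : IsHighestWeightVector e f h C wt v) (col : L → ι) (c : List ι)
    (τ : List L) (hτ : τ.Nodup) (hlen : c.length < τ.length) :
    wordAct (fun j => e j) (τ.map col) (wordAct (fun j => f j) c v) = 0 := by
  induction c generalizing τ with
  | nil =>
    have key : ∀ l : List ι, l ≠ [] → wordAct (fun j => e j) l v = 0 := by
      intro l
      induction l with
      | nil => simp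
      | cons i l ih =>
        intro _
        change e i (wordAct _ l v) = 0
        by_cases hl : l = []
        · subst hl; simp [wordAct, hv.e_vec]
        · rw [ih hl, map_zero]
    exact key _ (by rintro h; simp at h; subst h; simp at hlen)
  | cons i c ih =>
    change wordAct _ (τ.map col) (f i (wordAct _ c v)) = 0
    simp only [List.length_cons] at hlen
    rw [hv.wordAct_e_f col i (hv.h_wordAct_f i c) τ hτ, ih τ hτ (by omega), map_zero, zero_add]
    refine List.sum_eq_zero fun z hz => ?_
    obtain ⟨y, hy, rfl⟩ := List.mem_map.1 hz
    rw [ih _ (hτ.erase y) (by rw [List.length_erase_of_mem (List.mem_filter.1 hy).1]; omega),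
      smul_zero]

/-- The matrix coefficient `⟨v^*, e_{τ₁} ⋯ e_{τ_N} f_{c_1} ⋯ f_{c_N} v⟩` is a sum of chain
coefficients over the arrangements of `τ` with colours `c`. -/
theorem wordAct_eq_sum_chainCoeff (hv : IsHighestWeightVector e f h C wt v) (col : L → ι)
    (c : List ι) (τ : List L) (hτ : τ.Nodup) (hc : c.Perm (τ.map col)) :
    wordAct (fun j => e j) (τ.map col) (wordAct (fun j => f j) c v) =
      ((arrangements col c τ).map fun w =>
        chainCoeff (fun x y => -C (col x) (col y)) (fun x => wt (col x)) w τ).sum • v := by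
  induction c generalizing τ with
  | nil =>
    have : τ = [] := by simpa using hc
    subst this
    simp [wordAct, arrangements, chainCoeff]
  | cons i c ih =>
    have hlen : c.length < τ.length := by
      have := hc.length_eq; simp at this; omega
    change wordAct _ (τ.map col) (f i (wordAct _ c v)) = _
    rw [hv.wordAct_e_f col i (hv.h_wordAct_f i c) τ hτ,
      hv.wordAct_eq_zero col c τ hτ hlen, map_zero, zero_add, arrangements, List.map_flatMap,
      List.flatMap_def, List.sum_flatten, List.map_map, List.sum_smul, List.map_map]
    refine congrArg List.sum (List.map_congr_left fun y hy => ?_)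
    obtain ⟨hy, hyi⟩ := List.mem_filter.1 hy
    rw [decide_eq_true_eq] at hyi
    have hc' : c.Perm ((τ.erase y).map col) := by
      have := hc.trans ((List.perm_cons_erase hy).map col)
      rw [List.map_cons, hyi] at this
      exact this.cons_inv
    rw [ih _ (hτ.erase y) hc', (hc'.map (C i)).sum_eq, List.map_map, smul_smul]
    simp only [Function.comp, List.map_map]
    congr 1
    rw [← List.sum_map_mul_left]
    refine congrArg List.sum (List.map_congr_left fun w _ => ?_)
    simp only [chainCoeff, Function.comp]
    congr 1
    have : beforeSum (fun q => -C (col y) (col q)) y τ = -beforeSum (fun q => C i (col q)) y τ := by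
      rw [beforeSum, beforeSum, ← neg_one_mul, ← List.sum_map_mul_left]
      simp [hyi]
    rw [this, hyi]
    simp only [Function.comp_def]
    ring

end IsHighestWeightVector

end HighestWeight

/-! ### Vanishing of symmetrised tree functions -/

section Vanishing

variable {L ι V K : Type*} [Fintype L] [DecidableEq L] [DecidableEq ι] [Field K]

/-- Summing over colour preserving permutations of all labels amounts to summing over the
arrangements with the same colours. -/
theorem sum_perm_eq_sum_arrangements {R : Type*} [AddCommMonoid R] (col : L → ι) {w : List L}
    (hw : w.Nodup) (hall : ∀ x, x ∈ w) (F : List L → R) :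
    ∑ g : Equiv.Perm L with ∀ x, col (g x) = col x, F (w.map g) =
      ((arrangements col (w.map col) w).map F).sum := by
  rw [← List.sum_toFinset F (nodup_arrangements col _ hw)]
  refine Finset.sum_bij (fun g _ => w.map g) ?_ ?_ ?_ ?_
  · intro g hg
    simp only [Finset.mem_filter, Finset.mem_univ, true_and] at hg
    rw [List.mem_toFinset, mem_arrangements (by simp)]
    refine ⟨?_, by simp [hg]⟩
    rw [List.perm_ext_iff_of_nodup (hw.map g.injective) hw]
    exact fun x => ⟨fun _ => hall x, fun _ =>
      List.mem_map.2 ⟨g.symm x, hall _, g.apply_symm_apply x⟩⟩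
  · intro g _ g' _ h
    rw [List.map_inj_left] at h
    exact Equiv.ext fun x => h x (hall x)
  · intro w' hw'
    rw [List.mem_toFinset, mem_arrangements (by simp)] at hw'
    obtain ⟨hp, hc⟩ := hw'
    have hw'n := hp.nodup_iff.2 hw
    let g : Equiv.Perm L := (hw.getEquivOfForallMemList w hall).symm.trans
      ((finCongr hp.length_eq.symm).trans
        (hw'n.getEquivOfForallMemList w' fun x => hp.mem_iff.2 (hall x)))
    have hg : w.map g = w' := by
      refine List.ext_getElem (by simp [hp.length_eq]) fun i h₁ h₂ => ?_
      have h₃ : i < w.length := by simpa using h₁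
      have : (hw.getEquivOfForallMemList w hall).symm w[i] = ⟨i, h₃⟩ := by
        rw [Equiv.symm_apply_eq]
        rfl
      simp only [List.getElem_map, g, Equiv.trans_apply, this]
      rfl
    refine ⟨g, ?_, hg⟩
    simp only [Finset.mem_filter, Finset.mem_univ, true_and]
    intro x
    rw [← hg, List.map_map, List.map_inj_left] at hc
    exact hc x (hall x)
  · intros; rfl

/-- The coefficient of a chain in a symmetrised forest function is a sum over arrangements, the one
that occurs in `IsHighestWeightVector.wordAct_eq_sum_chainCoeff`. -/
theorem sum_perm_forestFun (col : L → ι) {t : L → K} (ht : Function.Injective t)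
    (e : L → L → K) (b : L → K) (s : K) (hs : ∀ x, t x ≠ s) {X w : List L} (hX : X.Nodup)
    (hall : ∀ x, x ∈ X) (hw : w.Perm X) :
    ∑ g : Equiv.Perm L with ∀ x, col (g x) = col x,
      forestFun (fun x y => e x y / (t x - t y)) (fun x => b x / (t x - s)) (w.map g) =
      ∑ τ ∈ X.permutations.toFinset, chainFun t s τ *
        ((arrangements col (w.map col) τ).map fun w' => chainCoeff e b w' τ).sum := by
  have hwn := hw.nodup_iff.2 hX
  rw [sum_perm_eq_sum_arrangements col hwn (fun x => hw.mem_iff.2 (hall x)),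
    ← List.sum_toFinset _ (nodup_arrangements col _ hwn)]
  have h₁ : ∀ w' ∈ (arrangements col (w.map col) w).toFinset,
      forestFun (fun x y => e x y / (t x - t y)) (fun x => b x / (t x - s)) w' =
      ∑ τ ∈ X.permutations.toFinset, chainFun t s τ * chainCoeff e b w' τ := by
    intro w' hw'
    rw [List.mem_toFinset, mem_arrangements (by simp)] at hw'
    have hw'X := hw'.1.trans hw
    have hw'n := hw'X.nodup_iff.2 hX
    rw [forestFun_eq_sum_chainFun ht e b s hs w' hw'n, ← List.sum_toFinset _
      ((List.permutations_perm_permutations' w').nodup_iff.1 (List.nodup_permutations w' hw'n))]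
    refine Finset.sum_congr ?_ fun _ _ => rfl
    ext τ
    simp only [List.mem_toFinset, List.mem_permutations', List.mem_permutations]
    exact ⟨fun h => h.trans hw'X, fun h => h.trans hw'X.symm⟩
  rw [Finset.sum_congr rfl h₁, Finset.sum_comm]
  refine Finset.sum_congr rfl fun τ hτ => ?_
  rw [List.mem_toFinset, List.mem_permutations] at hτ
  rw [← List.sum_toFinset _ (nodup_arrangements col _ (hτ.nodup_iff.2 hX)), Finset.mul_sum]
  refine Finset.sum_congr ?_ fun _ _ => rfl
  ext w'
  rw [List.mem_toFinset, List.mem_toFinset, mem_arrangements (by simp),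
    mem_arrangements (by simp [hw.length_eq, hτ.length_eq])]
  exact ⟨fun h => ⟨h.1.trans (hw.trans hτ.symm), h.2⟩, fun h => ⟨h.1.trans (hτ.trans hw.symm), h.2⟩⟩

/-- A sum of simple fractions with distinct poles, not all of whose residues vanish, takes a
nonzero value outside its poles. -/
theorem exists_sum_div_ne_zero [Infinite K] {t : L → K} (ht : Function.Injective t) (b : L → K)
    {x₀ : L} (hx₀ : b x₀ ≠ 0) : ∃ s, (∀ x, t x ≠ s) ∧ ∑ x, b x / (t x - s) ≠ 0 := by
  -- the common denominator `Q` and the numerator `P` of the sum, as polynomials in `s`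
  let Q : Polynomial K := ∏ x, (Polynomial.C (t x) - Polynomial.X)
  let P : Polynomial K :=
    ∑ x, Polynomial.C (b x) * ∏ y ∈ Finset.univ.erase x, (Polynomial.C (t y) - Polynomial.X)
  have hP : P ≠ 0 := by
    intro h
    have : P.eval (t x₀) = b x₀ * ∏ y ∈ Finset.univ.erase x₀, (t y - t x₀) := by
      simp only [P, Polynomial.eval_finsetSum, Polynomial.eval_mul, Polynomial.eval_C,
        Polynomial.eval_prod, Polynomial.eval_sub, Polynomial.eval_X]
      refine Finset.sum_eq_single x₀ (fun x _ hx => ?_) (by simp)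
      rw [Finset.prod_eq_zero (i := x₀) (by simp [hx.symm]) (sub_self _), mul_zero]
    rw [h, Polynomial.eval_zero] at this
    refine mul_ne_zero hx₀ (Finset.prod_ne_zero_iff.2 fun y hy => ?_) this.symm
    exact sub_ne_zero.2 fun h => Finset.ne_of_mem_erase hy (ht h)
  have hQ : Q ≠ 0 := Finset.prod_ne_zero_iff.2 fun x _ h => by
    have := congrArg (Polynomial.eval (t x + 1)) h
    simp at this
  obtain ⟨s, hs⟩ : ∃ s, (P * Q).eval s ≠ 0 := by
    by_contra! h
    exact mul_ne_zero hP hQ (Polynomial.funext fun s => by simpa using h s)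
  rw [Polynomial.eval_mul] at hs
  have hne : ∀ x, t x ≠ s := by
    intro x hx
    refine right_ne_zero_of_mul hs ?_
    simp only [Q, Polynomial.eval_prod, Polynomial.eval_sub, Polynomial.eval_C, Polynomial.eval_X]
    exact Finset.prod_eq_zero (Finset.mem_univ x) (sub_eq_zero.2 hx)
  refine ⟨s, hne, fun h => left_ne_zero_of_mul hs ?_⟩
  have hmul : (∏ x, (t x - s)) * ∑ x, b x / (t x - s) = P.eval s := by
    simp only [P, Polynomial.eval_finsetSum, Polynomial.eval_mul, Polynomial.eval_C,
      Polynomial.eval_prod, Polynomial.eval_sub, Polynomial.eval_X]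
    rw [Finset.mul_sum]
    refine Finset.sum_congr rfl fun x _ => ?_
    rw [← Finset.mul_prod_erase _ _ (Finset.mem_univ x)]
    have := sub_ne_zero.2 (hne x)
    field_simp
  rw [← hmul, h, mul_zero]

variable [AddCommGroup V] [Module ℂ V] [Algebra ℂ K]

/-- If the iterated commutator of the `f`'s coloured by `X` annihilates a highest weight vector
whose weight pairs nontrivially with one of the colours, then the tree function of `X` vanishes
after symmetrisation. The tree function is multiplied by the symmetric function
`∑_x b_x / (t_x - s)` and expanded into forests, then into chains; the coefficient of every chain
is a matrix coefficient of the commutator. -/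
theorem sum_perm_treeFun_eq_zero {e f h : ι → V →ₗ[ℂ] V} {C : ι → ι → ℂ} {wt : ι → ℂ} {v : V}
    (hv : IsHighestWeightVector e f h C wt v) (hv0 : v ≠ 0) {ex : ι → ι → ℂ} {ez r : ι → ℂ}
    (hr : ∀ i, r i ≠ 0) (hex : ∀ i j, C i j = -(r i * ex i j)) (hez : ∀ i, wt i = r i * ez i)
    (hsymm : ∀ i j, ex i j = ex j i) (col : L → ι) {t : L → K} (ht : Function.Injective t)
    {X : List L} (hX : X.Nodup) (hall : ∀ x, x ∈ X)
    (hbr : ((bracketWords X).map fun w => w.1 • wordAct (fun x => f (col x)) w.2 v).sum = 0)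
    {x₀ : L} (hx₀ : ez (col x₀) ≠ 0) :
    ∑ g : Equiv.Perm L with ∀ x, col (g x) = col x,
      treeFun (fun x y => algebraMap ℂ K (ex (col x) (col y)) / (t x - t y)) (X.map g) = 0 := by
  have : Infinite K := Infinite.of_injective _ (algebraMap ℂ K).injective
  obtain ⟨s, hs, hβ⟩ := exists_sum_div_ne_zero ht (fun x => algebraMap ℂ K (ez (col x)))
    (x₀ := x₀) (by simpa using hx₀)
  set k : L → L → K := fun x y => algebraMap ℂ K (ex (col x) (col y)) / (t x - t y) with hk
  set β : L → K := fun x => algebraMap ℂ K (ez (col x)) / (t x - s) with hβdef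
  have hkanti : ∀ x y, k y x = -k x y := fun x y => by
    simp only [hk]
    rw [hsymm, ← neg_sub (t x), div_neg]
  have hsumX : ∀ g : Equiv.Perm L, ((X.map g).map β).sum = ∑ x, β x := by
    intro g
    rw [List.map_map, ← List.sum_toFinset _ hX,
      show X.toFinset = Finset.univ from Finset.eq_univ_of_forall fun x => by simp [hall x]]
    exact Equiv.sum_comp g β
  refine (mul_eq_zero.1 ?_).resolve_right hβ
  rw [Finset.sum_mul]
  -- both sides of the expansion into forests are permuted alike
  have hexp : ∀ g : Equiv.Perm L, treeFun k (X.map g) * ∑ x, β x =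
      ((bracketWords X).map fun w => (w.1 : K) * forestFun k β (w.2.map g)).sum := by
    intro g
    have h₁ := treeFun_mul_sum (k := fun x y => k (g x) (g y)) (fun x y => hkanti _ _)
      (fun x => β (g x)) X
    rw [← hsumX g, treeFun_map, List.map_map]
    exact h₁.trans (congrArg List.sum (List.map_congr_left fun w _ => by rw [forestFun_map]))
  rw [Finset.sum_congr rfl fun g _ => hexp g]
  -- the coefficient of the chain of `τ` is the coefficient of `v` in `e_{τ₁} ⋯ e_{τ_N} [f_X] v`
  have hmatrix : ∀ τ : List L, τ.Perm X → ((bracketWords X).map fun w => (w.1 : ℂ) *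
      ((arrangements col (w.2.map col) τ).map fun w' =>
        chainCoeff (fun x y => ex (col x) (col y)) (fun x => ez (col x)) w' τ).sum).sum = 0 := by
    intro τ hτ
    have hτn := hτ.nodup_iff.2 hX
    have hprod : (X.map fun x => r (col x)).prod ≠ 0 := by
      refine List.prod_ne_zero fun h => ?_
      obtain ⟨x, _, hx⟩ := List.mem_map.1 h
      exact hr _ hx
    refine (mul_eq_zero.1 ?_).resolve_left hprod
    refine (smul_eq_zero.1 ?_).resolve_right hv0
    have happ : ∀ (l : List ι), ∃ F : V →ₗ[ℂ] V, ∀ x, wordAct (fun j => e j) l x = F x := by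
      intro l
      induction l with
      | nil => exact ⟨LinearMap.id, fun _ => rfl⟩
      | cons i l ih =>
        obtain ⟨F, hF⟩ := ih
        exact ⟨e i ∘ₗ F, fun x => congrArg (e i) (hF x)⟩
    obtain ⟨F, hF⟩ := happ (τ.map col)
    have h0 := congrArg F hbr
    rw [map_zero, map_list_sum, List.map_map] at h0
    rw [← h0, ← List.sum_map_mul_left, List.sum_smul, List.map_map]
    refine congrArg List.sum (List.map_congr_left fun w hw => ?_)
    have hwX := perm_of_mem_bracketWords hw
    have hact : wordAct (fun x => f (col x)) w.2 v = wordAct (fun j => f j) (w.2.map col) v := by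
      simp [wordAct, List.foldr_map]
    simp only [Function.comp]
    rw [map_zsmul, hact, ← hF, hv.wordAct_eq_sum_chainCoeff col _ τ hτn
      ((hwX.trans hτ.symm).map col), ← Int.cast_smul_eq_zsmul ℂ, smul_smul]
    congr 1
    rw [← mul_assoc, mul_comm _ (w.1 : ℂ), mul_assoc, ← List.sum_map_mul_left]
    congr 2
    refine List.map_congr_left fun w' hw' => ?_
    rw [mem_arrangements (by simp [hwX.length_eq, hτ.length_eq])] at hw'
    rw [chainCoeff_scale (fun x y => ex (col x) (col y)) _ (fun x => ez (col x)) _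
      (fun x => r (col x)) (fun x y => by rw [hex, neg_neg]) (fun x => hez _),
      ((hw'.1.trans hτ).map fun x => r (col x)).prod_eq]
  have hswap : ∑ g : Equiv.Perm L with ∀ x, col (g x) = col x,
      ((bracketWords X).map fun w => (w.1 : K) * forestFun k β (w.2.map g)).sum =
      ((bracketWords X).map fun w => (w.1 : K) *
        ∑ g : Equiv.Perm L with ∀ x, col (g x) = col x, forestFun k β (w.2.map g)).sum := by
    generalize bracketWords X = l
    induction l with
    | nil => simp
    | cons a l ih => simp only [List.map_cons, List.sum_cons, Finset.sum_add_distrib, ih,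
        Finset.mul_sum]
  rw [hswap]
  have hstep : ∀ w ∈ bracketWords X, (w.1 : K) *
      ∑ g : Equiv.Perm L with ∀ x, col (g x) = col x, forestFun k β (w.2.map g) =
      ∑ τ ∈ X.permutations.toFinset, chainFun t s τ * algebraMap ℂ K ((w.1 : ℂ) *
      ((arrangements col (w.2.map col) τ).map fun w' =>
        chainCoeff (fun x y => ex (col x) (col y)) (fun x => ez (col x)) w' τ).sum) := by
    intro w hw
    rw [sum_perm_forestFun col ht (fun x y => algebraMap ℂ K (ex (col x) (col y)))
      (fun x => algebraMap ℂ K (ez (col x))) s hs hX hall (perm_of_mem_bracketWords hw),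
      Finset.mul_sum]
    refine Finset.sum_congr rfl fun τ _ => ?_
    rw [map_mul, map_list_sum, List.map_map, map_intCast]
    simp only [Function.comp_def, map_chainCoeff]
    ring
  rw [List.map_congr_left hstep]
  have hswap' : ∀ (l : List (ℤ × List L)) (G : List L → ℤ × List L → ℂ),
      (l.map fun w => ∑ τ ∈ X.permutations.toFinset, chainFun t s τ *
        algebraMap ℂ K (G τ w)).sum =
      ∑ τ ∈ X.permutations.toFinset, chainFun t s τ *
        algebraMap ℂ K ((l.map (G τ)).sum) := by
    intro l G
    induction l with
    | nil => simp
    | cons a l ih => simp only [List.map_cons, List.sum_cons, ih, map_add, mul_add,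
        Finset.sum_add_distrib]
  rw [hswap' _ fun τ w => (w.1 : ℂ) * ((arrangements col (w.2.map col) τ).map fun w' =>
        chainCoeff (fun x y => ex (col x) (col y)) (fun x => ez (col x)) w' τ).sum]
  refine Finset.sum_eq_zero fun τ hτ => ?_
  rw [List.mem_toFinset, List.mem_permutations] at hτ
  rw [hmatrix τ hτ, map_zero, mul_zero]

end Vanishing

/-! ### The highest root vector -/

section HighestRoot

open LieAlgebra Module

variable {𝔤 : Type*} [LieRing 𝔤] [LieAlgebra ℂ 𝔤] [FiniteDimensional ℂ 𝔤]
  [LieAlgebra.IsSimple ℂ 𝔤] {H : LieSubalgebra ℂ 𝔤} [H.IsCartanSubalgebra]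
  {ι : Type*} [Fintype ι] [DecidableEq ι] (b : LieAlgebra.Basis ι H)

theorem sum_baseSupp_add_ne_zero (k : ι → ℕ) (i : ι) :
    ∑ j, k j • b.baseSupp j + b.baseSupp i ≠ 0 := by
  intro h
  have hli := b.linearIndependent_baseSupp
  rw [Fintype.linearIndependent_iff] at hli
  have := hli (fun j => (k j : ℂ) + if j = i then 1 else 0) (by
    simp only [add_smul, Finset.sum_add_distrib, ite_smul, one_smul, zero_smul,
      Finset.sum_ite_eq', Finset.mem_univ, if_true]
    simpa [Nat.cast_smul_eq_nsmul] using h) i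
  simp only [if_true] at this
  exact (Nat.cast_add_one_ne_zero (k i)) this

variable {b} {θ : H.root} {a : ι → ℕ}

/-- `θ + α_i` is not a root, since `θ` is the highest root. -/
theorem IsHighestRootWith.rootSpace_eq_bot (hθ : IsHighestRootWith b θ a) (i : ι) :
    rootSpace H ((θ.1 : H → ℂ) + b.baseSupp i) = ⊥ := by
  by_contra hne
  let β : LieModule.Weight ℂ H 𝔤 := ⟨(θ.1 : H → ℂ) + b.baseSupp i, hne⟩
  have hβ : β.toLinear = θ.1.toLinear + b.baseSupp i := LinearMap.ext fun x => rfl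
  by_cases hz : β.IsZero
  · refine sum_baseSupp_add_ne_zero b a i ?_
    rw [← hθ.eq_sum, ← hβ]
    exact LinearMap.ext fun x => congrFun hz x
  · obtain ⟨k, hk⟩ := hθ.le_highest ⟨β, by simpa using hz⟩
    refine sum_baseSupp_add_ne_zero b k i ?_
    change _ = β.toLinear + _ at hk
    rw [hβ] at hk
    have := sub_eq_zero.2 hk
    rw [← neg_eq_zero, ← this]
    abel

theorem IsHighestRootWith.rootSpace_neg_eq_bot (hθ : IsHighestRootWith b θ a) (i : ι) :
    rootSpace H (-(θ.1 : H → ℂ) + -b.baseSupp i) = ⊥ := by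
  by_contra hne
  let β : LieModule.Weight ℂ H 𝔤 := ⟨-(θ.1 : H → ℂ) + -b.baseSupp i, hne⟩
  refine LieModule.Weight.genWeightSpace_ne_bot 𝔤 (-β) ?_
  have : ((-β : LieModule.Weight ℂ H 𝔤) : H → ℂ) = (θ.1 : H → ℂ) + b.baseSupp i := by
    rw [LieModule.Weight.coe_neg]
    change -(-(θ.1 : H → ℂ) + -(b.baseSupp i : H → ℂ)) = _
    abel
  rw [this]
  exact hθ.rootSpace_eq_bot i

theorem mem_rootSpace_e (i : ι) : b.e i ∈ rootSpace H (b.baseSupp i) :=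
  (LieModule.mem_genWeightSpace _ _ _).mpr fun x => ⟨1, by simp⟩

theorem mem_rootSpace_f (i : ι) : b.f i ∈ rootSpace H (-(b.baseSupp i : H → ℂ)) :=
  (LieModule.mem_genWeightSpace _ _ _).mpr fun x => ⟨1, by
    have h := b.baseSupp_apply_smul_f i x
    simp [h]
    rw [← lie_skew, neg_add_cancel]⟩

theorem IsHighestRootWith.lie_e_eq_zero (hθ : IsHighestRootWith b θ a) (i : ι) {v : 𝔤}
    (hv : v ∈ rootSpace H θ.1) : ⁅b.e i, v⁆ = 0 := by
  have h := LieAlgebra.lie_mem_genWeightSpace_of_mem_genWeightSpace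
    (mem_rootSpace_e (b := b) i) hv
  have hbot : LieModule.genWeightSpace 𝔤 ((b.baseSupp i : H → ℂ) + (θ.1 : H → ℂ)) = ⊥ := by
    rw [add_comm]
    exact hθ.rootSpace_eq_bot i
  exact (LieSubmodule.mem_bot _).1 (hbot.le h)

theorem IsHighestRootWith.lie_f_eq_zero (hθ : IsHighestRootWith b θ a) (i : ι) {v : 𝔤}
    (hv : v ∈ rootSpace H (-(θ.1 : H → ℂ))) : ⁅b.f i, v⁆ = 0 := by
  have h := LieAlgebra.lie_mem_genWeightSpace_of_mem_genWeightSpace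
    (mem_rootSpace_f (b := b) i) hv
  have hbot : LieModule.genWeightSpace 𝔤 (-(b.baseSupp i : H → ℂ) + -(θ.1 : H → ℂ)) = ⊥ := by
    rw [add_comm]
    exact hθ.rootSpace_neg_eq_bot i
  exact (LieSubmodule.mem_bot _).1 (hbot.le h)

theorem normForm_symm (χ μ : Dual ℂ H) : normForm θ χ μ = normForm θ μ χ := by
  have key : ∀ χ μ : Dual ℂ H, χ ((IsKilling.cartanEquivDual H).symm μ) =
      LieModule.traceForm ℂ H 𝔤 ((IsKilling.cartanEquivDual H).symm χ)
        ((IsKilling.cartanEquivDual H).symm μ) := by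
    intro χ μ
    conv_lhs => rw [← (IsKilling.cartanEquivDual H).apply_symm_apply χ]
    rfl
  rw [normForm, normForm, key, LieModule.traceForm_comm, ← key]

theorem apply_cartanEquivDual_ne_zero (α : H.root) :
    α.1 ((IsKilling.cartanEquivDual H).symm α.1.toLinear) ≠ 0 :=
  IsKilling.root_apply_cartanEquivDual_symm_ne_zero (LieSubalgebra.isNonZero_coe_root α)

theorem normForm_self : normForm θ θ.1.toLinear θ.1.toLinear = 2 := by
  rw [normForm]
  exact mul_div_cancel_right₀ _ (apply_cartanEquivDual_ne_zero θ)

/-- The ratio `(θ, θ) / (α_i, α_i)`. -/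
def lengthRatio (b : LieAlgebra.Basis ι H) (θ : H.root) (i : ι) : ℂ :=
  θ.1 ((IsKilling.cartanEquivDual H).symm θ.1.toLinear) /
    b.baseSupp i ((IsKilling.cartanEquivDual H).symm (b.baseSupp i))

theorem lengthRatio_ne_zero (i : ι) : lengthRatio b θ i ≠ 0 :=
  div_ne_zero (apply_cartanEquivDual_ne_zero θ) (apply_cartanEquivDual_ne_zero (b.baseSupp' i))

/-- The coroot `h_i` corresponds to a multiple of `α_i` under the normalised form. -/
theorem apply_h' (i : ι) (μ : Dual ℂ H) :
    μ (b.h' i) = lengthRatio b θ i * normForm θ (b.baseSupp i) μ := by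
  have hco : b.h' i = IsKilling.coroot (b.baseSupp' i).1 := by
    rw [← b.coroot_eq_h' i]
    rfl
  have h₁ := apply_cartanEquivDual_ne_zero θ
  have h₂ := apply_cartanEquivDual_ne_zero (b.baseSupp' i)
  change b.baseSupp i ((IsKilling.cartanEquivDual H).symm (b.baseSupp i)) ≠ 0 at h₂
  have h₃ : μ (b.h' i) = 2 * ((b.baseSupp i ((IsKilling.cartanEquivDual H).symm
      (b.baseSupp i)))⁻¹ * μ ((IsKilling.cartanEquivDual H).symm (b.baseSupp i))) := by
    rw [hco, IsKilling.coroot, map_nsmul, map_smul, nsmul_eq_mul, smul_eq_mul]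
    rfl
  rw [h₃, normForm_symm, normForm, lengthRatio]
  field_simp

/-- A nonzero vector of the highest root space is a highest weight vector of the adjoint
representation. -/
theorem IsHighestRootWith.isHighestWeightVector (hθ : IsHighestRootWith b θ a) {v : 𝔤}
    (hv : v ∈ rootSpace H θ.1) :
    IsHighestWeightVector (fun i => (LieAlgebra.ad ℂ 𝔤 (b.e i) : 𝔤 →ₗ[ℂ] 𝔤))
      (fun i => (LieAlgebra.ad ℂ 𝔤 (b.f i) : 𝔤 →ₗ[ℂ] 𝔤))
      (fun i => (LieAlgebra.ad ℂ 𝔤 (b.h i) : 𝔤 →ₗ[ℂ] 𝔤))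
      (fun i j => b.baseSupp j (b.h' i)) (fun i => θ.1 (b.h' i)) v where
  ef i j x := by
    simp only [LieAlgebra.ad_apply]
    rw [leibniz_lie, add_comm]
    congr 1
    split_ifs with h
    · subst h; rw [(b.sl2 i).lie_e_f]
    · rw [b.lie_e_f_ne i j h, zero_lie]
  hf i j x := by
    simp only [LieAlgebra.ad_apply]
    rw [leibniz_lie, b.lie_h_f, b.baseSupp_apply_h', smul_lie, Int.cast_smul_eq_zsmul, neg_smul]
    abel
  he i j x := by
    simp only [LieAlgebra.ad_apply]
    rw [leibniz_lie, b.lie_h_e, b.baseSupp_apply_h', smul_lie, Int.cast_smul_eq_zsmul]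
    abel
  e_vec i := by
    exact hθ.lie_e_eq_zero i hv
  h_vec i := IsKilling.lie_eq_smul_of_mem_rootSpace hv (b.h' i)

/-- The symmetrisation of the tree function of a sequence that represents `[f_i, f_θ]` is zero,
because `[f_i, f_θ] = 0` and the highest weight `θ` of the adjoint representation is not orthogonal
to all the simple roots that occur in `θ`. -/
theorem IsHighestRootWith.sum_perm_treeFun_eq_zero (hθ : IsHighestRootWith b θ a) {κ : ℂ}
    (hκ : κ ≠ 0) {A : ℕ} (π₂ : Fin A → ι)
    (hπ₂ : ∀ i, (Finset.univ.filter fun j => π₂ j = i).card = a i)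
    (Iθ : Fin A → ι) {cθ : ℂ} (hcθ : cθ ≠ 0) {fθ : 𝔤}
    (hfθ_root : fθ ∈ LieAlgebra.rootSpace H (-(θ.1 : H → ℂ)))
    (hfθ : fθ = cθ • iterBracket (List.ofFn fun p => b.f (Iθ p)))
    {J : Fin A → Fin A} (hJ : Function.Injective J) (hJθ : ∀ p, π₂ (J p) = Iθ p)
    {L K : Type*} [Fintype L] [DecidableEq L] [Field K] [Algebra ℂ K] (col : L → ι) {t : L → K}
    (ht : Function.Injective t) {x : L} {X : List L} (hX : (x :: X).Nodup)
    (hall : ∀ y, y ∈ x :: X) (hcol : X.map col = (List.ofFn Iθ).reverse) :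
    ∑ g : Equiv.Perm L with ∀ y, col (g y) = col y,
      treeFun (fun y y' => algebraMap ℂ K (normForm θ (b.baseSupp (col y)) (b.baseSupp (col y')) /
        κ) / (t y - t y')) ((x :: X).map g) = 0 := by
  obtain ⟨v, hv, hv0⟩ := θ.1.exists_ne_zero
  have hhw := hθ.isHighestWeightVector hv
  have hJb : Function.Bijective J := Finite.injective_iff_bijective.1 hJ
  -- some simple root of the content of `θ` is not orthogonal to `θ`, because `(θ, θ) = 2`
  obtain ⟨j, hj⟩ : ∃ j : Fin A, normForm θ (b.baseSupp (Iθ j)) θ.1.toLinear ≠ 0 := by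
    by_contra! h
    have h2 : normForm θ θ.1.toLinear θ.1.toLinear =
        ∑ j : Fin A, normForm θ (b.baseSupp (π₂ j)) θ.1.toLinear := by
      rw [← Finset.sum_fiberwise Finset.univ π₂]
      have : ∀ i, ∑ j with π₂ j = i, normForm θ (b.baseSupp (π₂ j)) θ.1.toLinear =
          a i * normForm θ (b.baseSupp i) θ.1.toLinear := by
        intro i
        rw [Finset.sum_congr rfl (g := fun _ => normForm θ (b.baseSupp i) θ.1.toLinear)
          (fun j hj => by rw [(Finset.mem_filter.1 hj).2]), Finset.sum_const, hπ₂, nsmul_eq_mul]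
      rw [Finset.sum_congr rfl fun i _ => this i]
      have hT := congrArg (fun χ : Dual ℂ H =>
        χ ((IsKilling.cartanEquivDual H).symm θ.1.toLinear)) hθ.eq_sum
      simp only [LinearMap.sum_apply, LinearMap.smul_apply, nsmul_eq_mul] at hT
      simp only [normForm]
      rw [hT, Finset.mul_sum, Finset.sum_div]
      exact Finset.sum_congr rfl fun i _ => by ring
    rw [normForm_self, Finset.sum_eq_zero] at h2
    · exact two_ne_zero h2
    · intro i _
      obtain ⟨p, rfl⟩ := hJb.2 i
      rw [hJθ, h]
  obtain ⟨x₀, hx₀⟩ : ∃ x₀ : L, col x₀ = Iθ j := by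
    have : Iθ j ∈ X.map col := by rw [hcol]; simp
    obtain ⟨x₀, _, h⟩ := List.mem_map.1 this
    exact ⟨x₀, h⟩
  refine _root_.sum_perm_treeFun_eq_zero hhw hv0
    (ex := fun i j => normForm θ (b.baseSupp i) (b.baseSupp j) / κ)
    (ez := fun i => -normForm θ (b.baseSupp i) θ.1.toLinear / κ)
    -- the sign makes the exponent with the base point equal to `-(α_i, θ) / κ`
    (r := fun i => -κ * lengthRatio b θ i)
    (fun i => mul_ne_zero (neg_ne_zero.2 hκ) (lengthRatio_ne_zero i)) ?_ ?_ ?_ col ht hX hall ?_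
    (x₀ := x₀) ?_
  · intro i j
    rw [apply_h' (θ := θ)]
    field_simp
  · intro i
    change (LieModule.Weight.toLinear ℂ H 𝔤 θ.1) (b.h' i) = _
    rw [apply_h' (θ := θ)]
    field_simp
  · intro i j
    rw [normForm_symm]
  · have h := lie_iterBracket_reverse (fun y => b.f (col y)) (x :: X) v
    refine Eq.trans h.symm ?_
    have hXne : X ≠ [] := by
      rintro rfl
      have := congrArg List.length hcol
      simp only [List.map_nil, List.length_nil, List.length_reverse, List.length_ofFn] at this
      exact (this ▸ j).elim0
    have hX' : (X.map fun y => b.f (col y)).reverse = List.ofFn fun p => b.f (Iθ p) := by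
      have := congrArg (fun l => (List.map b.f l).reverse) hcol
      simpa [List.map_ofFn, Function.comp_def] using this
    have hbr : iterBracket (List.ofFn fun p => b.f (Iθ p)) = cθ⁻¹ • fθ := by
      rw [hfθ, inv_smul_smul₀ hcθ]
    rw [iterBracket_reverse_cons _ _ hXne, hX', hbr, lie_smul,
      hθ.lie_f_eq_zero _ hfθ_root, smul_zero, zero_lie]
  · rw [hx₀]
    exact div_ne_zero (neg_ne_zero.2 hj) hκ

end HighestRoot

/-! ### Permutations acting on rational functions -/

section RatFieldLemmas

variable {T : Type}

theorem permRat_algebraMap (σ : Equiv.Perm T) (p : MvPolynomial T ℂ) :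
    permRat σ (algebraMap _ (RatField T) p) = algebraMap _ (RatField T) (MvPolynomial.rename σ p) :=
  IsFractionRing.lift_algebraMap (injective_permPoly σ) p

@[simp] theorem permRat_tvar (σ : Equiv.Perm T) (x : T) : permRat σ (tvar x) = tvar (σ x) := by
  simp [tvar, permRat_algebraMap]

@[simp] theorem permRat_cst (σ : Equiv.Perm T) (c : ℂ) : permRat σ (cst c) = cst c :=
  (permRat σ).commutes c

theorem permRat_ext {φ ψ : RatField T →ₐ[ℂ] RatField T} (h : ∀ x, φ (tvar x) = ψ (tvar x)) :
    φ = ψ := by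
  refine AlgHom.coe_ringHom_injective ?_
  refine IsLocalization.ringHom_ext (nonZeroDivisors (MvPolynomial T ℂ)) ?_
  have : (φ.comp (IsScalarTower.toAlgHom ℂ (MvPolynomial T ℂ) (RatField T))) =
      ψ.comp (IsScalarTower.toAlgHom ℂ (MvPolynomial T ℂ) (RatField T)) :=
    MvPolynomial.algHom_ext fun x => h x
  exact RingHom.ext fun p => DFunLike.congr_fun this p

theorem permRat_mul (σ τ : Equiv.Perm T) (f : RatField T) :
    permRat (σ * τ) f = permRat σ (permRat τ f) := by
  have : permRat (σ * τ) = (permRat σ).comp (permRat τ) := permRat_ext fun x => by simp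
  rw [this, AlgHom.comp_apply]

theorem tvar_injective : Function.Injective (tvar : T → RatField T) := fun _ _ h =>
  MvPolynomial.X_injective (IsFractionRing.injective (MvPolynomial T ℂ) (RatField T) h)

theorem cst_eq_algebraMap (c : ℂ) :
    (cst c : RatField T) = algebraMap (MvPolynomial T ℂ) (RatField T) (MvPolynomial.C c) :=
  IsScalarTower.algebraMap_apply ℂ (MvPolynomial T ℂ) (RatField T) c

theorem tvar_ne_cst (x : T) (c : ℂ) : (tvar x : RatField T) ≠ cst c := by
  rw [cst_eq_algebraMap]
  intro h
  have h := IsFractionRing.injective (MvPolynomial T ℂ) (RatField T) h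
  have := congrArg (MvPolynomial.aeval fun _ => c + 1) h
  simp at this

variable {ι : Type*} [Fintype T] {col : T → ι}

theorem mem_colourPerms {σ : Equiv.Perm T} : σ ∈ colourPerms col ↔ ∀ x, col (σ x) = col x := by
  simp [colourPerms]

theorem symRat_add (f g : RatField T) : symRat col (f + g) = symRat col f + symRat col g := by
  simp [symRat, Finset.sum_add_distrib]

theorem symRat_zero : symRat col (0 : RatField T) = 0 := by simp [symRat]

theorem symRat_sum {α : Type*} (s : Finset α) (f : α → RatField T) :
    symRat col (∑ i ∈ s, f i) = ∑ i ∈ s, symRat col (f i) := by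
  simp only [symRat, map_sum]
  exact Finset.sum_comm

theorem symRat_list_sum_eq_zero {l : List (RatField T)} (hl : ∀ f ∈ l, symRat col f = 0) :
    symRat col l.sum = 0 := by
  induction l with
  | nil => exact symRat_zero
  | cons f l ih =>
    rw [List.sum_cons, symRat_add, hl f (by simp), ih fun g hg => hl g (by simp [hg]), add_zero]

theorem symRat_cst_mul (c : ℂ) (f : RatField T) :
    symRat col (cst c * f) = cst c * symRat col f := by
  simp [symRat, Finset.mul_sum]

theorem symRat_permRat {σ : Equiv.Perm T} (hσ : σ ∈ colourPerms col) (f : RatField T) :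
    symRat col (permRat σ f) = symRat col f := by
  refine Finset.sum_bij (fun τ _ => τ * σ) ?_ (fun _ _ _ _ h => mul_right_cancel h) ?_ ?_
  · intro τ hτ
    rw [mem_colourPerms] at *
    intro x
    rw [Equiv.Perm.mul_apply, hτ, hσ]
  · intro τ hτ
    refine ⟨τ * σ⁻¹, ?_, by simp⟩
    rw [mem_colourPerms] at *
    intro x
    rw [Equiv.Perm.mul_apply, hτ, ← hσ]
    simp
  · intro τ _
    rw [permRat_mul]

/-- A rational function is invariant under the colour preserving permutations of the variables in
`S`. -/
def InvOn (col : T → ι) (S : Set T) (f : RatField T) : Prop :=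
  ∀ σ ∈ colourPerms col, (∀ x ∉ S, σ x = x) → permRat σ f = f

theorem InvOn.mul {S : Set T} {f g : RatField T} (hf : InvOn col S f) (hg : InvOn col S g) :
    InvOn col S (f * g) := fun σ hσ h => by rw [map_mul, hf σ hσ h, hg σ hσ h]

theorem InvOn.add {S : Set T} {f g : RatField T} (hf : InvOn col S f) (hg : InvOn col S g) :
    InvOn col S (f + g) := fun σ hσ h => by rw [map_add, hf σ hσ h, hg σ hσ h]

theorem InvOn.cst {S : Set T} (c : ℂ) : InvOn col S (cst c) := fun σ _ _ => permRat_cst σ c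

theorem InvOn.prod {α : Type*} {S : Set T} (s : Finset α) {f : α → RatField T}
    (hf : ∀ i ∈ s, InvOn col S (f i)) : InvOn col S (∏ i ∈ s, f i) := fun σ hσ h => by
  rw [map_prod]
  exact Finset.prod_congr rfl fun i hi => hf i hi σ hσ h

theorem InvOn.mono {S S' : Set T} (hS : S ⊆ S') {f : RatField T} (hf : InvOn col S' f) :
    InvOn col S f := fun σ hσ h => hf σ hσ fun x hx => h x fun hx' => hx (hS hx')

/-- If the symmetrisation over the permutations of a subset of the variables is zero, so is the
full symmetrisation, also after multiplication by an invariant. -/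
theorem symRat_eq_zero_of_sum_viaEmbedding {L : Type*} [Fintype L] [DecidableEq L]
    [DecidableEq ι] (j : L ↪ T) {f h : RatField T} (hh : InvOn col (Set.range j) h)
    (hf : ∑ g : Equiv.Perm L with ∀ y, col (j (g y)) = col (j y),
      permRat (g.viaEmbedding j) f = 0) : symRat col (h * f) = 0 := by
  classical
  have hmem : ∀ g : Equiv.Perm L, (∀ y, col (j (g y)) = col (j y)) →
      g.viaEmbedding j ∈ colourPerms col := by
    intro g hg
    rw [mem_colourPerms]
    intro x
    by_cases hx : x ∈ Set.range j
    · obtain ⟨y, rfl⟩ := hx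
      rw [Equiv.Perm.viaEmbedding_apply, hg]
    · rw [Equiv.Perm.viaEmbedding_apply_of_notMem _ _ _ hx]
  have h₁ : ∑ g : Equiv.Perm L with ∀ y, col (j (g y)) = col (j y), symRat col (h * f) = 0 := by
    rw [← symRat_zero (T := T) (col := col), ← mul_zero h, ← hf, Finset.mul_sum, symRat_sum]
    refine Finset.sum_congr rfl fun g hg => ?_
    have hg := hmem g (Finset.mem_filter.1 hg).2
    rw [← symRat_permRat hg, map_mul, hh _ hg fun x hx =>
      Equiv.Perm.viaEmbedding_apply_of_notMem _ _ _ hx]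
  rw [Finset.sum_const, nsmul_eq_mul] at h₁
  have : CharZero (RatField T) := charZero_of_injective_algebraMap (algebraMap ℂ _).injective
  -- the sum over the subset counts the full symmetrisation as often as there are permutations
  refine (mul_eq_zero.1 h₁).resolve_left (Nat.cast_ne_zero.2 (Finset.card_ne_zero.2 ⟨1, ?_⟩))
  simp

end RatFieldLemmas

/-! ### Moving a vertex of a forest to its base point -/

section Residues

variable {L K : Type*} [Field K] [Algebra ℂ K]

/-- The ways to cut off a branch of a forest: the exponents of the removed edge, the branch, and the
remaining forest. -/
def branches (e : L → L → ℂ) (b : L → ℂ) : List L → List (ℂ × List L × List L)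
  | [] => []
  | y :: w => (b y + (w.map (e y)).sum, [y], w) ::
      ((branches e b w).map (fun u => (u.1, u.2.1, y :: u.2.2)) ++
        (branches e b w).map (fun u => (u.1, y :: u.2.1, u.2.2)))

theorem branches_spec {e : L → L → ℂ} {b : L → ℂ} {w : List L} {u : ℂ × List L × List L}
    (hu : u ∈ branches e b w) : u.2.1 ≠ [] ∧ (u.2.1 ++ u.2.2).Perm w := by
  induction w generalizing u with
  | nil => simp [branches] at hu
  | cons y w ih =>
    simp only [branches, List.mem_cons, List.mem_append, List.mem_map] at hu
    obtain rfl | ⟨u, hu, rfl⟩ | ⟨u, hu, rfl⟩ := hu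
    · simp
    · exact ⟨(ih hu).1, List.perm_middle.trans ((ih hu).2.cons y)⟩
    · exact ⟨by simp, (ih hu).2.cons y⟩

/-- In a forest with base point `z`, the weights `t_y - z` cut off branches: writing `t_y - z` as
the sum of the differences along the path from `y` to `z` cancels one edge in each summand. -/
theorem forestFun_mul_sum {t : L → K} {z : K} (e : L → L → ℂ) (b : L → ℂ)
    (ht : Function.Injective t) (hz : ∀ x, t x ≠ z) (ψ : L → K) (w : List L) (hw : w.Nodup) :
    forestFun (fun x y => algebraMap ℂ K (e x y) / (t x - t y))
        (fun x => algebraMap ℂ K (b x) / (t x - z)) w *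
        (w.map fun y => (t y - z) * ψ y).sum =
      ((branches e b w).map fun u => algebraMap ℂ K u.1 *
        forestFun (fun x y => algebraMap ℂ K (e x y) / (t x - t y))
          (fun x => algebraMap ℂ K (b x) / (t x - z)) u.2.2 *
        (treeFun (fun x y => algebraMap ℂ K (e x y) / (t x - t y)) u.2.1 *
          (u.2.1.map ψ).sum)).sum := by
  induction w generalizing ψ with
  | nil => simp [branches]
  | cons y w ih =>
    rw [List.nodup_cons] at hw
    set k : L → L → K := fun x y => algebraMap ℂ K (e x y) / (t x - t y)
    set β : L → K := fun x => algebraMap ℂ K (b x) / (t x - z)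
    have hsum : ((branches e b w).map fun u => algebraMap ℂ K u.1 * forestFun k β (y :: u.2.2) *
          (treeFun k u.2.1 * (u.2.1.map ψ).sum)).sum +
        ((branches e b w).map fun u => algebraMap ℂ K u.1 * forestFun k β u.2.2 *
          (treeFun k (y :: u.2.1) * ((y :: u.2.1).map ψ).sum)).sum =
        forestFun k β w * (w.map fun q => (t q - z) * ψ q).sum * (β y + (w.map (k y)).sum) +
        forestFun k β w * (w.map fun q => (t q - z) * k y q).sum * ψ y := by
      rw [ih _ hw.2, ih _ hw.2, ← List.sum_map_mul_right, ← List.sum_map_mul_right,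
        ← List.sum_map_add, ← List.sum_map_add]
      refine congrArg List.sum (List.map_congr_left fun u hu => ?_)
      obtain ⟨hne, hp⟩ := branches_spec hu
      rw [treeFun_cons _ _ hne, forestFun, ← (hp.map (k y)).sum_eq, List.map_append,
        List.sum_append, List.map_cons, List.sum_cons]
      ring
    have hbase : (t y - z) * (β y + (w.map (k y)).sum) =
        algebraMap ℂ K (b y + (w.map (e y)).sum) + (w.map fun q => (t q - z) * k y q).sum := by
      have h₁ : (t y - z) * β y = algebraMap ℂ K (b y) :=
        mul_div_cancel₀ _ (sub_ne_zero.2 (hz y))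
      have h₂ : (t y - z) * (w.map (k y)).sum =
          algebraMap ℂ K (w.map (e y)).sum + (w.map fun q => (t q - z) * k y q).sum := by
        rw [map_list_sum, List.map_map, ← List.sum_map_add, ← List.sum_map_mul_left]
        refine congrArg List.sum (List.map_congr_left fun q hq => ?_)
        have : t y - t q ≠ 0 := sub_ne_zero.2 fun h => hw.1 (ht h ▸ hq)
        simp only [k, Function.comp]
        field_simp
        ring
      rw [mul_add, h₁, h₂, map_add, add_assoc]
    rw [branches, List.map_cons (a := y), List.sum_cons, List.map_cons, List.sum_cons,
      List.map_append, List.sum_append, List.map_map,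
      List.map_map]
    simp only [Function.comp_def]
    rw [hsum, forestFun]
    simp only [treeFun, List.map_cons, List.map_nil, List.sum_cons, List.sum_nil]
    linear_combination forestFun k β w * ψ y * hbase

end Residues

/-! ### Tree functions of variables that stand for a central element -/

namespace ResData

variable {ι : Type*} {n M A : ℕ} (D : ResData ι n M A) (m : ℕ)

/-- The weight `a(x, y) / (x - y)` of an edge. -/
def kern (x y : ResVar M m A) : RatField (ResVar M m A) :=
  cst (D.exv m x y) / (tvar x - tvar y)

/-- The weight `a(x, z_s) / (x - z_s)` of an edge that ends in `z_s`. -/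
def kernZ (s : Fin n) (x : ResVar M m A) : RatField (ResVar M m A) :=
  cst (D.exvz m x s) / (tvar x - cst (D.z s))

/-- The sequence of variables `v_{j_1}(p), …, v_{j_A}(p)`, from last to first. -/
def vList (p : Fin m) : List (ResVar M m A) := (List.ofFn fun k => v M p (D.seqJ k)).reverse

variable {D m}

theorem permRat_kern {σ : Equiv.Perm (ResVar M m A)} (hσ : σ ∈ colourPerms (D.col m))
    (x y : ResVar M m A) : permRat σ (D.kern m x y) = D.kern m (σ x) (σ y) := by
  rw [mem_colourPerms] at hσ
  simp [kern, exv, hσ, map_div₀]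

theorem permRat_kernZ {σ : Equiv.Perm (ResVar M m A)} (hσ : σ ∈ colourPerms (D.col m))
    (s : Fin n) (x : ResVar M m A) : permRat σ (D.kernZ m s x) = D.kernZ m s (σ x) := by
  rw [mem_colourPerms] at hσ
  simp [kernZ, exvz, hσ, map_div₀]

theorem permRat_treeFun {σ : Equiv.Perm (ResVar M m A)} (hσ : σ ∈ colourPerms (D.col m))
    (w : List (ResVar M m A)) :
    permRat σ (treeFun (D.kern m) w) = treeFun (D.kern m) (w.map σ) := by
  rw [map_treeFun, treeFun_map]
  simp only [permRat_kern hσ]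

theorem kern_symm (hsymm : ∀ i j, D.ex i j = D.ex j i) (x y : ResVar M m A) :
    D.kern m y x = -D.kern m x y := by
  rw [kern, kern, exv, hsymm, ← exv, ← neg_sub (tvar x), div_neg]

theorem invOn_treeFun {S : Set (ResVar M m A)} {w : List (ResVar M m A)} (hw : ∀ x ∈ w, x ∉ S) :
    InvOn (D.col m) S (treeFun (D.kern m) w) := by
  intro σ hσ h
  rw [permRat_treeFun hσ, List.map_congr_left (g := id) fun x hx => h x (hw x hx), List.map_id]

theorem invOn_forestFun {S : Set (ResVar M m A)} {β : ResVar M m A → RatField (ResVar M m A)}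
    {w : List (ResVar M m A)} (hw : ∀ x ∈ w, x ∉ S) (hβ : ∀ x ∈ w, InvOn (D.col m) S (β x)) :
    InvOn (D.col m) S (forestFun (D.kern m) β w) := by
  induction w with
  | nil => exact fun σ _ _ => map_one _
  | cons y w ih =>
    refine (ih (fun x hx => hw x (by simp [hx])) fun x hx => hβ x (by simp [hx])).mul
      ((hβ y (by simp)).add fun σ hσ h => ?_)
    rw [map_list_sum, List.map_map]
    refine congrArg List.sum (List.map_congr_left fun x hx => ?_)
    rw [Function.comp, permRat_kern hσ, h y (hw y (by simp)), h x (hw x (by simp [hx]))]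

theorem invOn_kernZ {S : Set (ResVar M m A)} {x : ResVar M m A} (hx : x ∉ S) (s : Fin n) :
    InvOn (D.col m) S (D.kernZ m s x) := fun σ hσ h => by rw [permRat_kernZ hσ, h x hx]

/-- The sum of the weights of all edges from `x` to a set of variables is invariant under the
permutations of the set. -/
theorem invOn_sum_kern {S : Set (ResVar M m A)} {x : ResVar M m A} (hx : x ∉ S)
    {l : List (ResVar M m A)} (hl : l.Nodup) (hS : ∀ y, y ∈ l ↔ y ∈ S) :
    InvOn (D.col m) S ((l.map (D.kern m x)).sum) := by
  intro σ hσ h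
  rw [map_list_sum, List.map_map]
  have hperm : (l.map σ).Perm l := by
    rw [List.perm_ext_iff_of_nodup (hl.map σ.injective) hl]
    intro y
    rw [List.mem_map]
    have key : ∀ z, σ z ∈ S ↔ z ∈ S := by
      intro z
      by_cases hz : z ∈ S
      · simp only [hz, iff_true]
        by_contra hσz
        exact hσz (by rwa [σ.injective (h _ hσz)])
      · rw [h z hz]
    constructor
    · rintro ⟨z, hz, rfl⟩
      rw [hS] at *
      exact (key z).2 hz
    · intro hy
      refine ⟨σ⁻¹ y, ?_, by simp⟩
      rw [hS, ← key]
      simpa using (hS y).1 hy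
  rw [← (hperm.map (D.kern m x)).sum_eq, List.map_map]
  refine congrArg List.sum (List.map_congr_left fun y _ => ?_)
  rw [Function.comp, permRat_kern hσ, h x hx, Function.comp]

variable (D m) in
/-- The tree function of a variable attached to `v_{j_1}(p), …, v_{j_A}(p)` vanishes when it is
symmetrised over these variables. -/
def TreesVanish : Prop := ∀ (p : Fin m) (x : ResVar M m A), x ∉ D.vList m p →
  ∀ h, InvOn (D.col m) {y | y ∈ x :: D.vList m p} h →
    symRat (D.col m) (h * treeFun (D.kern m) (x :: D.vList m p)) = 0

/-- If the variables `v(p)` stand for an element that commutes with every single generator, then it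
also commutes with all iterated commutators, such as the one of the sequence `S`. -/
theorem TreesVanish.symRat_eq_zero (hD : D.TreesVanish m) (hsymm : ∀ i j, D.ex i j = D.ex j i)
    {p : Fin m} (hV : D.vList m p ≠ [])
    {S : List (ResVar M m A)}
    (hS : (S ++ D.vList m p).Nodup) {h : RatField (ResVar M m A)}
    (hh : InvOn (D.col m) {y | y ∈ S ++ D.vList m p} h) :
    symRat (D.col m) (h * (treeFun (D.kern m) (D.vList m p) * (treeFun (D.kern m) S *
      (S.map fun y => ((D.vList m p).map (D.kern m y)).sum).sum))) = 0 := by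
  set V := D.vList m p with hVdef
  rw [treeFun_mul_sum (kern_symm hsymm), ← List.sum_map_mul_left, ← List.sum_map_mul_left]
  refine symRat_list_sum_eq_zero fun f hf => ?_
  obtain ⟨w, hw, rfl⟩ := List.mem_map.1 hf
  have hp := perm_of_mem_bracketWords hw
  have hwV : (w.2 ++ V).Nodup := (hp.append_right V).nodup_iff.2 hS
  rcases List.eq_nil_or_concat w.2 with hnil | ⟨w₁, x, hx⟩
  · -- the expansion of a commutator has no empty words
    rw [hnil] at hp
    rw [hp.nil_eq.symm] at hw
    simp [bracketWords] at hw
  rw [List.concat_eq_append] at hx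
  have hcast : ((w.1 : ℤ) : RatField (ResVar M m A)) = cst (w.1 : ℂ) := by simp [cst]
  have heq : h * (treeFun (D.kern m) V * ((w.1 : RatField (ResVar M m A)) *
      forestFun (D.kern m) (fun y => (V.map (D.kern m y)).sum) w.2)) =
      cst (w.1 : ℂ) * (h * forestFun (D.kern m)
        (fun y => ((x :: V).map (D.kern m y)).sum) w₁ * treeFun (D.kern m) (x :: V)) := by
    have h₁ := treeFun_append (D.kern m) w.2 hV
    have h₂ := treeFun_append (D.kern m) w₁ (List.cons_ne_nil x V)
    rw [hx, List.append_assoc, List.singleton_append] at h₁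
    rw [hx, hcast]
    linear_combination h * cst (w.1 : ℂ) * (h₂ - h₁)
  rw [heq, symRat_cst_mul, hVdef, hD p x, mul_zero]
  · rw [← hVdef]
    rw [hx] at hwV
    intro hxV
    have := (List.nodup_append.1 hwV).2.2 x (by simp) x hxV
    exact this rfl
  · rw [← hVdef]
    rw [hx, List.append_assoc, List.singleton_append] at hwV
    have hsub : {y | y ∈ x :: V} ⊆ {y | y ∈ S ++ V} := by
      intro y hy
      have : y ∈ w.2 ++ V := by
        rw [hx]; simp only [Set.mem_ofPred_eq, List.mem_cons] at hy; simp [hy]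
      exact (hp.append_right V).mem_iff.1 this
    have hdisj : ∀ y ∈ w₁, y ∉ x :: V :=
      fun y hy hy' => (List.nodup_append.1 hwV).2.2 y hy y hy' rfl
    refine (hh.mono hsub).mul (invOn_forestFun hdisj fun y hy => ?_)
    exact invOn_sum_kern (hdisj y hy) (List.nodup_append.1 hwV).2.1 fun z => Iff.rfl

end ResData

/-! ### The functions `A`, `B` and the highest root vector -/

section Sequences

variable {T : Type}

theorem funB_eq_forestFun (e : T → T → ℂ) (z : ℂ) (ez : T → ℂ) {N : ℕ} (x : Fin N → T) :
    funB e z ez x = forestFun (fun x y => cst (e x y) / (tvar x - tvar y))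
      (fun x => cst (ez x) / (tvar x - cst z)) (List.ofFn x).reverse := by
  induction N with
  | zero => simp [funB, forestFun]
  | succ N ih =>
    have hrec := ih fun i => x i.castSucc
    rw [List.ofFn_succ', List.concat_eq_append, List.reverse_append, List.reverse_singleton,
      List.singleton_append, forestFun, ← hrec, funB, Fin.prod_univ_castSucc, funB]
    congr 1
    · refine Finset.prod_congr rfl fun p _ => ?_
      simp [Finset.sum_filter, Fin.sum_univ_castSucc, Fin.le_last]
    · simp [Finset.sum_filter, Fin.sum_univ_castSucc, Fin.castSucc_lt_last, List.sum_reverse,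
        List.map_ofFn, List.sum_ofFn, List.map_reverse]

theorem funA_eq_treeFun (e : T → T → ℂ) {N : ℕ} (x : Fin N → T) :
    funA e x = treeFun (fun x y => cst (e x y) / (tvar x - tvar y)) (List.ofFn x).reverse := by
  induction N with
  | zero => simp [funA, treeFun]
  | succ N ih =>
    have hrec := ih fun i => x i.castSucc
    rw [List.ofFn_succ', List.concat_eq_append, List.reverse_append, List.reverse_singleton,
      List.singleton_append]
    rcases Nat.eq_zero_or_pos N with rfl | hN
    · simp [funA, treeFun, Finset.filter_singleton]
    rw [treeFun_cons _ _ (by simp; omega), ← hrec, funA, funA, Finset.prod_filter,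
      Finset.prod_filter, Fin.prod_univ_castSucc]
    congr 1
    · refine Finset.prod_congr rfl fun p _ => ?_
      simp [Finset.sum_filter, Fin.sum_univ_castSucc, (Fin.castSucc_lt_last p).not_gt]
    · simp [Finset.sum_filter, Fin.sum_univ_castSucc, Fin.castSucc_lt_last, List.sum_reverse,
        List.map_ofFn, List.sum_ofFn, List.map_reverse, hN]

end Sequences

namespace ResData

variable {ι : Type*} {n M A : ℕ} {D : ResData ι n M A} {m : ℕ}

theorem mem_vList (hJ : Function.Injective D.seqJ) {p : Fin m} {y : ResVar M m A} :
    y ∈ D.vList m p ↔ ∃ j, y = v M p j := by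
  simp only [vList, List.mem_reverse, List.mem_ofFn]
  constructor
  · rintro ⟨k, rfl⟩; exact ⟨_, rfl⟩
  · rintro ⟨j, rfl⟩
    obtain ⟨k, rfl⟩ := (Finite.injective_iff_bijective.1 hJ).2 j
    exact ⟨k, rfl⟩

theorem nodup_vList (hJ : Function.Injective D.seqJ) (p : Fin m) : (D.vList m p).Nodup := by
  rw [vList, List.nodup_reverse, List.nodup_ofFn]
  intro k k' h
  simp only [v, Sum.inr.injEq, Prod.mk.injEq, true_and] at h
  exact hJ h

theorem sum_vList {R : Type*} [AddCommMonoid R] (hJ : Function.Injective D.seqJ) (p : Fin m)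
    (F : ResVar M m A → R) : ((D.vList m p).map F).sum = ∑ j, F (v M p j) := by
  rw [vList, List.map_reverse, List.sum_reverse, List.map_ofFn, List.sum_ofFn]
  exact (Equiv.ofBijective _ (Finite.injective_iff_bijective.1 hJ)).sum_comp fun j => F (v M p j)

/-- The tree functions of the highest root vector vanish after symmetrisation when one more
variable is attached. -/
theorem treesVanish_lieResData {𝔤 : Type*} [LieRing 𝔤] [LieAlgebra ℂ 𝔤] [FiniteDimensional ℂ 𝔤]
    [LieAlgebra.IsSimple ℂ 𝔤] {H : LieSubalgebra ℂ 𝔤} [H.IsCartanSubalgebra]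
    [Fintype ι] [DecidableEq ι] {b : LieAlgebra.Basis ι H}
    {θ : H.root} {a : ι → ℕ} (hθ : IsHighestRootWith b θ a) {κ : ℂ} (hκ : κ ≠ 0)
    (Λ : Fin n → Module.Dual ℂ H) (z : Fin n → ℂ) (π₁ : Fin M → ι) (π₂ : Fin A → ι)
    (hπ₂ : ∀ i, (Finset.univ.filter fun j => π₂ j = i).card = a i) (I : Fin n → List (Fin M))
    (Iθ : Fin A → ι) {cθ : ℂ} (hcθ : cθ ≠ 0) {fθ : 𝔤}
    (hfθ_root : fθ ∈ LieAlgebra.rootSpace H (-(θ.1 : H → ℂ)))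
    (hfθ : fθ = cθ • iterBracket (List.ofFn fun p => b.f (Iθ p)))
    {J : Fin A → Fin A} (hJ : Function.Injective J) (hJθ : ∀ p, π₂ (J p) = Iθ p) :
    (lieResData b θ κ Λ z π₁ π₂ I J).TreesVanish m := by
  intro p x hx h hh
  set D := lieResData b θ κ Λ z π₁ π₂ I J with hD
  set V := D.vList m p with hV
  have hVn : V.Nodup := nodup_vList (D := D) hJ p
  classical
  let L := {y // y ∈ x :: V}
  let j : L ↪ ResVar M m A := Function.Embedding.subtype _
  have hrange : Set.range j = {y | y ∈ x :: V} := Subtype.range_coe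
  let x' : L := ⟨x, by simp⟩
  let X : List L := V.attach.map fun y => ⟨y.1, List.mem_cons_of_mem x y.2⟩
  have hX : X.map j = V := by
    simp only [X, List.map_map]
    exact List.attach_map_subtype_val V
  have hxX : (x' :: X).map j = x :: V := by rw [List.map_cons, hX]; rfl
  have hnd : (x' :: X).Nodup := by
    refine List.Nodup.of_map j ?_
    rw [hxX]
    exact List.nodup_cons.2 ⟨hx, hVn⟩
  have hall : ∀ y, y ∈ x' :: X := by
    intro y
    have : j y ∈ (x' :: X).map j := by rw [hxX]; exact y.2
    obtain ⟨y', hy', h⟩ := List.mem_map.1 this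
    rwa [← j.injective h]
  have hcol : X.map (fun y => D.col m (j y)) = (List.ofFn Iθ).reverse := by
    have : X.map (fun y => D.col m (j y)) = (X.map j).map (D.col m) := by
      rw [List.map_map (l := X)]; rfl
    rw [this, hX, hV, vList, List.map_reverse, List.map_ofFn]
    congr 2
    funext k
    exact hJθ k
  refine symRat_eq_zero_of_sum_viaEmbedding j (by rw [hrange]; exact hh) ?_
  have key := hθ.sum_perm_treeFun_eq_zero hκ π₂ hπ₂ Iθ hcθ hfθ_root hfθ hJ hJθ
    (K := RatField (ResVar M m A)) (fun y : L => D.col m (j y)) (t := fun y => tvar (j y))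
    (tvar_injective.comp j.injective) hnd hall hcol
  refine Eq.trans ?_ key
  refine Finset.sum_congr ?_ fun g hg => ?_
  · ext; simp
  have hgc : g.viaEmbedding j ∈ colourPerms (D.col m) := by
    have hg := (Finset.mem_filter.1 hg).2
    rw [mem_colourPerms]
    intro y
    by_cases hy : y ∈ Set.range j
    · obtain ⟨y, rfl⟩ := hy
      rw [Equiv.Perm.viaEmbedding_apply]
      exact hg y
    · rw [Equiv.Perm.viaEmbedding_apply_of_notMem _ _ _ hy]
  rw [permRat_treeFun hgc, ← hxX, List.map_map]
  have : (g.viaEmbedding j ∘ j) = j ∘ g := funext fun y => Equiv.Perm.viaEmbedding_apply g j y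
  rw [this, ← List.map_map, treeFun_map]
  rfl

/-! ### Attaching blocks of variables to the points `z_s` -/

variable (D m) in
/-- The variables that stand at the point `z_s` when the variables `v(p)`, for the entries `(p, s)`
of the list, have been added to the initial variables `u_i`, `i ∈ I_s`. -/
def content : List (Fin m × Fin n) → Fin n → List (ResVar M m A)
  | [], s => ((D.seqI s).map (u m A)).reverse
  | x :: l, s => if x.2 = s then D.vList m x.1 ++ content l s else content l s

variable (D m) in
/-- The sum of the weights of all edges from `v(p)` to `z_s` and the variables that stand there. -/
def attachSum (p : Fin m) (s : Fin n) (l : List (Fin m × Fin n)) : RatField (ResVar M m A) :=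
  ((D.vList m p).map fun x => D.kernZ m s x + ((D.content m l s).map (D.kern m x)).sum).sum

variable (D m) in
/-- The summand of `W_i` in which `v(p)` is attached to `z_s` or to a variable that stands there,
for each entry `(p, s)` of a list, the last entry first. -/
def attachProd : List (Fin m × Fin n) → RatField (ResVar M m A)
  | [] => 1
  | x :: l => attachProd l * (cst (D.z x.2) * D.attachSum m x.1 x.2 l)

theorem mem_content (hJ : Function.Injective D.seqJ) {l : List (Fin m × Fin n)} {s : Fin n}
    {y : ResVar M m A} :
    y ∈ D.content m l s ↔ (∃ i ∈ D.seqI s, y = u m A i) ∨ ∃ p, (p, s) ∈ l ∧ ∃ j, y = v M p j := by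
  induction l with
  | nil => simp [content, eq_comm]
  | cons x l ih =>
    obtain ⟨p, s'⟩ := x
    simp only [content]
    split_ifs with h
    · subst h
      rw [List.mem_append, ih, mem_vList hJ]
      simp only [List.mem_cons, Prod.mk.injEq, and_true]
      constructor
      · rintro (h | h | ⟨q, hq, h⟩)
        · exact Or.inr ⟨p, Or.inl rfl, h⟩
        · exact Or.inl h
        · exact Or.inr ⟨q, Or.inr hq, h⟩
      · rintro (h | ⟨q, rfl | hq, h⟩)
        · exact Or.inr (Or.inl h)
        · exact Or.inl h
        · exact Or.inr (Or.inr ⟨q, hq, h⟩)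
    · rw [ih]
      simp [Ne.symm h]

theorem nodup_content (hJ : Function.Injective D.seqJ) (hI : ∀ s, (D.seqI s).Nodup)
    {l : List (Fin m × Fin n)} (hl : (l.map Prod.fst).Nodup) (s : Fin n) :
    (D.content m l s).Nodup := by
  induction l with
  | nil => exact List.nodup_reverse.2 ((hI s).map Sum.inl_injective)
  | cons x l ih =>
    rw [List.map_cons, List.nodup_cons] at hl
    simp only [content]
    split_ifs with h
    · rw [List.nodup_append]
      refine ⟨nodup_vList hJ _, ih hl.2, ?_⟩
      rintro y hy y' hy' rfl
      rw [mem_vList hJ] at hy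
      rw [mem_content hJ] at hy'
      obtain ⟨j, rfl⟩ := hy
      rcases hy' with ⟨i, _, h⟩ | ⟨p, hp, j', h⟩
      · simp [u, v] at h
      · simp only [v, Sum.inr.injEq, Prod.mk.injEq] at h
        exact hl.1 (List.mem_map.2 ⟨(p, s), hp, h.1.symm⟩)
    · exact ih hl.2

theorem disjoint_content (hJ : Function.Injective D.seqJ)
    (hI : ∀ s s', s ≠ s' → List.Disjoint (D.seqI s) (D.seqI s')) {l : List (Fin m × Fin n)}
    (hl : (l.map Prod.fst).Nodup) {s s' : Fin n} (hs : s ≠ s') {y : ResVar M m A}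
    (hy : y ∈ D.content m l s) : y ∉ D.content m l s' := by
  rw [mem_content hJ] at *
  rintro (⟨i', hi', rfl⟩ | ⟨p', hp', j', rfl⟩)
  · rcases hy with ⟨i, hi, h⟩ | ⟨p, hp, j, h⟩
    · rw [Sum.inl_injective h] at hi'
      exact hI s s' hs hi hi'
    · simp [u, v] at h
  · rcases hy with ⟨i, hi, h⟩ | ⟨p, hp, j, h⟩
    · simp [u, v] at h
    · simp only [v, Sum.inr.injEq, Prod.mk.injEq] at h
      obtain ⟨rfl, _⟩ := h
      exact hs (congrArg Prod.snd (List.inj_on_of_nodup_map hl hp hp' rfl))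

theorem notMem_content (hJ : Function.Injective D.seqJ) {l : List (Fin m × Fin n)} {p : Fin m}
    (hp : p ∉ l.map Prod.fst) {s : Fin n} {y : ResVar M m A} (hy : y ∈ D.vList m p) :
    y ∉ D.content m l s := by
  rw [mem_vList hJ] at hy
  rw [mem_content hJ]
  obtain ⟨j, rfl⟩ := hy
  rintro (⟨i, _, h⟩ | ⟨p', hp', j', h⟩)
  · simp [u, v] at h
  · simp only [v, Sum.inr.injEq, Prod.mk.injEq] at h
    exact hp (List.mem_map.2 ⟨_, hp', h.1.symm⟩)

variable (D m) in
/-- Products over `s` of forest functions with base points `z_s`, whose sequences are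
rearrangements of the variables that stand at `z_s`. -/
def forestProducts (l : List (Fin m × Fin n)) : Set (RatField (ResVar M m A)) :=
  {f | ∃ w : Fin n → List (ResVar M m A), (∀ s, (w s).Perm (D.content m l s)) ∧
    f = ∏ s, forestFun (D.kern m) (D.kernZ m s) (w s)}

/-- Attaching the variables `v(p)` to a point amounts to applying the commutator `f_θ`, which is a
combination of words in the `f_i`. -/
theorem mem_span_forestProducts (hsymm : ∀ i j, D.ex i j = D.ex j i)
    (l : List (Fin m × Fin n)) :
    D.prodB m * (l.map fun x => treeFun (D.kern m) (D.vList m x.1)).prod * D.attachProd m l ∈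
      Submodule.span ℂ (D.forestProducts m l) := by
  induction l with
  | nil =>
    refine Submodule.subset_span ⟨fun s => D.content m [] s, fun s => List.Perm.refl _, ?_⟩
    simp only [List.map_nil, List.prod_nil, attachProd, mul_one, prodB]
    refine Finset.prod_congr rfl fun s _ => ?_
    rw [funB_eq_forestFun, content]
    congr 2
    refine List.ext_getElem (by simp) fun i h₁ h₂ => ?_
    simp
  | cons x l ih =>
    obtain ⟨p, s⟩ := x
    set V := D.vList m p with hV
    have hle : Submodule.span ℂ (D.forestProducts m l) ≤
        (Submodule.span ℂ (D.forestProducts m ((p, s) :: l))).comap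
          (LinearMap.mulRight ℂ (treeFun (D.kern m) V * (cst (D.z s) * D.attachSum m p s l))) := by
      rw [Submodule.span_le]
      rintro _ ⟨w, hw, rfl⟩
      simp only [Submodule.comap_coe, Set.mem_preimage, LinearMap.mulRight_apply, SetLike.mem_coe]
      have h₁ : D.attachSum m p s l =
          (V.map fun x => D.kernZ m s x + ((w s).map (D.kern m x)).sum).sum := by
        refine congrArg List.sum (List.map_congr_left fun x _ => ?_)
        rw [((hw s).map (D.kern m x)).sum_eq]
      have h₂ := treeFun_mul_sum (kern_symm hsymm)
        (fun x => D.kernZ m s x + ((w s).map (D.kern m x)).sum) V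
      rw [← h₁] at h₂
      have h₃ : (∏ s', forestFun (D.kern m) (D.kernZ m s') (w s')) *
          (treeFun (D.kern m) V * (cst (D.z s) * D.attachSum m p s l)) =
          D.z s • ((bracketWords V).map fun w' => (w'.1 : ℂ) •
            ∏ s', forestFun (D.kern m) (D.kernZ m s')
              (Function.update w s (w'.2 ++ w s) s')).sum := by
        rw [mul_left_comm (treeFun _ _), h₂, ← Finset.mul_prod_erase _ _ (Finset.mem_univ s),
          Algebra.smul_def, ← cst, ← List.sum_map_mul_left, ← List.sum_map_mul_left,
          ← List.sum_map_mul_left]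
        refine congrArg List.sum (List.map_congr_left fun w' _ => ?_)
        rw [← Finset.mul_prod_erase _ _ (Finset.mem_univ s), Function.update_self,
          forestFun_append, Algebra.smul_def, map_intCast]
        have : ∏ s' ∈ Finset.univ.erase s, forestFun (D.kern m) (D.kernZ m s')
            (Function.update w s (w'.2 ++ w s) s') =
            ∏ s' ∈ Finset.univ.erase s, forestFun (D.kern m) (D.kernZ m s') (w s') :=
          Finset.prod_congr rfl fun s' hs' => by
            rw [Function.update_of_ne (Finset.ne_of_mem_erase hs')]
        rw [this]
        ring
      rw [h₃]
      refine Submodule.smul_mem _ _ (list_sum_mem fun f hf => ?_)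
      obtain ⟨w', hw', rfl⟩ := List.mem_map.1 hf
      refine Submodule.smul_mem _ _ (Submodule.subset_span ⟨_, fun s' => ?_, rfl⟩)
      by_cases hs' : s' = s
      · subst hs'
        rw [Function.update_self, content, if_pos rfl]
        exact (perm_of_mem_bracketWords hw').append (hw s')
      · rw [Function.update_of_ne hs', content, if_neg (Ne.symm hs')]
        exact hw s'
    have := hle ih
    rw [Submodule.mem_comap, LinearMap.mulRight_apply] at this
    convert this using 1
    rw [attachProd, List.map_cons, List.prod_cons]
    ring

/-- The weights `y - z_s` of the edges between `v(p)` and the variables `y` that stand at `z_s`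
contribute nothing to the symmetrisation: by `forestFun_mul_sum` they cut a branch off the forest at
`z_s`, and what is left is the tree function of that branch joined to the one of `v(p)`. -/
theorem TreesVanish.symRat_attach_eq_zero (hD : D.TreesVanish m)
    (hsymm : ∀ i j, D.ex i j = D.ex j i) (hJ : Function.Injective D.seqJ) (hA : 0 < A)
    (hI : ∀ s, (D.seqI s).Nodup)
    (hI' : ∀ s s', s ≠ s' → List.Disjoint (D.seqI s) (D.seqI s'))
    {l : List (Fin m × Fin n)} (hl : (l.map Prod.fst).Nodup) {p : Fin m}
    (hp : p ∉ l.map Prod.fst) (s : Fin n) {h : RatField (ResVar M m A)}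
    (hh : InvOn (D.col m) {y | y ∈ D.content m l s ++ D.vList m p} h) :
    symRat (D.col m) (h * treeFun (D.kern m) (D.vList m p) *
      (D.prodB m * (l.map fun x => treeFun (D.kern m) (D.vList m x.1)).prod * D.attachProd m l) *
      ((D.content m l s).map fun y => (tvar y - cst (D.z s)) *
        ((D.vList m p).map fun x => D.kern m x y).sum).sum) = 0 := by
  set V := D.vList m p with hV
  have hVne : V ≠ [] := by
    intro h
    have := congrArg List.length h
    simp [hV, vList] at this
    omega
  have hspan := mem_span_forestProducts (m := m) hsymm l
  revert hspan
  generalize D.prodB m * (l.map fun x => treeFun (D.kern m) (D.vList m x.1)).prod *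
    D.attachProd m l = f
  intro hspan
  induction hspan using Submodule.span_induction with
  | zero => simp [symRat_zero]
  | add f g _ _ hf hg => rw [mul_add, add_mul, symRat_add, hf, hg, add_zero]
  | smul c f _ hf =>
    rw [Algebra.smul_def, ← cst, mul_left_comm, mul_assoc (cst c), symRat_cst_mul, hf, mul_zero]
  | mem f hf =>
    obtain ⟨w, hw, rfl⟩ := hf
    have hwn : (w s).Nodup := (hw s).nodup_iff.2 (nodup_content hJ hI hl s)
    have hU := forestFun_mul_sum (K := RatField (ResVar M m A)) (D.exv m)
      (fun x => D.exvz m x s) tvar_injective (fun x => tvar_ne_cst x (D.z s))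
      (fun y => (V.map fun x => D.kern m x y).sum) (w s) hwn
    change forestFun (D.kern m) (D.kernZ m s) (w s) * _ = _ at hU
    rw [← Finset.mul_prod_erase _ _ (Finset.mem_univ s), mul_assoc,
      mul_right_comm (forestFun _ _ _), ← ((hw s).map _).sum_eq, hU, ← List.sum_map_mul_right,
      ← List.sum_map_mul_left]
    refine symRat_list_sum_eq_zero fun f hf => ?_
    obtain ⟨b, hb, rfl⟩ := List.mem_map.1 hf
    obtain ⟨_, hbp⟩ := branches_spec hb
    have hbw := hbp.trans (hw s)
    have hneg : (b.2.1.map fun y => (V.map fun x => D.kern m x y).sum).sum =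
        -(b.2.1.map fun y => (V.map (D.kern m y)).sum).sum := by
      rw [← neg_one_mul, ← List.sum_map_mul_left]
      refine congrArg List.sum (List.map_congr_left fun y _ => ?_)
      rw [← neg_one_mul, ← List.sum_map_mul_left]
      refine congrArg List.sum (List.map_congr_left fun x _ => ?_)
      rw [kern_symm hsymm y x]
      ring
    have hdisjV : ∀ y ∈ V, ∀ s', y ∉ D.content m l s' := fun y hy s' => notMem_content hJ hp hy
    have hbn : (b.2.1 ++ b.2.2).Nodup := hbp.nodup_iff.2 hwn
    have hmem : ∀ y ∈ b.2.1 ++ b.2.2, y ∈ D.content m l s := fun y hy => hbw.mem_iff.1 hy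
    have hSV : (b.2.1 ++ V).Nodup := by
      refine List.nodup_append.2 ⟨(List.nodup_append.1 hbn).1, nodup_vList hJ p, ?_⟩
      rintro y hy y' hy' rfl
      exact hdisjV y hy' s (hmem y (by simp [hy]))
    have hkZ : ∀ (s' : Fin n) (r : List (ResVar M m A)), (∀ y ∈ r, y ∉ b.2.1 ++ V) →
        InvOn (D.col m) {y | y ∈ b.2.1 ++ V} (forestFun (D.kern m) (D.kernZ m s') r) :=
      fun s' r hr => invOn_forestFun hr fun y hy => invOn_kernZ (hr y hy) s'
    have hR : ∀ y ∈ b.2.2, y ∉ b.2.1 ++ V := by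
      intro y hy hy'
      rcases List.mem_append.1 hy' with hy' | hy'
      · exact (List.nodup_append.1 hbn).2.2 y hy' y hy rfl
      · exact hdisjV y hy' s (hmem y (by simp [hy]))
    have hother : ∀ s' ∈ Finset.univ.erase s, ∀ y ∈ w s', y ∉ b.2.1 ++ V := by
      intro s' hs' y hy hy'
      have hy := (hw s').mem_iff.1 hy
      rcases List.mem_append.1 hy' with hy' | hy'
      · exact disjoint_content hJ hI' hl (Finset.ne_of_mem_erase hs') hy
          (hmem y (by simp [hy']))
      · exact hdisjV y hy' s' hy
    have hinv : InvOn (D.col m) {y | y ∈ b.2.1 ++ V} (cst (-b.1) * (h *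
        (forestFun (D.kern m) (D.kernZ m s) b.2.2 *
          ∏ s' ∈ Finset.univ.erase s, forestFun (D.kern m) (D.kernZ m s') (w s')))) := by
      refine (InvOn.cst _).mul ((hh.mono ?_).mul ((hkZ s _ hR).mul
        (InvOn.prod _ fun s' hs' => hkZ s' _ (hother s' hs'))))
      intro y hy
      rcases List.mem_append.1 hy with hy | hy
      · exact List.mem_append.2 (Or.inl (hmem y (by simp [hy])))
      · exact List.mem_append.2 (Or.inr hy)
    refine Eq.trans (congrArg _ ?_) (hD.symRat_eq_zero hsymm hVne hSV hinv)
    rw [hneg, show (cst (-b.1) : RatField (ResVar M m A)) = -cst b.1 from map_neg _ _]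
    change h * treeFun (D.kern m) V * (cst b.1 * forestFun (D.kern m) (D.kernZ m s) b.2.2 *
      (treeFun (D.kern m) b.2.1 * _) * _) = _
    ring

end ResData

/-! ### The functions `W_i` as sums over sequences of attachments -/

theorem consPair_injective {α : Type*} :
    Function.Injective fun t : List α × α => t.2 :: t.1 := fun t t' h => by
  obtain ⟨h₁, h₂⟩ := List.cons.inj h
  exact Prod.ext h₂ h₁

/-- The lists of length `i` of pairs `(p, s)` whose first entries are distinct elements of `P`. -/
def attachLists {m : ℕ} (n : ℕ) (P : Finset (Fin m)) : ℕ → Finset (List (Fin m × Fin n))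
  | 0 => {[]}
  | i + 1 => (((attachLists n P i) ×ˢ (P ×ˢ Finset.univ)).filter
      fun t => t.2.1 ∉ t.1.map Prod.fst).map
        ⟨fun t => t.2 :: t.1, consPair_injective⟩

/-- The elements of `P` that do not occur in a list of attachments. -/
def unattached {m n : ℕ} (P : Finset (Fin m)) (l : List (Fin m × Fin n)) : Finset (Fin m) :=
  P.filter (· ∉ l.map Prod.fst)

section AttachLists

variable {m n : ℕ} {P : Finset (Fin m)}

theorem mem_attachLists {i : ℕ} {l : List (Fin m × Fin n)} :
    l ∈ attachLists n P i ↔ l.length = i ∧ (l.map Prod.fst).Nodup ∧ ∀ x ∈ l, x.1 ∈ P := by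
  induction i generalizing l with
  | zero =>
    simp only [attachLists, Finset.mem_singleton, List.length_eq_zero_iff]
    constructor
    · rintro rfl; simp
    · exact fun h => h.1
  | succ i ih =>
    simp only [attachLists, Finset.mem_map, Finset.mem_filter, Finset.mem_product,
      Finset.mem_univ, and_true, Function.Embedding.coeFn_mk, Prod.exists, ih]
    constructor
    · rintro ⟨l, p, s, ⟨⟨⟨h₁, h₂, h₃⟩, hp⟩, hpl⟩, rfl⟩
      refine ⟨by simp [h₁], by rw [List.map_cons, List.nodup_cons]; exact ⟨hpl, h₂⟩, ?_⟩
      rintro x hx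
      rcases List.mem_cons.1 hx with rfl | hx
      · exact hp
      · exact h₃ x hx
    · rintro ⟨h₁, h₂, h₃⟩
      cases l with
      | nil => simp at h₁
      | cons x l =>
        rw [List.map_cons, List.nodup_cons] at h₂
        exact ⟨l, x.1, x.2, ⟨⟨⟨by simpa using h₁, h₂.2, fun y hy => h₃ y (by simp [hy])⟩,
          h₃ x (by simp)⟩, h₂.1⟩, rfl⟩

theorem sum_attachLists_succ {R : Type*} [AddCommMonoid R] (i : ℕ)
    (F : List (Fin m × Fin n) → R) :
    ∑ l ∈ attachLists n P (i + 1), F l =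
      ∑ l ∈ attachLists n P i, ∑ p ∈ unattached P l, ∑ s, F ((p, s) :: l) := by
  simp only [attachLists, Finset.sum_map, Finset.sum_filter, Finset.sum_product,
    Function.Embedding.coeFn_mk, unattached]
  refine Finset.sum_congr rfl fun l _ => Finset.sum_congr rfl fun p _ => ?_
  split_ifs <;> simp

theorem card_unattached {i : ℕ} {l : List (Fin m × Fin n)} (hl : l ∈ attachLists n P i) :
    (unattached P l).card + i = P.card := by
  rw [mem_attachLists] at hl
  have h₁ : (l.map Prod.fst).toFinset.card = i := by
    rw [List.toFinset_card_of_nodup hl.2.1, List.length_map, hl.1]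
  have h₂ : (l.map Prod.fst).toFinset ⊆ P := by
    intro p hp
    rw [List.mem_toFinset, List.mem_map] at hp
    obtain ⟨x, hx, rfl⟩ := hp
    exact hl.2.2 x hx
  have h₃ : unattached P l = P \ (l.map Prod.fst).toFinset := by
    ext p; simp [unattached]
  rw [h₃, Finset.card_sdiff_of_subset h₂, h₁]
  have := Finset.card_le_card h₂
  omega

theorem sum_erase_eq {R : Type*} [AddCommMonoid R] {i : ℕ} {l : List (Fin m × Fin n)}
    (hl : l ∈ attachLists n P i) {p : Fin m} (hp : p ∈ unattached P l) (F : Fin m → R) :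
    ∑ p' ∈ P.erase p, F p' = (l.map fun x => F x.1).sum +
      ∑ p' ∈ (unattached P l).erase p, F p' := by
  rw [mem_attachLists] at hl
  have h₁ : (l.map fun x => F x.1).sum = ∑ p' ∈ (l.map Prod.fst).toFinset, F p' := by
    rw [List.sum_toFinset _ hl.2.1, List.map_map]; rfl
  rw [h₁, ← Finset.sum_union]
  · refine Finset.sum_congr ?_ fun _ _ => rfl
    rw [unattached, Finset.mem_filter] at hp
    ext q
    simp only [Finset.mem_erase, Finset.mem_union, List.mem_toFinset, unattached,
      Finset.mem_filter]
    constructor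
    · rintro ⟨h, hq⟩
      by_cases hql : q ∈ l.map Prod.fst
      · exact Or.inl hql
      · exact Or.inr ⟨h, hq, hql⟩
    · rintro (hq | ⟨h, hq, _⟩)
      · obtain ⟨x, hx, rfl⟩ := List.mem_map.1 hq
        exact ⟨fun h => hp.2 (h ▸ hq), hl.2.2 x hx⟩
      · exact ⟨h, hq⟩
  · rw [Finset.disjoint_left]
    intro q hq hq'
    rw [List.mem_toFinset] at hq
    exact (Finset.mem_filter.1 (Finset.mem_of_mem_erase hq')).2 hq

theorem sum_attachLists_erase {R : Type*} [AddCommMonoid R] (i : ℕ)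
    (F : Fin m → List (Fin m × Fin n) → R) :
    ∑ p ∈ P, ∑ l ∈ attachLists n (P.erase p) i, F p l =
      ∑ l ∈ attachLists n P i, ∑ p ∈ unattached P l, F p l := by
  refine Finset.sum_comm' fun p l => ?_
  simp only [mem_attachLists, unattached, Finset.mem_filter, Finset.mem_erase, List.mem_map,
    not_exists, not_and]
  constructor
  · rintro ⟨hp, h₁, h₂, h₃⟩
    exact ⟨⟨hp, fun x hx => (h₃ x hx).1⟩, h₁, h₂, fun x hx => (h₃ x hx).2⟩
  · rintro ⟨⟨hp, h⟩, h₁, h₂, h₃⟩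
    exact ⟨hp, h₁, h₂, fun x hx => ⟨h x hx, h₃ x hx⟩⟩

end AttachLists

namespace ResData

variable {ι : Type*} {n M A : ℕ} {D : ResData ι n M A} {m : ℕ}

variable (D m) in
/-- The part of `W_i` that involves the variables `v(p)` with `p ∈ P` only. -/
def partW (P : Finset (Fin m)) (i : ℕ) : RatField (ResVar M m A) :=
  ∑ l ∈ attachLists n P i, D.attachProd m l

open Classical in
/-- The sum over the points `t_j` that are admissible for the `j`-th factor of a term of `W_i`. -/
theorem sum_admissible_eq_attachSum (hJ : Function.Injective D.seqJ)
    (hI : ∀ s, (D.seqI s).Nodup) {i : ℕ} {p : Fin i → Fin m} (s : Fin i → Fin n)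
    {l : List (Fin m × Fin n)} (hln : (l.map Prod.fst).Nodup) (j : Fin i)
    (hl : ∀ x, x ∈ l ↔ ∃ k, k < j ∧ (p k, s k) = x) :
    ∑ q : Fin A, ∑ t : ResVar M m A ⊕ Fin n with D.Admissible m s p j t,
      cst (D.z (s j)) * (cst (D.exPt m (v M (p j) q) t) / (tvar (v M (p j) q) - D.pt m t)) =
      cst (D.z (s j)) * D.attachSum m (p j) (s j) l := by
  rw [attachSum, sum_vList hJ, Finset.mul_sum]
  refine Finset.sum_congr rfl fun q _ => ?_
  rw [Finset.sum_filter, Fintype.sum_sum_type, mul_add, add_comm]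
  congr 1
  · have hadm : ∀ s', D.Admissible m s p j (Sum.inr s') ↔ s' = s j := fun s' => Iff.rfl
    simp only [hadm]
    rw [Finset.sum_ite_eq' Finset.univ (s j), if_pos (Finset.mem_univ _)]
    rfl
  · rw [← List.sum_toFinset _ (nodup_content hJ hI hln (s j)), Finset.mul_sum,
      ← Finset.sum_filter]
    refine Finset.sum_congr ?_ fun y _ => rfl
    ext y
    simp only [Finset.mem_filter, Finset.mem_univ, true_and, List.mem_toFinset, mem_content hJ]
    rcases y with y | ⟨r, y⟩
    · change y ∈ D.seqI (s j) ↔ _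
      simp [u, v]
    · change (∃ k : Fin i, k < j ∧ s k = s j ∧ p k = r) ↔ _
      simp only [u, v, reduceCtorEq, and_false, exists_false, false_or, hl, Sum.inr.injEq,
        Prod.mk.injEq]
      constructor
      · rintro ⟨k, hk, hs, hp⟩
        exact ⟨r, ⟨k, hk, hp, hs⟩, y, rfl, rfl⟩
      · rintro ⟨r', ⟨k, hk, hp, hs⟩, y', rfl, _⟩
        exact ⟨k, hk, hs, hp⟩

open Classical in
theorem prod_sum_admissible (hJ : Function.Injective D.seqJ) (hI : ∀ s, (D.seqI s).Nodup)
    {i : ℕ} (p : Fin i → Fin m) (hp : Function.Injective p) (s : Fin i → Fin n) :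
    ∏ j, ∑ q : Fin A, ∑ t : ResVar M m A ⊕ Fin n with D.Admissible m s p j t,
      cst (D.z (s j)) * (cst (D.exPt m (v M (p j) q) t) / (tvar (v M (p j) q) - D.pt m t)) =
      D.attachProd m (List.ofFn fun j => (p j, s j)).reverse := by
  induction i with
  | zero => simp [attachProd]
  | succ i ih =>
    have hrec := ih (fun j => p j.castSucc) (fun _ _ h => Fin.castSucc_injective i (hp h))
      (fun j => s j.castSucc)
    rw [List.ofFn_succ', List.concat_eq_append, List.reverse_append, List.reverse_singleton,
      List.singleton_append, attachProd, ← hrec, Fin.prod_univ_castSucc]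
    congr 1
    · refine Finset.prod_congr rfl fun j _ => Finset.sum_congr rfl fun q _ =>
        Finset.sum_congr ?_ fun _ _ => rfl
      refine Finset.filter_congr fun t _ => ?_
      rcases t with (t | ⟨r, y⟩) | t
      · exact Iff.rfl
      · change (∃ k : Fin (i + 1), k < j.castSucc ∧ s k = s j.castSucc ∧ p k = r) ↔
          ∃ k : Fin i, k < j ∧ s k.castSucc = s j.castSucc ∧ p k.castSucc = r
        constructor
        · rintro ⟨k, hk, h⟩
          refine ⟨k.castLT (lt_trans (Fin.lt_def.1 hk) j.2), hk, h⟩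
        · rintro ⟨k, hk, h⟩
          exact ⟨k.castSucc, hk, h⟩
      · exact Iff.rfl
    · refine sum_admissible_eq_attachSum hJ hI s ?_ (Fin.last i) ?_
      · rw [List.map_reverse, List.map_ofFn, List.nodup_reverse, List.nodup_ofFn]
        exact fun _ _ h => Fin.castSucc_injective i (hp h)
      · intro x
        rw [List.mem_reverse, List.mem_ofFn]
        constructor
        · rintro ⟨k, rfl⟩
          exact ⟨k.castSucc, Fin.castSucc_lt_last k, rfl⟩
        · rintro ⟨k, hk, rfl⟩
          exact ⟨k.castLT hk, rfl⟩

theorem funW_eq_partW (hJ : Function.Injective D.seqJ) (hI : ∀ s, (D.seqI s).Nodup) (i : ℕ) :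
    D.funW m i = D.partW m Finset.univ i := by
  classical
  have h₁ : ∀ p : Fin i ↪ Fin m, D.funWp m p =
      ∑ s : Fin i → Fin n, D.attachProd m (List.ofFn fun j => (p j, s j)).reverse := by
    intro p
    rw [funWp]
    refine Finset.sum_congr rfl fun s _ => ?_
    rw [← prod_sum_admissible hJ hI p p.injective s, Finset.prod_univ_sum, Fintype.piFinset_univ]
    refine Finset.sum_congr rfl fun q _ => ?_
    rw [Finset.prod_univ_sum]
    refine Finset.sum_congr ?_ fun t _ => rfl
    ext t
    simp [Fintype.mem_piFinset]
  simp only [funW, h₁, partW]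
  rw [← Finset.sum_product']
  refine Finset.sum_bij (fun t _ => (List.ofFn fun j => (t.1 j, t.2 j)).reverse) ?_ ?_ ?_ ?_
  · rintro ⟨p, s⟩ _
    rw [mem_attachLists]
    refine ⟨by simp, ?_, by simp⟩
    rw [List.map_reverse, List.map_ofFn, List.nodup_reverse, List.nodup_ofFn]
    exact p.injective
  · rintro ⟨p, s⟩ _ ⟨p', s'⟩ _ h
    have h := List.ofFn_injective (List.reverse_injective h)
    simp only [funext_iff, Prod.mk.injEq] at h
    exact Prod.ext (DFunLike.ext _ _ fun j => (h j).1) (funext fun j => (h j).2)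
  · intro l hl
    rw [mem_attachLists] at hl
    obtain ⟨rfl, hn, -⟩ := hl
    have hlen : l.reverse.length = l.length := List.length_reverse
    refine ⟨(⟨fun j => (l.reverse.get (j.cast hlen.symm)).1, ?_⟩,
      fun j => (l.reverse.get (j.cast hlen.symm)).2), by simp, ?_⟩
    · intro j j' h
      have hn' : (l.reverse.map Prod.fst).Nodup := by
        rw [List.map_reverse, List.nodup_reverse]; exact hn
      have h' : (l.reverse.get (j.cast hlen.symm)) = l.reverse.get (j'.cast hlen.symm) :=
        List.inj_on_of_nodup_map hn' (List.get_mem _ _) (List.get_mem _ _) h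
      have := List.nodup_iff_injective_get.1 hn'.of_map h'
      exact Fin.ext (by simpa using congrArg Fin.val this)
    · rw [List.reverse_eq_iff]
      refine List.ext_getElem (by simp) fun k h₁ h₂ => ?_
      simp
  · intros; rfl

/-! ### The recursion for the functions `W_i` -/

theorem sum_content (hI : ∀ s, (D.seqI s).Nodup)
    (hI' : ∀ s s', s ≠ s' → List.Disjoint (D.seqI s) (D.seqI s')) (hIc : ∀ j, ∃ s, j ∈ D.seqI s)
    (hJ : Function.Injective D.seqJ)
    {R : Type*} [AddCommMonoid R] (F : ResVar M m A → R) (l : List (Fin m × Fin n)) :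
    ∑ s, ((D.content m l s).map F).sum =
      ∑ i, F (u m A i) + (l.map fun x => ∑ r, F (v M x.1 r)).sum := by
  induction l with
  | nil =>
    simp only [content, List.map_reverse, List.sum_reverse, List.map_map, List.map_nil,
      List.sum_nil, add_zero]
    classical
    have h₁ : ∀ s, ((D.seqI s).map (F ∘ u m A)).sum = ∑ i ∈ (D.seqI s).toFinset, F (u m A i) :=
      fun s => (List.sum_toFinset _ (hI s)).symm
    rw [Finset.sum_congr rfl fun s _ => h₁ s, ← Finset.sum_biUnion]
    · refine Finset.sum_congr ?_ fun _ _ => rfl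
      ext i
      simpa using hIc i
    · intro s _ s' _ hs
      rw [Function.onFun, Finset.disjoint_left]
      intro i hi hi'
      exact hI' s s' hs (List.mem_toFinset.1 hi) (List.mem_toFinset.1 hi')
  | cons x l ih =>
    have h₁ : ∀ s, ((D.content m (x :: l) s).map F).sum =
        (if s = x.2 then ∑ r, F (v M x.1 r) else 0) + ((D.content m l s).map F).sum := by
      intro s
      simp only [content]
      split_ifs with h h' h'
      · rw [List.map_append, List.sum_append, sum_vList hJ]
      · exact absurd h.symm h'
      · exact absurd h'.symm h
      · rw [zero_add]
    rw [Finset.sum_congr rfl fun s _ => h₁ s, Finset.sum_add_distrib, ih, List.map_cons,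
      List.sum_cons, Finset.sum_ite_eq', if_pos (Finset.mem_univ _)]
    exact add_left_comm _ _ _

variable (D m) in
/-- The factor by which `A_J(v(p))` is multiplied in the differential that defines `Ω̃(p)`, if the
variables `v(p')`, `p' ∈ P`, precede `v(p)`. -/
def eulerFactor (p : Fin m) (P : Finset (Fin m)) : RatField (ResVar M m A) :=
  cst (1 + D.numB) + ∑ j, tvar (v M p j) * (∑ s, D.kernZ m s (v M p j) +
    ∑ i, D.kern m (v M p j) (u m A i) + ∑ p' ∈ P, ∑ r, D.kern m (v M p j) (v M p' r))

variable (D m) in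
/-- The terms of `eulerFactor` that vanish after symmetrisation. -/
def errorTerm (p : Fin m) (l : List (Fin m × Fin n)) : RatField (ResVar M m A) :=
  ∑ s, ((D.content m l s).map fun y => (tvar y - cst (D.z s)) *
    ((D.vList m p).map fun x => D.kern m x y).sum).sum

variable (D m) in
/-- The sum of the terms `v_j(p) a / (v_j(p) - v_r(p'))` for given `p` and `p'`. -/
def crossSum (p p' : Fin m) : RatField (ResVar M m A) :=
  ∑ j, ∑ r, tvar (v M p j) * D.kern m (v M p j) (v M p' r)

theorem cst_add {T : Type} (c d : ℂ) : (cst (c + d) : RatField T) = cst c + cst d := map_add _ _ _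

theorem cst_mul {T : Type} (c d : ℂ) : (cst (c * d) : RatField T) = cst c * cst d := map_mul _ _ _

theorem cst_sum {α : Type*} {T : Type} (s : Finset α) (f : α → ℂ) :
    (cst (∑ i ∈ s, f i) : RatField T) = ∑ i ∈ s, cst (f i) := map_sum _ _ _

/-- The terms with `p` and `p'` interchanged add up to constants: `x / (x - y) + y / (y - x) = 1`. -/
theorem crossSum_add_crossSum (hsymm : ∀ i j, D.ex i j = D.ex j i) {p p' : Fin m} (h : p ≠ p') :
    D.crossSum m p p' + D.crossSum m p' p = cst D.numC := by
  have h₁ : D.crossSum m p' p =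
      ∑ j, ∑ r, tvar (v M p' r) * D.kern m (v M p' r) (v M p j) := Finset.sum_comm
  rw [h₁, crossSum, ← Finset.sum_add_distrib, numC, cst_sum]
  refine Finset.sum_congr rfl fun j _ => ?_
  rw [← Finset.sum_add_distrib, cst_sum]
  refine Finset.sum_congr rfl fun r _ => ?_
  rw [kern_symm hsymm (v M p j) (v M p' r), kern]
  have : (tvar (v M p j) - tvar (v M p' r) : RatField (ResVar M m A)) ≠ 0 := by
    refine sub_ne_zero.2 fun h' => h ?_
    have := tvar_injective h'
    simp only [v, Sum.inr.injEq, Prod.mk.injEq] at this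
    exact this.1
  change _ = cst (D.exv m (v M p j) (v M p' r))
  field_simp
  ring

/-- Expansion of the Euler factor by `x / (x - z) = 1 + z / (x - z)` and
`x / (x - y) = 1 + z / (x - y) + (y - z) / (x - y)`. -/
theorem eulerFactor_eq (hI : ∀ s, (D.seqI s).Nodup)
    (hI' : ∀ s s', s ≠ s' → List.Disjoint (D.seqI s) (D.seqI s')) (hIc : ∀ j, ∃ s, j ∈ D.seqI s)
    (hJ : Function.Injective D.seqJ) {P : Finset (Fin m)} {i : ℕ} {l : List (Fin m × Fin n)}
    (hl : l ∈ attachLists n P i) {p : Fin m} (hp : p ∈ unattached P l) :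
    D.eulerFactor m p (P.erase p) =
      cst (1 + D.numB + D.numA + D.numD + i * D.numC) +
        ∑ s, cst (D.z s) * D.attachSum m p s l + D.errorTerm m p l +
        ∑ p' ∈ (unattached P l).erase p, D.crossSum m p p' := by
  have hpl : p ∉ l.map Prod.fst := (Finset.mem_filter.1 hp).2
  have hlen : l.length = i := (mem_attachLists.1 hl).1
  have hZ : ∀ j, tvar (v M p j) * ∑ s, D.kernZ m s (v M p j) =
      cst (∑ s, D.exz (D.colV j) s) + ∑ s, cst (D.z s) * D.kernZ m s (v M p j) := by
    intro j
    rw [Finset.mul_sum, cst_sum, ← Finset.sum_add_distrib]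
    refine Finset.sum_congr rfl fun s _ => ?_
    have := sub_ne_zero.2 (tvar_ne_cst (v M p j) (D.z s))
    change _ = cst (D.exvz m (v M p j) s) + _
    rw [kernZ]
    field_simp
    ring
  have hK : ∀ j, ∑ s, ((D.content m l s).map fun y =>
        tvar (v M p j) * D.kern m (v M p j) y).sum =
      ∑ s, ((D.content m l s).map fun y => cst (D.exv m (v M p j) y)).sum +
      (∑ s, cst (D.z s) * ((D.content m l s).map (D.kern m (v M p j))).sum +
      ∑ s, ((D.content m l s).map fun y =>
        (tvar y - cst (D.z s)) * D.kern m (v M p j) y).sum) := by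
    intro j
    rw [← Finset.sum_add_distrib, ← Finset.sum_add_distrib]
    refine Finset.sum_congr rfl fun s _ => ?_
    rw [← List.sum_map_mul_left, ← List.sum_map_add, ← List.sum_map_add]
    refine congrArg List.sum (List.map_congr_left fun y hy => ?_)
    have hne : (tvar (v M p j) - tvar y : RatField (ResVar M m A)) ≠ 0 := by
      refine sub_ne_zero.2 fun h => ?_
      refine notMem_content hJ hpl (s := s) ((mem_vList hJ).2 ⟨j, rfl⟩) ?_
      rwa [tvar_injective h]
    rw [kern]
    field_simp
    ring
  simp only [sum_content hI hI' hIc hJ] at hK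
  have hexv : ∑ j, (∑ i, cst (D.exv m (v M p j) (u m A i)) +
      (l.map fun x => ∑ r, cst (D.exv m (v M p j) (v M x.1 r))).sum) =
      (cst (D.numD + i * D.numC) : RatField (ResVar M m A)) := by
    rw [Finset.sum_add_distrib, cst_add]
    congr 1
    · rw [numD]; simp only [cst_sum]; rfl
    · have : ∀ j, (l.map fun x => ∑ r, (cst (D.exv m (v M p j) (v M x.1 r)) :
          RatField (ResVar M m A))).sum = (i : RatField (ResVar M m A)) *
          cst (∑ r, D.ex (D.colV j) (D.colV r)) := by
        intro j
        rw [List.map_congr_left (g := fun _ => cst (∑ r, D.ex (D.colV j) (D.colV r)))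
          (fun x _ => by rw [cst_sum]; rfl), List.map_const', List.sum_replicate, hlen,
          nsmul_eq_mul]
      rw [Finset.sum_congr rfl fun j _ => this j, ← Finset.mul_sum, ← cst_sum, cst_mul]
      congr 1
      simp [cst]
  have herr : D.errorTerm m p l = ∑ j, ∑ s, ((D.content m l s).map fun y =>
        (tvar y - cst (D.z s)) * D.kern m (v M p j) y).sum := by
    rw [errorTerm, Finset.sum_comm]
    refine Finset.sum_congr rfl fun s _ => ?_
    have h₁ : ∀ L : List (ResVar M m A), ∑ j, (L.map fun y =>
        (tvar y - cst (D.z s)) * D.kern m (v M p j) y).sum =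
        (L.map fun y => (tvar y - cst (D.z s)) *
          ((D.vList m p).map fun x => D.kern m x y).sum).sum := by
      intro L
      induction L with
      | nil => simp
      | cons y L ih =>
        simp only [List.map_cons, List.sum_cons, Finset.sum_add_distrib, ih, sum_vList hJ,
          Finset.mul_sum]
    exact (h₁ _).symm
  have hatt : ∑ s, cst (D.z s) * D.attachSum m p s l =
      ∑ j, (∑ s, cst (D.z s) * D.kernZ m s (v M p j) +
        ∑ s, cst (D.z s) * ((D.content m l s).map (D.kern m (v M p j))).sum) := by
    simp only [← Finset.sum_add_distrib, ← mul_add]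
    rw [Finset.sum_comm]
    refine Finset.sum_congr rfl fun s _ => ?_
    rw [attachSum, sum_vList hJ, Finset.mul_sum]
  have hcross : ∑ p' ∈ (unattached P l).erase p, D.crossSum m p p' =
      ∑ j, ∑ p' ∈ (unattached P l).erase p, ∑ r,
        tvar (v M p j) * D.kern m (v M p j) (v M p' r) := by
    rw [Finset.sum_comm]; rfl
  have hlhs : ∀ j, tvar (v M p j) * (∑ s, D.kernZ m s (v M p j) +
      ∑ i, D.kern m (v M p j) (u m A i) + ∑ p' ∈ P.erase p, ∑ r, D.kern m (v M p j) (v M p' r)) =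
      cst (∑ s, D.exz (D.colV j) s) + (∑ i, cst (D.exv m (v M p j) (u m A i)) +
        (l.map fun x => ∑ r, cst (D.exv m (v M p j) (v M x.1 r))).sum) +
      (∑ s, cst (D.z s) * D.kernZ m s (v M p j) +
        ∑ s, cst (D.z s) * ((D.content m l s).map (D.kern m (v M p j))).sum) +
      ∑ s, ((D.content m l s).map fun y =>
        (tvar y - cst (D.z s)) * D.kern m (v M p j) y).sum +
      ∑ p' ∈ (unattached P l).erase p, ∑ r,
        tvar (v M p j) * D.kern m (v M p j) (v M p' r) := by
    intro j
    have h₁ := hK j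
    have h₂ := sum_erase_eq hl hp fun p' => ∑ r, tvar (v M p j) * D.kern m (v M p j) (v M p' r)
    simp only [← Finset.mul_sum] at h₁ h₂ ⊢
    rw [mul_add, mul_add, hZ, h₂]
    linear_combination h₁
  rw [eulerFactor, Finset.sum_congr rfl fun j _ => hlhs j]
  simp only [Finset.sum_add_distrib]
  have hA : ∑ j, cst (∑ s, D.exz (D.colV j) s) = (cst D.numA : RatField (ResVar M m A)) := by
    rw [numA, ← cst_sum]
  simp only [Finset.sum_add_distrib] at hexv hatt
  rw [hA, herr, hatt, hcross]
  have hc : (cst (1 + D.numB + D.numA + D.numD + i * D.numC) : RatField (ResVar M m A)) =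
      cst (1 + D.numB) + cst D.numA + cst (D.numD + i * D.numC) := by
    rw [← cst_add, ← cst_add]; congr 1; ring
  rw [hc]
  linear_combination hexv

theorem sum_sum_crossSum (hsymm : ∀ i j, D.ex i j = D.ex j i) (P : Finset (Fin m)) :
    ∑ p ∈ P, ∑ p' ∈ P.erase p, D.crossSum m p p' =
      cst ((P.card : ℂ) * ((P.card : ℂ) - 1) / 2 * D.numC) := by
  have hswap : ∑ p ∈ P, ∑ p' ∈ P.erase p, D.crossSum m p p' =
      ∑ p ∈ P, ∑ p' ∈ P.erase p, D.crossSum m p' p :=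
    Finset.sum_comm' fun p p' => by simp only [Finset.mem_erase]; tauto
  have h2 : ∑ p ∈ P, ∑ p' ∈ P.erase p, D.crossSum m p p' +
      ∑ p ∈ P, ∑ p' ∈ P.erase p, D.crossSum m p p' =
      cst ((P.card : ℂ) * ((P.card : ℂ) - 1) * D.numC) := by
    nth_rw 2 [hswap]
    rw [← Finset.sum_add_distrib]
    have : ∀ p ∈ P, ∑ p' ∈ P.erase p, D.crossSum m p p' + ∑ p' ∈ P.erase p, D.crossSum m p' p =
        cst (((P.card : ℂ) - 1) * D.numC) := by
      intro p hp
      rw [← Finset.sum_add_distrib, Finset.sum_congr rfl fun p' hp' =>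
        crossSum_add_crossSum hsymm (Finset.ne_of_mem_erase hp').symm, Finset.sum_const,
        Finset.card_erase_of_mem hp, nsmul_eq_mul, cst_mul]
      congr 1
      have : 0 < P.card := Finset.card_pos.2 ⟨p, hp⟩
      rw [Nat.cast_sub this]
      simp [cst]
    rw [Finset.sum_congr rfl this, Finset.sum_const, nsmul_eq_mul, mul_assoc, cst_mul (P.card : ℂ)]
    simp [cst]
  have h3 : ∀ x y : RatField (ResVar M m A), x + x = y → x = cst (1 / 2) * y := by
    rintro x _ rfl
    have : (cst (1 / 2) : RatField (ResVar M m A)) * cst 2 = 1 := by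
      rw [← cst_mul]; simp [cst]
    rw [← two_mul, ← mul_assoc,
      show (2 : RatField (ResVar M m A)) = cst 2 from
        (map_ofNat (algebraMap ℂ (RatField (ResVar M m A))) 2).symm, this,
      one_mul]
  rw [h3 _ _ h2, ← cst_mul]
  congr 1
  ring

/-- The recursion behind the constants `C(j)`. A block `v(p)` is attached to a point `z_s`, which
leads to `W_{i+1}`; or it contributes a constant, and these add up to `C(|P|) - C(i)`. -/
theorem partW_mul_eulerFactor (hsymm : ∀ i j, D.ex i j = D.ex j i) (hI : ∀ s, (D.seqI s).Nodup)
    (hI' : ∀ s s', s ≠ s' → List.Disjoint (D.seqI s) (D.seqI s')) (hIc : ∀ j, ∃ s, j ∈ D.seqI s)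
    (hJ : Function.Injective D.seqJ) (P : Finset (Fin m)) (i : ℕ) :
    ∑ p ∈ P, D.partW m (P.erase p) i * D.eulerFactor m p (P.erase p) =
      cst (D.constC P.card - D.constC i) * D.partW m P i + D.partW m P (i + 1) +
        ∑ l ∈ attachLists n P i, ∑ p ∈ unattached P l, D.attachProd m l * D.errorTerm m p l := by
  simp only [partW, Finset.sum_mul]
  rw [sum_attachLists_erase i fun p l => D.attachProd m l * D.eulerFactor m p (P.erase p),
    sum_attachLists_succ, Finset.mul_sum, ← Finset.sum_add_distrib, ← Finset.sum_add_distrib]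
  refine Finset.sum_congr rfl fun l hl => ?_
  rw [← Finset.mul_sum, Finset.sum_congr rfl fun p hp => eulerFactor_eq hI hI' hIc hJ hl hp]
  simp only [Finset.sum_add_distrib, sum_sum_crossSum hsymm, attachProd, ← Finset.mul_sum,
    Finset.sum_const, nsmul_eq_mul]
  have hcard : (P.card : ℂ) = (unattached P l).card + i := by
    exact_mod_cast (card_unattached hl).symm
  have hc : (((unattached P l).card : ℕ) : RatField (ResVar M m A)) *
      cst (1 + D.numB + D.numA + D.numD + i * D.numC) +
      cst (((unattached P l).card : ℂ) * (((unattached P l).card : ℂ) - 1) / 2 * D.numC) =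
      cst (D.constC P.card - D.constC i) := by
    rw [show (((unattached P l).card : ℕ) : RatField (ResVar M m A)) =
      cst ((unattached P l).card : ℂ) by simp [cst], ← cst_mul, ← cst_add]
    congr 1
    rw [constC, constC, hcard]
    ring
  rw [← hc]
  ring

end ResData

/-! ### The symmetrised identity -/

/-- A telescoping sum: this is how the recursion for the `W_i` is iterated. -/
theorem sum_prod_Icc_mul_recursion {R : Type*} [CommRing R] (C W : ℕ → R) (hC : C 0 = 0) (k : ℕ) :
    ∑ i ∈ Finset.range (k + 1), (∏ j ∈ Finset.Icc (i + 1) k, C j) *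
      ((C (k + 1) - C i) * W i + W (i + 1)) =
    ∑ i ∈ Finset.range (k + 2), (∏ j ∈ Finset.Icc (i + 1) (k + 1), C j) * W i := by
  -- `t i = C i ⋯ C k W_i`, which is zero for `i = 0`
  let t : ℕ → R := fun i => if i = 0 then 0 else (∏ j ∈ Finset.Icc i k, C j) * W i
  have h : ∀ i ∈ Finset.range (k + 1), (∏ j ∈ Finset.Icc (i + 1) k, C j) *
      ((C (k + 1) - C i) * W i + W (i + 1)) =
      (∏ j ∈ Finset.Icc (i + 1) (k + 1), C j) * W i + (t (i + 1) - t i) := by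
    intro i hi
    have hi : i ≤ k := by simpa [Nat.lt_succ_iff] using hi
    rw [Finset.prod_Icc_succ_top (by omega)]
    have ht : t i = C i * (∏ j ∈ Finset.Icc (i + 1) k, C j) * W i := by
      rcases Nat.eq_zero_or_pos i with rfl | hpos
      · simp [t, hC]
      · simp only [t, hpos.ne', if_false]
        rw [← Finset.insert_Icc_add_one_left_eq_Icc hi, Finset.prod_insert (by simp)]
    rw [ht]
    simp only [t, Nat.succ_ne_zero, if_false]
    ring
  rw [Finset.sum_congr rfl h, Finset.sum_add_distrib, Finset.sum_range_sub,
    Finset.sum_range_succ _ (k + 1)]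
  simp [t]

namespace ResData

variable {ι : Type*} {n M A : ℕ} {D : ResData ι n M A} {m : ℕ}

/-- The permutation `v_j(p) ↦ v_j(π p)` of the variables. -/
def blockPerm (M A : ℕ) {m : ℕ} (π : Equiv.Perm (Fin m)) : Equiv.Perm (ResVar M m A) :=
  Equiv.sumCongr (Equiv.refl _) (Equiv.prodCongr π (Equiv.refl _))

theorem blockPerm_u (π : Equiv.Perm (Fin m)) (i : Fin M) :
    blockPerm M A π (u m A i) = u m A i := rfl

theorem blockPerm_v (π : Equiv.Perm (Fin m)) (p : Fin m) (j : Fin A) :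
    blockPerm M A π (v M p j) = v M (π p) j := rfl

theorem blockPerm_mem (π : Equiv.Perm (Fin m)) : blockPerm M A π ∈ colourPerms (D.col m) := by
  rw [mem_colourPerms]
  rintro (i | ⟨p, j⟩) <;> rfl

theorem map_blockPerm_vList (π : Equiv.Perm (Fin m)) (p : Fin m) :
    (D.vList m p).map (blockPerm M A π) = D.vList m (π p) := by
  rw [vList, vList, List.map_reverse, List.map_ofFn]
  rfl

theorem map_blockPerm_content (π : Equiv.Perm (Fin m)) (l : List (Fin m × Fin n)) (s : Fin n) :
    (D.content m l s).map (blockPerm M A π) = D.content m (l.map (Prod.map π id)) s := by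
  induction l with
  | nil =>
    rw [List.map_nil, content, List.map_reverse, List.map_map]
    rfl
  | cons x l ih =>
    simp only [List.map_cons, content, Prod.map_snd, Prod.map_fst, id]
    split_ifs
    · rw [List.map_append, ih, map_blockPerm_vList]
    · exact ih

theorem permRat_blockPerm_attachSum (π : Equiv.Perm (Fin m)) (p : Fin m) (s : Fin n)
    (l : List (Fin m × Fin n)) : permRat (blockPerm M A π) (D.attachSum m p s l) =
      D.attachSum m (π p) s (l.map (Prod.map π id)) := by
  have hσ := blockPerm_mem (D := D) (A := A) (M := M) π
  rw [attachSum, attachSum, map_list_sum, ← map_blockPerm_vList, ← map_blockPerm_content,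
    List.map_map, List.map_map]
  refine congrArg List.sum (List.map_congr_left fun x _ => ?_)
  simp only [Function.comp, map_add, map_list_sum, List.map_map, permRat_kernZ hσ]
  congr 2
  refine List.map_congr_left fun y _ => ?_
  exact permRat_kern hσ x y

theorem permRat_blockPerm_attachProd (π : Equiv.Perm (Fin m)) (l : List (Fin m × Fin n)) :
    permRat (blockPerm M A π) (D.attachProd m l) = D.attachProd m (l.map (Prod.map π id)) := by
  induction l with
  | nil => exact map_one _
  | cons x l ih =>
    rw [attachProd, map_mul, map_mul, ih, permRat_cst, permRat_blockPerm_attachSum]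
    rfl

theorem permRat_blockPerm_partW (π : Equiv.Perm (Fin m)) (P : Finset (Fin m)) (i : ℕ) :
    permRat (blockPerm M A π) (D.partW m P i) = D.partW m (P.map π.toEmbedding) i := by
  rw [partW, map_sum, partW]
  have hinv : ∀ l : List (Fin m × Fin n), (l.map (Prod.map π.symm id)).map (Prod.map π id) = l := by
    intro l
    rw [List.map_map]
    refine Eq.trans (List.map_congr_left fun x _ => ?_) (List.map_id l)
    exact Prod.ext (π.apply_symm_apply x.1) rfl
  refine Finset.sum_bij (fun l _ => l.map (Prod.map π id)) ?_ ?_ ?_ ?_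
  · intro l hl
    rw [mem_attachLists] at *
    refine ⟨by simp [hl.1], ?_, ?_⟩
    · have : (l.map (Prod.map π id)).map Prod.fst = (l.map Prod.fst).map π := by
        rw [List.map_map, List.map_map]; rfl
      rw [this]
      exact hl.2.1.map π.injective
    · intro x hx
      obtain ⟨y, hy, rfl⟩ := List.mem_map.1 hx
      exact Finset.mem_map.2 ⟨y.1, hl.2.2 y hy, rfl⟩
  · intro l _ l' _ h
    exact List.map_injective_iff.2 (Function.Injective.prodMap π.injective Function.injective_id) h
  · intro l hl
    refine ⟨l.map (Prod.map π.symm id), ?_, hinv l⟩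
    rw [mem_attachLists] at *
    refine ⟨by simp [hl.1], ?_, ?_⟩
    · have : (l.map (Prod.map π.symm id)).map Prod.fst = (l.map Prod.fst).map π.symm := by
        rw [List.map_map, List.map_map]; rfl
      rw [this]
      exact hl.2.1.map π.symm.injective
    · intro x hx
      obtain ⟨y, hy, rfl⟩ := List.mem_map.1 hx
      obtain ⟨p, hp, h⟩ := Finset.mem_map.1 (hl.2.2 y hy)
      rw [Prod.map_fst, ← h]
      simpa using hp
  · intro l _
    exact permRat_blockPerm_attachProd π l

theorem permRat_blockPerm_eulerFactor (π : Equiv.Perm (Fin m)) (p : Fin m) (P : Finset (Fin m)) :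
    permRat (blockPerm M A π) (D.eulerFactor m p P) =
      D.eulerFactor m (π p) (P.map π.toEmbedding) := by
  have hσ := blockPerm_mem (D := D) (A := A) (M := M) π
  simp only [eulerFactor, map_add, map_sum, map_mul, permRat_cst, permRat_tvar, permRat_kern hσ,
    permRat_kernZ hσ, blockPerm_u, blockPerm_v, Finset.sum_map, Equiv.coe_toEmbedding]

/-- The variables `u_i` and `v_j(p)` with `p ∈ P`. -/
def varSet (M A : ℕ) {m : ℕ} (P : Finset (Fin m)) : Set (ResVar M m A) :=
  {x | (∃ i, x = u m A i) ∨ ∃ p ∈ P, ∃ j, x = v M p j}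

theorem inl_mem_varSet {P : Finset (Fin m)} (i : Fin M) : Sum.inl i ∈ varSet M A P :=
  Or.inl ⟨i, rfl⟩

theorem inr_mem_varSet {P : Finset (Fin m)} {x : Fin m × Fin A} :
    Sum.inr x ∈ varSet M A P ↔ x.1 ∈ P := by
  obtain ⟨p, j⟩ := x
  simp [varSet, u, v]

theorem invOn_eulerFactor {p : Fin m} {P : Finset (Fin m)} (hp : p ∉ P) :
    InvOn (D.col m) (varSet M A P) (D.eulerFactor m p P) := by
  classical
  have hv : ∀ j, v M p j ∉ varSet M A P := fun j h => hp (inr_mem_varSet.1 h)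
  have hsum : ∀ x, ∑ i, D.kern m x (u m A i) + ∑ p' ∈ P, ∑ r, D.kern m x (v M p' r) =
      (((Finset.univ.filter (· ∈ varSet M A P)).toList).map (D.kern m x)).sum := by
    intro x
    rw [Finset.sum_map_toList, Finset.sum_filter, Fintype.sum_sum_type, Fintype.sum_prod_type]
    simp only [inl_mem_varSet, inr_mem_varSet, if_true]
    congr 1
    rw [← Finset.sum_filter_add_sum_filter_not Finset.univ (· ∈ P)]
    rw [Finset.sum_congr (s₁ := Finset.univ.filter (· ∉ P)) rfl
      (fun p' hp' => Finset.sum_eq_zero fun r _ => if_neg (Finset.mem_filter.1 hp').2),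
      Finset.sum_const_zero, add_zero]
    refine Finset.sum_congr (by ext; simp) fun p' hp' => Finset.sum_congr rfl fun r _ => ?_
    rw [if_pos (by simpa using hp' : p' ∈ P)]
    rfl
  have hinv : ∀ j, InvOn (D.col m) (varSet M A P) (∑ i, D.kern m (v M p j) (u m A i) +
      ∑ p' ∈ P, ∑ r, D.kern m (v M p j) (v M p' r)) := by
    intro j
    rw [hsum]
    exact invOn_sum_kern (hv j) (Finset.nodup_toList _) fun y => by simp
  refine (InvOn.cst _).add fun σ hσ h => ?_
  rw [map_sum]
  refine Finset.sum_congr rfl fun j _ => ?_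
  rw [map_mul, add_assoc, map_add, hinv j σ hσ h, permRat_tvar, h _ (hv j), map_sum]
  congr 2
  exact Finset.sum_congr rfl fun s _ => by rw [permRat_kernZ hσ, h _ (hv j)]

theorem invOn_prodB (S : Set (ResVar M m A)) (hS : ∀ i, u m A i ∉ S) :
    InvOn (D.col m) S (D.prodB m) := by
  refine InvOn.prod _ fun s _ => ?_
  rw [funB_eq_forestFun]
  have hmem : ∀ x ∈ (List.ofFn fun k => u m A ((D.seqI s).get k)).reverse, x ∉ S := by
    intro x hx
    rw [List.mem_reverse, List.mem_ofFn] at hx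
    obtain ⟨k, rfl⟩ := hx
    exact hS _
  exact invOn_forestFun hmem fun x hx => invOn_kernZ (hmem x hx) s

variable (D m) in
/-- The product of `B_{I_1,…,I_n}(u; z)` and all `A_J(v(p))`. -/
def baseProd : RatField (ResVar M m A) := D.prodB m * ∏ p, treeFun (D.kern m) (D.vList m p)

theorem permRat_blockPerm_baseProd (π : Equiv.Perm (Fin m)) :
    permRat (blockPerm M A π) (D.baseProd m) = D.baseProd m := by
  have hσ := blockPerm_mem (D := D) (A := A) (M := M) π
  rw [baseProd, map_mul, map_prod]
  congr 1
  · refine invOn_prodB (Set.range Sum.inr) (by rintro i ⟨x, h⟩; simp [u] at h) _ hσ ?_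
    rintro (i | x) hx
    · rfl
    · exact absurd ⟨x, rfl⟩ hx
  · simp only [permRat_treeFun hσ, map_blockPerm_vList]
    exact Equiv.prod_comp π fun p => treeFun (D.kern m) (D.vList m p)

/-- The error terms vanish after symmetrisation. -/
theorem TreesVanish.symRat_errorTerm_eq_zero (hD : D.TreesVanish m)
    (hsymm : ∀ i j, D.ex i j = D.ex j i) (hJ : Function.Injective D.seqJ) (hA : 0 < A)
    (hI : ∀ s, (D.seqI s).Nodup)
    (hI' : ∀ s s', s ≠ s' → List.Disjoint (D.seqI s) (D.seqI s'))
    {P : Finset (Fin m)} {i : ℕ} {l : List (Fin m × Fin n)} (hl : l ∈ attachLists n P i)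
    {p : Fin m} (hp : p ∈ unattached P l) {Q : RatField (ResVar M m A)}
    (hQ : InvOn (D.col m) (varSet M A P) Q) :
    symRat (D.col m) (D.baseProd m * (D.attachProd m l * D.errorTerm m p l) * Q) = 0 := by
  rw [mem_attachLists] at hl
  obtain ⟨hpP, hpl⟩ := Finset.mem_filter.1 hp
  rw [errorTerm, Finset.mul_sum, Finset.mul_sum, Finset.sum_mul, symRat_sum]
  refine Finset.sum_eq_zero fun s _ => ?_
  -- the blocks `v(p')` that are not involved
  let R : Finset (Fin m) := Finset.univ.filter fun q => q ∉ l.map Prod.fst ∧ q ≠ p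
  have hprod : ∏ q, treeFun (D.kern m) (D.vList m q) =
      (l.map fun x => treeFun (D.kern m) (D.vList m x.1)).prod *
        (treeFun (D.kern m) (D.vList m p) * ∏ q ∈ R, treeFun (D.kern m) (D.vList m q)) := by
    have h₁ : (l.map fun x => treeFun (D.kern m) (D.vList m x.1)).prod =
        ∏ q ∈ (l.map Prod.fst).toFinset, treeFun (D.kern m) (D.vList m q) := by
      rw [List.prod_toFinset _ hl.2.1, List.map_map]; rfl
    rw [h₁, ← Finset.prod_insert (f := fun q => treeFun (D.kern m) (D.vList m q)) (a := p)
      (s := R) (by simp [R]), ← Finset.prod_union]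
    · refine Finset.prod_congr ?_ fun _ _ => rfl
      ext q
      simp only [R, Finset.mem_univ, Finset.mem_union, List.mem_toFinset, Finset.mem_insert,
        Finset.mem_filter, true_and, true_iff]
      tauto
    · rw [Finset.disjoint_left]
      intro q hq hq'
      rw [List.mem_toFinset] at hq
      rcases Finset.mem_insert.1 hq' with rfl | hq'
      · exact hpl hq
      · exact (Finset.mem_filter.1 hq').2.1 hq
  have hh : InvOn (D.col m) {y | y ∈ D.content m l s ++ D.vList m p}
      (Q * ∏ q ∈ R, treeFun (D.kern m) (D.vList m q)) := by
    refine (hQ.mono ?_).mul (InvOn.prod _ fun q hq => invOn_treeFun fun y hy hy' => ?_)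
    · intro y hy
      rcases List.mem_append.1 hy with hy | hy
      · rcases (mem_content hJ).1 hy with ⟨i, _, rfl⟩ | ⟨q, hq, j, rfl⟩
        · exact inl_mem_varSet i
        · exact inr_mem_varSet.2 (hl.2.2 _ hq)
      · obtain ⟨j, rfl⟩ := (mem_vList hJ).1 hy
        exact inr_mem_varSet.2 hpP
    · have hq := (Finset.mem_filter.1 hq).2
      rcases List.mem_append.1 hy' with hy' | hy'
      · exact notMem_content hJ hq.1 hy hy'
      · obtain ⟨j, rfl⟩ := (mem_vList hJ).1 hy
        obtain ⟨j', h⟩ := (mem_vList hJ).1 hy'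
        simp only [v, Sum.inr.injEq, Prod.mk.injEq] at h
        exact hq.2 h.1
  refine Eq.trans (congrArg _ ?_) (hD.symRat_attach_eq_zero hsymm hJ hA hI hI' hl.2.1 hpl s hh)
  rw [baseProd, hprod]
  ring

variable (D m) in
/-- The sum `∑_i C(i + 1) ⋯ C(k) W_i`, restricted to the variables `v(p)` with `p ∈ P`. -/
def weightedW (P : Finset (Fin m)) (k : ℕ) : RatField (ResVar M m A) :=
  ∑ i ∈ Finset.range (k + 1), cst (∏ j ∈ Finset.Icc (i + 1) k, D.constC j) * D.partW m P i

/-- Adding one more block of variables to the partially expanded product. -/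
theorem TreesVanish.symRat_weightedW (hD : D.TreesVanish m)
    (hsymm : ∀ i j, D.ex i j = D.ex j i) (hJ : Function.Injective D.seqJ) (hA : 0 < A)
    (hI : ∀ s, (D.seqI s).Nodup)
    (hI' : ∀ s s', s ≠ s' → List.Disjoint (D.seqI s) (D.seqI s')) (hIc : ∀ j, ∃ s, j ∈ D.seqI s)
    {P : Finset (Fin m)} {k : ℕ} (hP : P.card = k + 1) {Q : RatField (ResVar M m A)}
    (hQ : InvOn (D.col m) (varSet M A P) Q) :
    ∑ p ∈ P, symRat (D.col m) (D.baseProd m * (D.weightedW m (P.erase p) k *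
      D.eulerFactor m p (P.erase p)) * Q) =
      symRat (D.col m) (D.baseProd m * D.weightedW m P (k + 1) * Q) := by
  have hid : ∑ p ∈ P, D.weightedW m (P.erase p) k * D.eulerFactor m p (P.erase p) =
      D.weightedW m P (k + 1) + ∑ i ∈ Finset.range (k + 1),
        cst (∏ j ∈ Finset.Icc (i + 1) k, D.constC j) *
        ∑ l ∈ attachLists n P i, ∑ p ∈ unattached P l, D.attachProd m l * D.errorTerm m p l := by
    have h₀ : (cst (D.constC 0) : RatField (ResVar M m A)) = 0 := by simp [constC, cst]
    have hprod : ∀ t : Finset ℕ, (cst (∏ j ∈ t, D.constC j) : RatField (ResVar M m A)) =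
        ∏ j ∈ t, cst (D.constC j) := fun t => map_prod _ _ _
    have hsub : ∀ x y : ℂ, (cst (x - y) : RatField (ResVar M m A)) = cst x - cst y :=
      fun x y => map_sub _ _ _
    have h₁ := sum_prod_Icc_mul_recursion
      (fun j => (cst (D.constC j) : RatField (ResVar M m A))) (D.partW m P) h₀ k
    simp only [weightedW, hprod, Finset.sum_mul]
    rw [Finset.sum_comm, ← h₁, ← Finset.sum_add_distrib]
    refine Finset.sum_congr rfl fun i _ => ?_
    simp only [mul_assoc]
    rw [← Finset.mul_sum, partW_mul_eulerFactor hsymm hI hI' hIc hJ P i, hP, hsub, mul_add]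
  rw [← symRat_sum, ← Finset.sum_mul, ← Finset.mul_sum, hid, mul_add, add_mul, symRat_add,
    add_eq_left, Finset.mul_sum, Finset.sum_mul, symRat_sum]
  refine Finset.sum_eq_zero fun i _ => ?_
  rw [mul_left_comm, mul_assoc, symRat_cst_mul, Finset.mul_sum, Finset.sum_mul, symRat_sum]
  refine mul_eq_zero_of_right _ (Finset.sum_eq_zero fun l hl => ?_)
  rw [Finset.mul_sum, Finset.sum_mul, symRat_sum]
  exact Finset.sum_eq_zero fun p hp => hD.symRat_errorTerm_eq_zero hsymm hJ hA hI hI' hl hp hQ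

/-- Expansion of the Euler factors of the first `k` blocks. The factor `k!` compares the fixed order
of the blocks with all the orders in which they may be added. -/
theorem TreesVanish.symRat_prod_eulerFactor_aux (hD : D.TreesVanish m)
    (hsymm : ∀ i j, D.ex i j = D.ex j i) (hJ : Function.Injective D.seqJ) (hA : 0 < A)
    (hI : ∀ s, (D.seqI s).Nodup)
    (hI' : ∀ s s', s ≠ s' → List.Disjoint (D.seqI s) (D.seqI s')) (hIc : ∀ j, ∃ s, j ∈ D.seqI s)
    (k : ℕ) (hk : k ≤ m) (Q : RatField (ResVar M m A))
    (hQ : InvOn (D.col m) (varSet M A (Finset.univ.filter fun p : Fin m => p.val < k)) Q) :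
    (k.factorial : RatField (ResVar M m A)) * symRat (D.col m) (D.baseProd m *
      (∏ p : Fin m with p.val < k, D.eulerFactor m p (Finset.univ.filter (· < p))) * Q) =
      symRat (D.col m) (D.baseProd m *
        D.weightedW m (Finset.univ.filter fun p : Fin m => p.val < k) k * Q) := by
  induction k generalizing Q with
  | zero => simp [weightedW, partW, attachLists, attachProd, cst]
  | succ k ih =>
    set P := Finset.univ.filter fun p : Fin m => p.val < k + 1 with hPdef
    let p₀ : Fin m := ⟨k, hk⟩
    have hp₀ : p₀ ∈ P := by simp [hPdef, p₀]
    have hPe : (Finset.univ.filter fun p : Fin m => p.val < k) = P.erase p₀ := by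
      ext p
      simp only [hPdef, p₀, Finset.mem_filter, Finset.mem_univ, true_and, Finset.mem_erase, ne_eq,
        Fin.ext_iff]
      omega
    have hlt : (Finset.univ.filter (· < p₀) : Finset (Fin m)) = P.erase p₀ := by
      rw [← hPe]; rfl
    have hcard : P.card = k + 1 := by
      have : P = (Finset.univ : Finset (Fin (k + 1))).map (Fin.castLEEmb hk) := by
        ext p
        simp only [hPdef, Finset.mem_filter, Finset.mem_univ, true_and, Finset.mem_map]
        exact ⟨fun h => ⟨⟨p, h⟩, rfl⟩, by rintro ⟨q, rfl⟩; exact q.2⟩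
      rw [this]; simp
    have hnot : p₀ ∉ P.erase p₀ := Finset.notMem_erase _ _
    have hQ' : InvOn (D.col m) (varSet M A (P.erase p₀))
        (D.eulerFactor m p₀ (P.erase p₀) * Q) := by
      refine (invOn_eulerFactor hnot).mul (hQ.mono ?_)
      rintro (i | x) hx
      · exact inl_mem_varSet i
      · exact inr_mem_varSet.2 (Finset.mem_of_mem_erase (inr_mem_varSet.1 hx))
    have hstep := ih (by omega) (D.eulerFactor m p₀ (P.erase p₀) * Q) (by rw [hPe]; exact hQ')
    -- by symmetry, the block that is added last may be any of the blocks in `P`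
    have hswap : ∀ p ∈ P, symRat (D.col m) (D.baseProd m * (D.weightedW m (P.erase p) k *
        D.eulerFactor m p (P.erase p)) * Q) = symRat (D.col m) (D.baseProd m *
        (D.weightedW m (P.erase p₀) k * D.eulerFactor m p₀ (P.erase p₀)) * Q) := by
      intro p hp
      have hmap : (P.erase p₀).map (Equiv.swap p₀ p).toEmbedding = P.erase p := by
        ext q
        simp only [Finset.mem_map_equiv, Equiv.symm_swap, Finset.mem_erase]
        rcases eq_or_ne q p with rfl | hqp
        · simp
        rcases eq_or_ne q p₀ with rfl | hq0
        · simp [hp, hp₀, hqp, hqp.symm]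
        · rw [Equiv.swap_apply_of_ne_of_ne hq0 hqp]
          simp [hqp, hq0]
      have hσ := blockPerm_mem (D := D) (M := M) (A := A) (Equiv.swap p₀ p)
      have hQs : permRat (blockPerm M A (Equiv.swap p₀ p)) Q = Q := by
        refine hQ _ hσ ?_
        rintro (i | ⟨q, j⟩) hx
        · rfl
        · have hqP : q ∉ P := fun h => hx (inr_mem_varSet.2 h)
          change v M (Equiv.swap p₀ p q) j = v M q j
          rw [Equiv.swap_apply_of_ne_of_ne]
          · rintro rfl; exact hqP hp₀
          · rintro rfl; exact hqP hp
      have hW : permRat (blockPerm M A (Equiv.swap p₀ p)) (D.weightedW m (P.erase p₀) k) =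
          D.weightedW m (P.erase p) k := by
        rw [weightedW, weightedW, map_sum]
        refine Finset.sum_congr rfl fun i _ => ?_
        rw [map_mul, permRat_cst, permRat_blockPerm_partW, hmap]
      have hE : permRat (blockPerm M A (Equiv.swap p₀ p)) (D.eulerFactor m p₀ (P.erase p₀)) =
          D.eulerFactor m p (P.erase p) := by
        rw [permRat_blockPerm_eulerFactor, hmap, Equiv.swap_apply_left]
      refine Eq.trans (congrArg _ ?_) (symRat_permRat hσ _)
      rw [map_mul, map_mul, map_mul, permRat_blockPerm_baseProd, hW, hE, hQs]
    have hsum := hD.symRat_weightedW hsymm hJ hA hI hI' hIc hcard hQ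
    rw [Finset.sum_congr rfl hswap, Finset.sum_const, hcard, nsmul_eq_mul] at hsum
    refine Eq.trans ?_ hsum
    rw [Nat.factorial_succ, Nat.cast_mul, mul_assoc]
    refine congrArg (((k + 1 : ℕ) : RatField (ResVar M m A)) * ·) ?_
    rw [hPe] at hstep
    rw [← Finset.mul_prod_erase P _ hp₀, hlt]
    have e₁ : ∀ a b c d : RatField (ResVar M m A), a * (b * c) * d = a * c * (b * d) := by
      intros; ring
    have e₂ : ∀ a b c d : RatField (ResVar M m A), a * (b * c) * d = a * b * (c * d) := by
      intros; ring
    rw [e₁, e₂]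
    exact hstep

/-- The resonance identity for the coefficients of the forms. -/
theorem TreesVanish.symRat_prod_eulerFactor (hD : D.TreesVanish m)
    (hsymm : ∀ i j, D.ex i j = D.ex j i) (hJ : Function.Injective D.seqJ) (hA : 0 < A)
    (hI : ∀ s, (D.seqI s).Nodup)
    (hI' : ∀ s s', s ≠ s' → List.Disjoint (D.seqI s) (D.seqI s'))
    (hIc : ∀ j, ∃ s, j ∈ D.seqI s) :
    (m.factorial : RatField (ResVar M m A)) * symRat (D.col m) (D.prodB m *
      (∏ p, D.funAJ m p) * ∏ p, D.eulerFactor m p (Finset.univ.filter (· < p))) =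
      symRat (D.col m) (D.prodB m * (∏ p, D.funAJ m p) *
        ∑ i ∈ Finset.range (m + 1), cst (∏ j ∈ Finset.Icc (i + 1) m, D.constC j) *
          D.funW m i) := by
  have huniv : (Finset.univ.filter fun p : Fin m => p.val < m) = Finset.univ := by
    ext p; simp
  have h := hD.symRat_prod_eulerFactor_aux hsymm hJ hA hI hI' hIc m le_rfl 1
    fun σ _ _ => map_one _
  simp only [huniv, mul_one] at h
  have hA : ∀ p, D.funAJ m p = treeFun (D.kern m) (D.vList m p) :=
    fun p => funA_eq_treeFun _ _
  simp only [hA, funW_eq_partW hJ hI]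
  exact h

end ResData

/-! ### Derivations of rational functions -/

/-- A derivation for which all the edge weights are eigenvectors with the same eigenvalue acts on a
tree function through its number of edges. -/
theorem Derivation.map_treeFun {L K : Type*} [Field K] [Algebra ℂ K] (δ : Derivation ℂ K K)
    {k : L → L → K} (c : K) {w : List L} (hw : w ≠ [])
    (h : ∀ x ∈ w, ∀ y ∈ w, δ (k x y) = c * k x y) :
    δ (treeFun k w) = ((w.length : K) - 1) * c * treeFun k w := by
  induction w with
  | nil => exact absurd rfl hw
  | cons y w ih =>
    rcases eq_or_ne w [] with rfl | hw'
    · simp [treeFun]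
    · have hsum : ∀ l : List L, (∀ x ∈ l, x ∈ w) →
          δ ((l.map (k y)).sum) = c * (l.map (k y)).sum := by
        intro l hl
        induction l with
        | nil => simp
        | cons x l ihl =>
          rw [List.map_cons, List.sum_cons, map_add,
            ihl fun z hz => hl z (List.mem_cons_of_mem _ hz),
            h y (by simp) x (List.mem_cons_of_mem _ (hl x (by simp))), mul_add]
      rw [treeFun_cons k y hw', δ.leibniz, hsum w fun _ => id,
        ih hw' fun a ha b hb => h a (List.mem_cons_of_mem _ ha) b (List.mem_cons_of_mem _ hb)]
      simp only [smul_eq_mul, List.length_cons, Nat.cast_add, Nat.cast_one]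
      ring

section Derivations

variable {T : Type}

/-- The partial derivative `∂/∂t_x` as a derivation. -/
def pderivDer (x : T) : Derivation ℂ (RatField T) (RatField T) :=
  Derivation.mk' (pderivRat x) fun f g => by
    -- the homomorphism `f ↦ f + ε ∂f / ∂t_x` that defines the partial derivative
    let φ := IsLocalization.liftAlgHom (M := nonZeroDivisors (MvPolynomial T ℂ))
      (S := RatField T) (f := dualEval x) (isUnit_dualEval x)
    have hfst : ∀ f, (φ f).fst = f := by
      have h : ((TrivSqZeroExt.fstHom ℂ (RatField T) (RatField T)).comp φ).toRingHom =
          RingHom.id _ := by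
        refine IsLocalization.ringHom_ext (nonZeroDivisors (MvPolynomial T ℂ)) ?_
        refine RingHom.ext fun p => ?_
        change (φ (algebraMap _ _ p)).fst = algebraMap _ _ p
        rw [IsLocalization.liftAlgHom_apply, IsLocalization.lift_eq]
        exact fst_dualEval x p
      exact fun f => RingHom.congr_fun h f
    change (φ (f * g)).snd = f • (φ g).snd + g • (φ f).snd
    rw [map_mul, TrivSqZeroExt.snd_mul, hfst, hfst, op_smul_eq_smul]

theorem pderivDer_apply (x : T) (f : RatField T) : pderivDer x f = pderivRat x f := rfl

open Classical in
theorem pderivDer_tvar (x y : T) : pderivDer x (tvar y) = if y = x then 1 else 0 := by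
  rw [pderivDer_apply]
  change (IsLocalization.liftAlgHom (M := nonZeroDivisors (MvPolynomial T ℂ))
      (S := RatField T) (f := dualEval x) (isUnit_dualEval x) (tvar y)).snd = _
  rw [IsLocalization.liftAlgHom_apply, tvar, IsLocalization.lift_eq]
  by_cases h : y = x <;> simp [dualEval, h]

theorem Derivation.map_cst (δ : Derivation ℂ (RatField T) (RatField T)) (c : ℂ) :
    δ (cst c) = 0 := δ.map_algebraMap c

/-- The Euler derivation `∑_j t_{x_j} ∂/∂t_{x_j}`. -/
def eulerDer {N : ℕ} (x : Fin N → T) : Derivation ℂ (RatField T) (RatField T) :=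
  ∑ j, tvar (x j) • pderivDer (x j)

theorem eulerDer_apply {N : ℕ} (x : Fin N → T) (f : RatField T) :
    eulerDer x f = ∑ j, tvar (x j) * pderivDer (x j) f := by
  have h := congrArg (fun F : RatField T → RatField T => F f)
    (map_sum (Derivation.coeFnAddMonoidHom (R := ℂ) (A := RatField T) (M := RatField T))
      (fun j => tvar (x j) • pderivDer (x j)) Finset.univ)
  exact h.trans (by rw [Finset.sum_apply]; rfl)

theorem eulerDer_tvar {N : ℕ} {x : Fin N → T} (hx : Function.Injective x) (j : Fin N) :
    eulerDer x (tvar (x j)) = tvar (x j) := by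
  classical
  simp [eulerDer_apply, pderivDer_tvar, hx.eq_iff]

theorem eulerDer_tvar_of_notMem {N : ℕ} {x : Fin N → T} {y : T} (hy : ∀ j, x j ≠ y) :
    eulerDer x (tvar y) = 0 := by
  classical
  simp [eulerDer_apply, pderivDer_tvar, fun j => (hy j).symm]

/-- The logarithmic derivative `∑ c_f δ(f) / f` of the symbol `∏ f^{c_f}`. -/
def logDer (δ : Derivation ℂ (RatField T) (RatField T)) (l : PowSymbol T) : RatField T :=
  l.sum fun f c => cst c * (f⁻¹ * δ f)

theorem logDer_add (δ : Derivation ℂ (RatField T) (RatField T)) (l l' : PowSymbol T) :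
    logDer δ (l + l') = logDer δ l + logDer δ l' :=
  Finsupp.sum_add_index' (by simp [cst]) fun f c c' => by rw [ResData.cst_add, add_mul]

theorem logDer_sum (δ : Derivation ℂ (RatField T) (RatField T)) {α : Type*} (s : Finset α)
    (l : α → PowSymbol T) : logDer δ (∑ i ∈ s, l i) = ∑ i ∈ s, logDer δ (l i) :=
  map_sum (AddMonoidHom.mk' (logDer δ) (logDer_add δ)) l s

theorem logDer_fpow (δ : Derivation ℂ (RatField T) (RatField T)) (f : RatField T) (c : ℂ) :
    logDer δ (fpow f c) = cst c * (f⁻¹ * δ f) :=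
  Finsupp.sum_single_index (by simp [cst])

theorem logDer_eulerDer {N : ℕ} (x : Fin N → T) (l : PowSymbol T) :
    logDer (eulerDer x) l = ∑ j, tvar (x j) * logDer (pderivDer (x j)) l := by
  simp only [logDer, eulerDer_apply, Finsupp.sum, Finset.mul_sum]
  rw [Finset.sum_comm]
  exact Finset.sum_congr rfl fun j _ => Finset.sum_congr rfl fun f _ => by ring

end Derivations

/-! ### Products of differentials -/

section Anticommuting

variable {α R : Type*} [Ring R] {d : α → R}

theorem prod_map_mul_eq_zero (hd : ∀ a b, d a * d b = -(d b * d a)) (hd' : ∀ a, d a * d a = 0)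
    {l : List α} {a : α} (h : a ∈ l) : (l.map d).prod * d a = 0 := by
  induction l with
  | nil => simp at h
  | cons b l ih =>
    rw [List.map_cons, List.prod_cons, mul_assoc]
    rcases List.mem_cons.1 h with rfl | h
    · have : ∀ l : List α, (l.map d).prod * d a = d a * (l.map d).prod ∨
          (l.map d).prod * d a = -(d a * (l.map d).prod) := by
        intro l
        induction l with
        | nil => simp
        | cons c l ih =>
          rw [List.map_cons, List.prod_cons, mul_assoc, ← mul_assoc (d a), hd a c]
          rcases ih with h | h <;> rw [h] <;> simp [mul_assoc]
      rcases this l with h | h <;> rw [h] <;> simp [← mul_assoc, hd']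
    · rw [ih h, mul_zero]

theorem mul_prod_map_eq_zero (hd : ∀ a b, d a * d b = -(d b * d a)) (hd' : ∀ a, d a * d a = 0)
    {l : List α} {a : α} (h : a ∈ l) : d a * (l.map d).prod = 0 := by
  induction l with
  | nil => simp at h
  | cons b l ih =>
    rw [List.map_cons, List.prod_cons, ← mul_assoc]
    rcases List.mem_cons.1 h with rfl | h
    · rw [hd', zero_mul]
    · rw [hd, neg_mul, mul_assoc, ih h, mul_zero, neg_zero]

/-- Moving `d a` to its place in a product from which it had been removed. -/
theorem mul_prod_map_erase [DecidableEq α] (hd : ∀ a b, d a * d b = -(d b * d a)) {l : List α}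
    {a : α} (h : a ∈ l) :
    d a * ((l.erase a).map d).prod = (-1) ^ (l.idxOf a) * (l.map d).prod := by
  induction l with
  | nil => simp at h
  | cons b l ih =>
    rcases eq_or_ne b a with rfl | hab
    · simp
    · have h' : a ∈ l := (List.mem_cons.1 h).resolve_left hab.symm
      rw [List.erase_cons_tail (by simpa using hab), List.idxOf_cons_ne _ hab, List.map_cons,
        List.prod_cons, List.map_cons, List.prod_cons, ← mul_assoc, hd, neg_mul, mul_assoc, ih h',
        pow_succ, mul_neg_one, neg_mul, ← mul_assoc, ← mul_assoc,
        ((Commute.neg_one_left (d b)).pow_left _).eq]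

end Anticommuting

section Forms

variable {T : Type}

theorem fnForm_add (f g : RatField T) : fnForm (f + g) = fnForm f + fnForm g :=
  TensorProduct.add_tmul _ _ _

theorem fnForm_mul (f g : RatField T) : fnForm (f * g) = fnForm f * fnForm g := by
  simp [fnForm, Algebra.TensorProduct.tmul_mul_tmul]

theorem fnForm_zero : fnForm (0 : RatField T) = 0 := TensorProduct.zero_tmul _ _

theorem fnForm_one : fnForm (1 : RatField T) = 1 := rfl

theorem fnForm_sum {β : Type*} (s : Finset β) (f : β → RatField T) :
    fnForm (∑ i ∈ s, f i) = ∑ i ∈ s, fnForm (f i) := TensorProduct.sum_tmul _ _ _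

theorem fnForm_cst (c : ℂ) (ω : RatForm T) : fnForm (cst c) * ω = c • ω := by
  have : (fnForm (cst c) : RatForm T) = algebraMap ℂ (RatForm T) c := rfl
  rw [this, Algebra.smul_def]

theorem fnForm_comm (f : RatField T) (ω : RatForm T) : fnForm f * ω = ω * fnForm f :=
  Algebra.commutes (A := RatForm T) f ω

theorem fnForm_left_comm (f : RatField T) (ω η : RatForm T) :
    ω * (fnForm f * η) = fnForm f * (ω * η) := by
  rw [← mul_assoc, ← fnForm_comm, mul_assoc]

theorem dvar_mul_self (x : T) : (dvar x * dvar x : RatForm T) = 0 := by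
  simp [dvar, Algebra.TensorProduct.tmul_mul_tmul]

theorem dvar_mul_comm (x y : T) : (dvar x * dvar y : RatForm T) = -(dvar y * dvar x) := by
  rw [dvar, dvar, Algebra.TensorProduct.tmul_mul_tmul, Algebra.TensorProduct.tmul_mul_tmul,
    ← TensorProduct.tmul_neg, eq_neg_of_add_eq_zero_left (ExteriorAlgebra.ι_add_mul_swap _ _)]

theorem prod_map_dvar (l : List T) : (l.map dvar).prod = (1 : RatField T) ⊗ₜ[ℂ]
    (l.map fun x => ExteriorAlgebra.ι ℂ (Finsupp.single x (1 : ℂ))).prod := by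
  induction l with
  | nil => rfl
  | cons x l ih =>
    rw [List.map_cons, List.prod_cons, ih, dvar, Algebra.TensorProduct.tmul_mul_tmul, one_mul]
    rfl

/-- A permutation of the variables changes the top degree form by its sign. -/
theorem permForm_prod_map_dvar [Fintype T] [DecidableEq T] (σ : Equiv.Perm T) {l : List T}
    (hl : l.Nodup) (hl' : ∀ x, x ∈ l) : permForm σ (l.map dvar).prod =
      ((Equiv.Perm.sign σ : ℤˣ) : ℤ) • (l.map dvar : List (RatForm T)).prod := by
  let e := hl.getEquivOfForallMemList l hl'
  let w : Fin l.length → (T →₀ ℂ) := fun i => Finsupp.single (e i) (1 : ℂ)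
  have h : ∀ τ : Equiv.Perm T,
      (l.map fun x => ExteriorAlgebra.ι ℂ (Finsupp.single (τ x) (1 : ℂ))).prod =
        ExteriorAlgebra.ιMulti ℂ l.length (w ∘ (e.symm.permCongr τ)) := by
    intro τ
    rw [ExteriorAlgebra.ιMulti_apply]
    congr 1
    refine List.ext_getElem (by simp) fun i hi hi' => ?_
    simp [w, e, Equiv.permCongr_apply]
  rw [prod_map_dvar, permForm, Algebra.TensorProduct.map_tmul, map_one, map_list_prod,
    List.map_map]
  have h₁ := h σ
  have h₂ := h 1
  rw [AlternatingMap.map_perm, Equiv.Perm.sign_permCongr] at h₁ h₂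
  simp only [Function.comp_def, ExteriorAlgebra.map_apply_ι, Finsupp.lmapDomain_apply,
    Finsupp.mapDomain_single]
  rw [h₁]
  simp only [Equiv.Perm.coe_one, id, map_one, one_smul] at h₂
  rw [h₂, Units.smul_def]
  exact TensorProduct.tmul_smul _ _ _

theorem permForm_fnForm (σ : Equiv.Perm T) (f : RatField T) :
    permForm σ (fnForm f) = fnForm (permRat σ f) := by
  rw [permForm, fnForm, Algebra.TensorProduct.map_tmul, map_one, fnForm]

variable [Fintype T]

theorem deRham_fnForm_mul (f : RatField T) (l : List T) :
    deRham (fnForm f * (l.map dvar).prod) =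
      ∑ x, fnForm (pderivDer x f) * (dvar x * (l.map dvar).prod) := by
  rw [prod_map_dvar, fnForm, Algebra.TensorProduct.tmul_mul_tmul, mul_one, one_mul, deRham,
    LinearMap.sum_apply]
  refine Finset.sum_congr rfl fun x _ => ?_
  rw [LinearMap.comp_apply, LinearMap.rTensor_tmul, LinearMap.mulLeft_apply, dvar, fnForm,
    Algebra.TensorProduct.tmul_mul_tmul, Algebra.TensorProduct.tmul_mul_tmul,
    Algebra.TensorProduct.tmul_mul_tmul]
  simp [pderivDer_apply]

theorem dlogForm_eq (l : PowSymbol T) :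
    dlogForm l = ∑ x, fnForm (logDer (pderivDer x) l) * dvar x := by
  simp only [logDer, Finsupp.sum, dlogForm, fnForm_sum, Finset.sum_mul]
  rw [Finset.sum_comm]
  refine Finset.sum_congr rfl fun f _ => ?_
  have h := deRham_fnForm_mul f []
  simp only [List.map_nil, List.prod_nil, mul_one] at h
  rw [h, Finset.mul_sum, Finset.smul_sum]
  refine Finset.sum_congr rfl fun x _ => ?_
  rw [fnForm_mul, fnForm_mul, mul_assoc, fnForm_cst, mul_assoc]

/-- Euler's identity for the differential of `l · g ν`, multiplied by a form `K` that is killed by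
the other differentials that could occur. -/
theorem mul_twisted_nuForm {N : ℕ} {x : Fin N → T} (K : RatForm T)
    (l : PowSymbol T) (g : RatField T) (hg : ∀ y, (∀ j, x j ≠ y) → pderivDer y g = 0)
    (hl : ∀ y, (∀ j, x j ≠ y) → logDer (pderivDer y) l = 0 ∨ K * dvar y = 0) :
    K * (deRham (fnForm g * nuForm x) + dlogForm l * (fnForm g * nuForm x)) =
      K * (fnForm ((N : RatField T) * g + eulerDer x g + logDer (eulerDer x) l * g) *
        (List.ofFn fun j => dvar (x j)).prod) := by
  classical
  set V : RatForm T := (List.ofFn fun j => dvar (x j)).prod with hV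
  let E : Fin N → RatForm T := fun q => ((((List.finRange N).erase q).map x).map dvar).prod
  have hE : ∀ q, E q = (((List.finRange N).erase q).map fun j => dvar (x j)).prod := by
    intro q; simp only [E, List.map_map]; rfl
  have hxE : ∀ q : Fin N, (-1 : ℂ) ^ (q : ℕ) • (dvar (x q) * E q) = V := by
    intro q
    rw [hE, mul_prod_map_erase (d := fun j => (dvar (x j) : RatForm T))
      (fun a b => dvar_mul_comm _ _) (List.mem_finRange q), List.idxOf_finRange, hV,
      List.ofFn_eq_map]
    have : ((-1 : RatForm T)) ^ (q : ℕ) = algebraMap ℂ (RatForm T) ((-1) ^ (q : ℕ)) := by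
      rw [map_pow, map_neg, map_one]
    rw [this, ← Algebra.smul_def, smul_smul, ← mul_pow]
    simp
  have hxE' : ∀ q j, j ≠ q → dvar (x j) * E q = 0 := by
    intro q j hj
    rw [hE]
    exact mul_prod_map_eq_zero (d := fun j => (dvar (x j) : RatForm T))
      (fun a b => dvar_mul_comm _ _) (fun a => dvar_mul_self _)
      ((List.mem_erase_of_ne hj).2 (List.mem_finRange j))
  have hnu : fnForm g * nuForm x =
      ∑ q : Fin N, (-1 : ℂ) ^ (q : ℕ) • (fnForm (g * tvar (x q)) * E q) := by
    rw [nuForm, Finset.mul_sum]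
    exact Finset.sum_congr rfl fun q _ => by rw [mul_smul_comm, fnForm_mul, mul_assoc, hE]
  -- a sum over all variables of terms `h_y dy ∧ (g ν)` reduces to the variables `x_j`
  have hsum : ∀ (h : T → Fin N → RatField T),
      (∀ y, (∀ j, x j ≠ y) → (∀ q, h y q = 0) ∨ K * dvar y = 0) →
      K * ∑ q : Fin N, (-1 : ℂ) ^ (q : ℕ) • ∑ y, fnForm (h y q) * (dvar y * E q) =
      K * (fnForm (∑ q, h (x q) q) * V) := by
    intro h hh
    rw [fnForm_sum, Finset.sum_mul, Finset.mul_sum, Finset.mul_sum]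
    refine Finset.sum_congr rfl fun q _ => ?_
    rw [mul_smul_comm, Finset.mul_sum, Finset.sum_eq_single (x q)]
    · rw [← mul_smul_comm, ← mul_smul_comm, hxE]
    · intro y _ hy
      by_cases hyx : ∃ j, x j = y
      · obtain ⟨j, rfl⟩ := hyx
        rw [hxE' q j (fun h => hy (h ▸ rfl)), mul_zero, mul_zero]
      · rcases hh y (not_exists.1 hyx) with h0 | h0
        · rw [h0, fnForm_zero, zero_mul, mul_zero]
        · rw [fnForm_left_comm, ← mul_assoc K, h0, zero_mul, mul_zero]
    · simp
  rw [hnu, mul_add, fnForm_add, add_mul, mul_add]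
  congr 1
  · rw [map_sum]
    simp only [map_smul, E, deRham_fnForm_mul]
    rw [hsum (fun y q => pderivDer y (g * tvar (x q)))]
    · congr 3
      simp only [Derivation.leibniz, pderivDer_tvar, if_true, smul_eq_mul, mul_one,
        Finset.sum_add_distrib, eulerDer_apply]
      simp
    · intro y hy
      left
      intro q
      rw [Derivation.leibniz, pderivDer_tvar, if_neg (hy q), hg y hy, smul_zero, smul_zero,
        add_zero]
  · rw [dlogForm_eq, Finset.mul_sum]
    have : ∀ q : Fin N, (∑ y, fnForm (logDer (pderivDer y) l) * dvar y) *
        ((-1 : ℂ) ^ (q : ℕ) • (fnForm (g * tvar (x q)) * E q)) = (-1 : ℂ) ^ (q : ℕ) •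
        ∑ y, fnForm (logDer (pderivDer y) l * (g * tvar (x q))) * (dvar y * E q) := by
      intro q
      rw [mul_smul_comm, Finset.sum_mul]
      congr 1
      refine Finset.sum_congr rfl fun y _ => ?_
      rw [fnForm_mul (logDer _ l), mul_assoc, mul_assoc, fnForm_left_comm _ (dvar y)]
    simp only [this]
    rw [hsum (fun y q => logDer (pderivDer y) l * (g * tvar (x q)))]
    · congr 3
      rw [logDer_eulerDer, Finset.sum_mul]
      exact Finset.sum_congr rfl fun q _ => by ring
    · intro y hy
      rcases hl y hy with h | h
      · exact Or.inl fun q => by rw [h, zero_mul]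
      · exact Or.inr h

end Forms

/-! ### Twisted forms -/

section Twisted

variable {T : Type}

theorem tw_mul_tw (l l' : PowSymbol T) (ω ω' : RatForm T) :
    tw l ω * tw l' ω' = tw (l + l') (ω * ω') :=
  AddMonoidAlgebra.single_mul_single _ _ _ _

theorem prod_ofFn_tw {N : ℕ} (l : Fin N → PowSymbol T) (ω : Fin N → RatForm T) :
    (List.ofFn fun p => tw (l p) (ω p)).prod = tw (∑ p, l p) (List.ofFn ω).prod := by
  induction N with
  | zero => simp [tw, AddMonoidAlgebra.one_def]
  | succ N ih =>
    rw [List.ofFn_succ, List.prod_cons, ih, tw_mul_tw, List.ofFn_succ, List.prod_cons,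
      Fin.sum_univ_succ]

theorem twD_tw [Fintype T] (l : PowSymbol T) (ω : RatForm T) :
    twD (tw l ω) = tw l (deRham ω + dlogForm l * ω) := by
  rw [twD, tw, AddMonoidAlgebra.coeff_single, Finsupp.sum_single_index]
  rw [map_zero, mul_zero, add_zero]
  exact AddMonoidAlgebra.single_zero _

theorem permTw_tw (σ : Equiv.Perm T) (l : PowSymbol T) (ω : RatForm T) :
    permTw σ (tw l ω) = tw l (permForm σ ω) := by
  rw [permTw, tw, AddMonoidAlgebra.coeff_single, Finsupp.sum_single_index]
  rw [map_zero]
  exact AddMonoidAlgebra.single_zero _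

/-- In top degree, skew symmetrisation of forms is symmetrisation of their coefficients, since the
two signs cancel. -/
theorem skewTw_tw [Fintype T] {ι : Type*} (col : T → ι) (l : PowSymbol T) (f : RatField T)
    {w : List T} (hw : w.Nodup) (hw' : ∀ x, x ∈ w) :
    skewTw col (tw l (fnForm f * (w.map dvar).prod)) =
      tw l (fnForm (symRat col f) * (w.map dvar).prod) := by
  classical
  rw [skewTw, symRat, fnForm_sum, Finset.sum_mul]
  have : tw l (∑ σ ∈ colourPerms col, fnForm (permRat σ f) * (w.map dvar).prod) =
      ∑ σ ∈ colourPerms col, tw l (fnForm (permRat σ f) * (w.map dvar).prod) :=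
    map_sum (AddMonoidHom.mk' (tw l) fun a b => AddMonoidAlgebra.single_add _ _ _) _ _
  rw [this]
  refine Finset.sum_congr rfl fun σ _ => ?_
  rw [permTw_tw, map_mul, permForm_fnForm]
  rw [show (permForm σ (w.map dvar).prod : RatForm T) = _ from permForm_prod_map_dvar σ hw hw']
  rw [tw, AddMonoidAlgebra.smul_single, mul_smul_comm, smul_smul]
  have hs : ∀ s : ℤˣ, ((s : ℤ) * (s : ℤ)) = 1 := fun s => by
    rw [← Units.val_mul, Int.units_mul_self, Units.val_one]
  rw [hs, one_smul]
  rfl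

end Twisted

/-! ### The form `Ω_m` -/

/-- In a product of forms of which each factor may be simplified in the presence of the preceding
ones, all the factors may be simplified. -/
theorem mul_prod_ofFn_congr {T : Type} {m : ℕ} (K : RatForm T) (η ζ : Fin m → RatForm T)
    (F : Fin m → RatField T)
    (h : ∀ p : Fin m, K * (List.ofFn fun q : Fin p => ζ (q.castLE p.2.le)).prod * η p =
      K * (List.ofFn fun q : Fin p => ζ (q.castLE p.2.le)).prod * (fnForm (F p) * ζ p)) :
    K * (List.ofFn η).prod = fnForm (∏ p, F p) * (K * (List.ofFn ζ).prod) := by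
  induction m with
  | zero => simp [fnForm_one]
  | succ m ih =>
    have h₁ := ih (fun p => η p.castSucc) (fun p => ζ p.castSucc) (fun p => F p.castSucc)
      fun p => h p.castSucc
    have h₂ := h (Fin.last m)
    change K * (List.ofFn fun q : Fin m => ζ q.castSucc).prod * _ =
      K * (List.ofFn fun q : Fin m => ζ q.castSucc).prod * _ at h₂
    rw [List.ofFn_succ_last, List.ofFn_succ_last, List.prod_append, List.prod_append,
      List.prod_singleton, List.prod_singleton, ← mul_assoc, h₁, mul_assoc, h₂,
      Fin.prod_univ_castSucc, fnForm_mul, fnForm_left_comm]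
    simp only [mul_assoc]

namespace ResData

variable {ι : Type*} {n M A : ℕ} {D : ResData ι n M A} {m : ℕ}

/-- The variables `u_1, …, u_M`, followed by the blocks `v(r_1), v(r_2), …`. -/
def varWord (M A : ℕ) {m k : ℕ} (r : Fin k → Fin m) : List (ResVar M m A) :=
  (List.ofFn fun i => u m A i) ++ (List.ofFn fun q => List.ofFn fun j => v M (r q) j).flatten

theorem mem_varWord {k : ℕ} {r : Fin k → Fin m} {x : ResVar M m A} :
    x ∈ varWord M A r ↔ (∃ i, u m A i = x) ∨ ∃ q j, v M (r q) j = x := by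
  simp [varWord, List.mem_ofFn]

theorem nodup_varWord : (varWord M A (id : Fin m → Fin m)).Nodup := by
  rw [varWord, List.nodup_append']
  refine ⟨List.nodup_ofFn.2 Sum.inl_injective, List.nodup_flatten.2 ⟨?_, ?_⟩, ?_⟩
  · intro l hl
    obtain ⟨q, rfl⟩ := List.mem_ofFn.1 hl
    exact List.nodup_ofFn.2 fun j j' h => by simpa [v] using h
  · rw [List.pairwise_ofFn]
    intro q q' hq x hx hx'
    obtain ⟨j, rfl⟩ := List.mem_ofFn.1 hx
    obtain ⟨j', h⟩ := List.mem_ofFn.1 hx'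
    simp only [v, id, Sum.inr.injEq, Prod.mk.injEq] at h
    exact hq.ne' h.1
  · intro x hx hx'
    obtain ⟨i, rfl⟩ := List.mem_ofFn.1 hx
    simp [u, v, List.mem_ofFn] at hx'

theorem prod_map_dvar_varWord {k : ℕ} (r : Fin k → Fin m) : du M m A *
    (List.ofFn fun q => (List.ofFn fun j : Fin A => dvar (v M (r q) j)).prod).prod =
      ((varWord M A r).map dvar).prod := by
  rw [varWord, List.map_append, List.prod_append, du, List.map_ofFn, List.map_flatten,
    List.prod_flatten, List.map_ofFn, List.map_ofFn]
  simp only [Function.comp_def, List.map_ofFn]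

variable (D m) in
/-- The symbol of `Ω̃(p)`. -/
def symBlock (p : Fin m) : PowSymbol (ResVar M m A) :=
  D.symTheta m p + (∑ q : Fin m with q < p, D.symVV m p q) + D.symVU m p

theorem symU_add_sum_symBlock : D.symU m + ∑ p, D.symBlock m p = D.symL m := by
  simp only [symBlock, symL, Finset.sum_add_distrib]
  abel

/-- The symbol of `Ω̃(p)` does not involve the variables of the later blocks. -/
theorem logDer_symBlock_of_lt {p q : Fin m} (h : p < q) (j : Fin A) :
    logDer (pderivDer (v M q j)) (D.symBlock m p) = 0 := by
  have hv : ∀ q' ≤ p, ∀ i : Fin A, pderivDer (v M q j) (tvar (v M q' i)) = 0 := by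
    intro q' hq' i
    rw [pderivDer_tvar, if_neg]
    simp only [v, Sum.inr.injEq, Prod.mk.injEq]
    exact fun h' => absurd (h'.1 ▸ h) (not_lt.2 hq')
  have hu : ∀ i, pderivDer (v M q j) (tvar (u m A i)) = 0 := by
    intro i
    rw [pderivDer_tvar, if_neg]
    simp [u, v]
  have hVV : ∑ q' : Fin m with q' < p, logDer (pderivDer (v M q j)) (D.symVV m p q') = 0 := by
    refine Finset.sum_eq_zero fun q' hq' => ?_
    simp only [symVV, logDer_sum, logDer_fpow, map_sub, hv p le_rfl,
      hv q' (Finset.mem_filter.1 hq').2.le]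
    simp
  simp only [symBlock, logDer_add, logDer_sum, hVV]
  simp only [symTheta, symVU, logDer_add, logDer_sum, logDer_fpow, map_sub, hv p le_rfl, hu,
    Derivation.map_cst]
  simp

theorem v_injective (p : Fin m) : Function.Injective fun j : Fin A => v M p j :=
  fun j j' h => by simpa [v] using h

/-- Each factor `(v_j(p) - t)^a` of the symbol contributes `v_j(p) a / (v_j(p) - t)` to the Euler
factor, and the factors `(v_i(p) - v_j(p))^{e_{ij}}`, which are homogeneous, contribute `b`. -/
theorem one_add_logDer_symBlock (p : Fin m) :
    1 + logDer (eulerDer fun j => v M p j) (D.symBlock m p) =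
      D.eulerFactor m p (Finset.univ.filter (· < p)) := by
  have hv : ∀ i : Fin A, eulerDer (fun j => v M p j) (tvar (v M p i)) = tvar (v M p i) :=
    eulerDer_tvar (v_injective p)
  have hv' : ∀ q < p, ∀ i : Fin A, eulerDer (fun j => v M p j) (tvar (v M q i)) = 0 := by
    intro q hq i
    refine eulerDer_tvar_of_notMem fun j h => ?_
    simp only [v, Sum.inr.injEq, Prod.mk.injEq] at h
    exact hq.ne' h.1
  have hu : ∀ i, eulerDer (fun j => v M p j) (tvar (u m A i)) = 0 :=
    fun i => eulerDer_tvar_of_notMem fun j => by simp [u, v]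
  have hθ : logDer (eulerDer fun j => v M p j) (D.symTheta m p) =
      ∑ j, tvar (v M p j) * ∑ s, D.kernZ m s (v M p j) + cst D.numB := by
    simp only [symTheta, logDer_add, logDer_sum, logDer_fpow, map_sub, hv, Derivation.map_cst,
      sub_zero, numB, cst_sum]
    congr 1
    · refine Finset.sum_congr rfl fun j _ => ?_
      rw [Finset.mul_sum]
      exact Finset.sum_congr rfl fun s _ => by rw [kernZ, div_eq_mul_inv]; ring
    · refine Finset.sum_congr rfl fun i _ => Finset.sum_congr rfl fun j hj => ?_
      rw [inv_mul_cancel₀, mul_one]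
      · rfl
      · rw [sub_ne_zero]
        exact fun h => (Finset.mem_filter.1 hj).2.ne' (v_injective p (tvar_injective h))
  have hVV : ∑ q : Fin m with q < p, logDer (eulerDer fun j => v M p j) (D.symVV m p q) =
      ∑ j, tvar (v M p j) * ∑ q : Fin m with q < p, ∑ r, D.kern m (v M p j) (v M q r) := by
    simp only [Finset.mul_sum]
    rw [Finset.sum_comm]
    refine Finset.sum_congr rfl fun q hq => ?_
    simp only [symVV, logDer_sum, logDer_fpow, map_sub, hv, hv' q (Finset.mem_filter.1 hq).2,
      sub_zero]
    exact Finset.sum_congr rfl fun j _ => Finset.sum_congr rfl fun r _ => by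
      rw [kern, div_eq_mul_inv]; ring
  have hVU : logDer (eulerDer fun j => v M p j) (D.symVU m p) =
      ∑ j, tvar (v M p j) * ∑ i, D.kern m (v M p j) (u m A i) := by
    simp only [symVU, logDer_sum, logDer_fpow, map_sub, hv, hu, sub_zero, Finset.mul_sum]
    exact Finset.sum_congr rfl fun j _ => Finset.sum_congr rfl fun r _ => by
      rw [kern, div_eq_mul_inv]; ring
  have h1 : (cst 1 : RatField (ResVar M m A)) = 1 := map_one _
  rw [symBlock, logDer_add, logDer_add, logDer_sum, hθ, hVV, hVU, eulerFactor, cst_add, h1]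
  simp only [mul_add, Finset.sum_add_distrib]
  ring

theorem pderivDer_funAJ (hJ : Function.Injective D.seqJ) (hA : 0 < A) {p : Fin m}
    {y : ResVar M m A} (hy : ∀ j, v M p j ≠ y) : pderivDer y (D.funAJ m p) = 0 := by
  have hne : D.vList m p ≠ [] := by
    rw [← List.length_pos_iff]; simpa [vList] using hA
  rw [funAJ, funA_eq_treeFun]
  refine (Derivation.map_treeFun (pderivDer y) 0 hne fun a ha b hb => ?_).trans (by simp)
  obtain ⟨i, rfl⟩ := (mem_vList hJ).1 ha
  obtain ⟨j, rfl⟩ := (mem_vList hJ).1 hb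
  rw [Derivation.leibniz_div, map_sub, pderivDer_tvar, pderivDer_tvar, if_neg (hy i),
    if_neg (hy j), Derivation.map_cst]
  simp

/-- The function `A_J(v(p))` is homogeneous of degree `1 - A`. -/
theorem eulerDer_funAJ (hJ : Function.Injective D.seqJ) (hA : 0 < A) (p : Fin m) :
    eulerDer (fun j => v M p j) (D.funAJ m p) = (1 - (A : RatField (ResVar M m A))) *
      D.funAJ m p := by
  have hne : D.vList m p ≠ [] := by
    rw [← List.length_pos_iff]; simpa [vList] using hA
  have hlen : (D.vList m p).length = A := by simp [vList]
  rw [funAJ, funA_eq_treeFun]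
  refine (Derivation.map_treeFun (eulerDer fun j => v M p j) (-1) hne
    fun a ha b hb => ?_).trans ?_
  · obtain ⟨i, rfl⟩ := (mem_vList hJ).1 ha
    obtain ⟨j, rfl⟩ := (mem_vList hJ).1 hb
    rw [Derivation.leibniz_div, map_sub, eulerDer_tvar (v_injective p) i,
      eulerDer_tvar (v_injective p) j, Derivation.map_cst]
    simp only [smul_eq_mul, mul_zero, zero_sub]
    rcases eq_or_ne (tvar (v M p i) - tvar (v M p j)) 0 with h | h
    · simp [h]
    · field_simp
  · change _ = _ * treeFun _ (D.vList m p)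
    rw [hlen]
    ring

/-- The form `Ω_m` in terms of the Euler factors. In the product that defines it, the differentials
`du_i` and `dv_j(q)` with `q < p` in `Ω̃(p)` are killed by the forms that precede it. -/
theorem omega_eq (hJ : Function.Injective D.seqJ) (hA : 0 < A) (c : ℂ) :
    D.omega m c = tw (D.symL m) (c ^ m • (fnForm (symRat (D.col m) (D.prodB m *
      (∏ p, D.funAJ m p) * ∏ p, D.eulerFactor m p (Finset.univ.filter (· < p)))) *
        (du M m A * dv M m A))) := by
  let η : Fin m → RatForm (ResVar M m A) := fun p =>
    deRham (fnForm (D.funAJ m p) * nuForm fun j => v M p j) +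
      dlogForm (D.symBlock m p) * (fnForm (D.funAJ m p) * nuForm fun j => v M p j)
  have hfac : ∀ p, D.omegaFactor m c p = tw (D.symBlock m p) (c • η p) := by
    intro p
    rw [omegaFactor, twD_tw, tw, AddMonoidAlgebra.smul_single]
    rfl
  let F : Fin m → RatField (ResVar M m A) := fun p =>
    cst c * (D.funAJ m p * D.eulerFactor m p (Finset.univ.filter (· < p)))
  have hprod : du M m A * (List.ofFn fun p => c • η p).prod =
      fnForm (∏ p, F p) * (du M m A * dv M m A) := by
    refine mul_prod_ofFn_congr _ _ _ _ fun p => ?_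
    rw [prod_map_dvar_varWord fun q : Fin p => q.castLE p.2.le, fnForm_mul, mul_assoc (fnForm _),
      fnForm_cst, mul_smul_comm, mul_smul_comm]
    congr 1
    refine (mul_twisted_nuForm _ _ _ (fun y hy => pderivDer_funAJ hJ hA hy) fun y hy => ?_).trans ?_
    · have hzero : y ∈ varWord M A (fun q : Fin p => q.castLE p.2.le) →
          ((varWord M A fun q : Fin p => q.castLE p.2.le).map dvar).prod * dvar y = 0 :=
        prod_map_mul_eq_zero dvar_mul_comm dvar_mul_self
      rcases y with i | ⟨q, j⟩
      · exact Or.inr (hzero (mem_varWord.2 (Or.inl ⟨i, rfl⟩)))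
      · rcases lt_trichotomy q p with h | rfl | h
        · exact Or.inr (hzero (mem_varWord.2 (Or.inr ⟨⟨q, h⟩, j, rfl⟩)))
        · exact absurd rfl (hy j)
        · exact Or.inl (logDer_symBlock_of_lt h j)
    · rw [← one_add_logDer_symBlock, eulerDer_funAJ hJ hA]
      congr 3
      ring
  have hdudv : du M m A * dv M m A = ((varWord M A (id : Fin m → Fin m)).map dvar).prod :=
    prod_map_dvar_varWord id
  have hF : ∏ p, F p = cst (c ^ m) * ((∏ p, D.funAJ m p) *
      ∏ p, D.eulerFactor m p (Finset.univ.filter (· < p))) := by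
    simp only [F, Finset.prod_mul_distrib, Finset.prod_const, Finset.card_univ, Fintype.card_fin]
    congr 1
    exact (map_pow _ _ _).symm
  simp only [omega, omegaTilde, hfac]
  rw [prod_ofFn_tw, tw_mul_tw, symU_add_sum_symBlock, mul_assoc, hprod, ← mul_assoc, ← fnForm_mul,
    hdudv, skewTw_tw _ _ _ nodup_varWord, hF, mul_left_comm, symRat_cst_mul, fnForm_mul, mul_assoc,
    fnForm_cst, mul_assoc (D.prodB m)]
  rintro (i | ⟨q, j⟩)
  · exact mem_varWord.2 (Or.inl ⟨i, rfl⟩)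
  · exact mem_varWord.2 (Or.inr ⟨q, j, rfl⟩)

end ResData

end

theorem mainTheorem3
    {𝔤 : Type*} [LieRing 𝔤] [LieAlgebra ℂ 𝔤] [FiniteDimensional ℂ 𝔤] [LieAlgebra.IsSimple ℂ 𝔤]
    {H : LieSubalgebra ℂ 𝔤} [H.IsCartanSubalgebra]
    {ι : Type*} [Fintype ι] [DecidableEq ι] (b : LieAlgebra.Basis ι H)
    (θ : H.root) (a : ι → ℕ) (hθ : IsHighestRootWith b θ a)
    (κ : ℂ) (hκ : κ ≠ 0)
    {n : ℕ} (Λ : Fin n → Module.Dual ℂ H) (z : Fin n → ℂ) (hz : Function.Injective z)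
    {M : ℕ} (π₁ : Fin M → ι)
    {A : ℕ} (π₂ : Fin A → ι) (hπ₂ : ∀ i, (Finset.univ.filter fun j => π₂ j = i).card = a i)
    (I : Fin n → List (Fin M)) (hI_nodup : ∀ s, (I s).Nodup)
    (hI_disj : ∀ s s', s ≠ s' → List.Disjoint (I s) (I s')) (hI_cover : ∀ j, ∃ s, j ∈ I s)
    (Iθ : Fin A → ι) (cθ : ℂ) (hcθ : cθ ≠ 0)
    (fθ : 𝔤) (hfθ_ne : fθ ≠ 0)
    (hfθ_root : fθ ∈ LieAlgebra.rootSpace H (-(θ.1 : H → ℂ)))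
    (hfθ : fθ = cθ • iterBracket (List.ofFn fun p => b.f (Iθ p)))
    (J : Fin A → Fin A) (hJ : Function.Injective J) (hJθ : ∀ p, π₂ (J p) = Iθ p)
    (D : ResData ι n M A) (hD : D = lieResData b θ κ Λ z π₁ π₂ I J)
    (m : ℕ) (hm : 1 ≤ m) :
    D.omega m cθ =
      tw (D.symL m) ((cθ ^ m / (m.factorial : ℂ)) •
        (fnForm (symRat (D.col m)
          (D.prodB m * (∏ p : Fin m, D.funAJ m p) *
            ∑ i ∈ Finset.range (m + 1),
              cst (∏ j ∈ Finset.Icc (i + 1) m, D.constC j) * D.funW m i)) *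
        (ResData.du M m A * ResData.dv M m A))) := by
  subst hD
  -- the empty commutator is zero
  have hA : 0 < A := by
    refine Nat.pos_of_ne_zero fun h => hfθ_ne ?_
    subst h
    rw [hfθ, List.ofFn_zero]
    exact smul_zero _
  have hsymm : ∀ i j, (lieResData b θ κ Λ z π₁ π₂ I J).ex i j =
      (lieResData b θ κ Λ z π₁ π₂ I J).ex j i := fun i j =>
    congrArg (· / κ) (normForm_symm _ _)
  have hT := ResData.treesVanish_lieResData (m := m) hθ hκ Λ z π₁ π₂ hπ₂ I Iθ hcθ hfθ_root hfθ
    hJ hJθ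
  have hkey := hT.symRat_prod_eulerFactor hsymm hJ hA hI_nodup hI_disj hI_cover
  rw [ResData.omega_eq (D := lieResData b θ κ Λ z π₁ π₂ I J) hJ hA, ← hkey]
  have hfac : (m.factorial : ℂ) ≠ 0 := Nat.cast_ne_zero.2 m.factorial_ne_zero
  have hcst : (m.factorial : RatField (ResVar M m A)) = cst (m.factorial : ℂ) :=
    (map_natCast (algebraMap ℂ (RatField (ResVar M m A))) _).symm
  rw [hcst, fnForm_mul, mul_assoc (fnForm _), fnForm_cst, smul_smul, div_mul_cancel₀ _ hfac]
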